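/- **Conventions.** Let $V=(V,Y,\mathbf 1,\omega)$ be a vertex operator algebra over $\mathbb C$ of central charge $\mathbf c$, with modes $Y(v,x)=\sum_{n\in\mathbb Z}v(n)x^{-n-1}$ and $L(n)=\omega(n+1)$. Its square-bracket modes are defined by $Y(e^{xL(0)}v,e^x-1)=\sum_{n\in\mathbb Z}v[n]x^{-n-1}$. Let $M$ be a $V$-module, $M=\bigoplus_{N\ge 0}M_{\lambda+N}$ with $M_{\lambda+N}$ the finite-dimensional $L(0)$-eigenspace of eigenvalue $\lambda+N$. For $v$ homogeneous of weight $k$ put $o(v)=v(k-1)$, and extend linearly. Let $h_1,\dots,h_m\in V_1$ be linearly independent with $h_i(0)h_j=0$ for all $i,j$, and such that each $h_j(0)$ acts semisimply on $M$ with integer eigenvalues. Let $\underline z\in\mathbb C^m$ and $\zeta_j=e^{2\pi i z_j}$. For $v_1,\dots,v_n\in V$ let $$J(v_1,\dots,v_n)=\operatorname{tr}_M Y(q_1^{L(0)}v_1,q_1)\cdots Y(q_n^{L(0)}v_n,q_n)\,\zeta_1^{h_1(0)}\cdots\zeta_m^{h_m(0)}q^{L(0)-\mathbf c/24},$$ and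 let $J^{o(v)}(v_1,\dots,v_n)$ be the same trace with $o(v)$ inserted to the left of all the vertex operators. Both are formal series: $q^{\lambda-\mathbf c/24}$ times a power series in $q$ in each monomial in the $q_i^{\pm1}$. Their values at $\tau$ in the upper half-plane and $w_1,\dots,w_n\in\mathbb C$ are obtained by $q=e^{2\pi i\tau}$, $q_i=e^{w_i}$. For $Z\in\mathbb C$, $\zeta=e^{2\pi iZ}$ and $k\ge1$ let $$\tilde P_k(w,\tau,Z)=\frac1{(k-1)!}\sum_{\ell\in\mathbb Z}\frac{\ell^{k-1}e^{w\ell}}{1-\zeta^{-1}q^\ell}\qquad(|q|<|e^w|<1),$$ $$\tilde E_k(\tau,Z)=c_k+\frac1{(k-1)!}\sum_{\ell\ge1}\ell^{k-1}\left(\frac{\zeta^{-1}q^\ell}{1-\zeta^{-1}q^\ell}+(-1)^k\frac{\zeta q^\ell}{1-\zeta q^\ell}\right),$$ where $c_1=\frac1{1-\zeta^{-1}}-\frac12$, $c_k=2(2\pi i)^{-k}\sum_{n\ge1}n^{-k}$ for even $k$, and $c_k=0$ for odd $k\ge3$. If $Z\in\mathbb Z$, the term $\ell=0$ of $\tilde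 P_k$ and the term $\frac1{1-\zeta^{-1}}$ of $c_1$ are left out. As formal series, $\tilde E_k$ and the coefficient of each $e^{w\ell}$ in $\tilde P_k$ are expanded in non-negative powers of $q$. **Statement.** Let $v\in V$ with $h_j(0)v=\mu_jv$, $\mu_j\in\mathbb C$, for $1\le j\le m$. Put $Z=\underline z\cdot\underline\mu=\sum_jz_j\mu_j$, and let $\delta_{Z,\mathbb Z}$ be $1$ if $Z\in\mathbb Z$ and $0$ otherwise. (a) For $n\ge0$ and $v_1,\dots,v_n\in V$, with $v$ inserted at $q_0=e^{w_0}$, $$J(v,v_1,\dots,v_n)=\delta_{Z,\mathbb Z}\,J^{o(v)}(v_1,\dots,v_n)+\sum_{s=1}^n\sum_{k\ge0}\tilde P_{k+1}(w_s-w_0,\tau,Z)\,J(v_1,\dots,v[k]v_s,\dots,v_n).$$ (b) For $n\ge1$, $v_1,\dots,v_n\in V$ and $p\ge1$, $$\begin{aligned}J(v[-p]v_1,v_2,\dots,v_n)={}&\delta_{Z,\mathbb Z}\,\delta_{p,1}\,J^{o(v)}(v_1,\dots,v_n)\\&+(-1)^{p+1}\sum_{k\ge0}\binom{k+p-1}{p-1}\tilde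 E_{k+p}(\tau,Z)\,J(v[k]v_1,v_2,\dots,v_n)\\&+(-1)^{p+1}\sum_{s=2}^n\sum_{k\ge0}\binom{k+p-1}{p-1}\tilde P_{k+p}(w_s-w_1,\tau,Z)\,J(v_1,\dots,v[k]v_s,\dots,v_n).\end{aligned}$$ Both hold as identities of formal series in $q$ and the $q_i^{\pm1}$. They also hold as identities of complex numbers at every point $(\tau,w)$ such that $Z\notin(\mathbb Z+\mathbb Z\tau)\setminus\mathbb Z$, such that $|q|<|e^{w_s-w_0}|<1$ for $1\le s\le n$ in (a), respectively $|q|<|e^{w_s-w_1}|<1$ for $2\le s\le n$ in (b), and at which the series of all $(n+1)$-point functions in (a), respectively of all $n$-point functions in (b), converge absolutely. The sums over $k$ are finite. -/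

import Mathlib

noncomputable section

namespace JacobiTrace

open scoped Classical

/-! ### Vertex operator algebras and their modules -/

/-- The Jacobi identity in component form (Borcherds' identity), for states of `V` acting on `M`:
`∑ᵢ C(p,i) (u(r+i)v)(p+q-i) = ∑ᵢ (-1)ⁱ C(r,i) (u(p+r-i) v(q+i) - (-1)ʳ v(q+r-i) u(p+i))`.
All the sums are finite on each vector. -/
def BorcherdsIdentity {V M : Type*} [AddCommGroup V] [Module ℂ V] [AddCommGroup M] [Module ℂ M]
    (Y : V →ₗ[ℂ] VertexOperator ℂ V) (YM : V →ₗ[ℂ] VertexOperator ℂ M) : Prop :=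
  ∀ (u v : V) (x : M) (p q r : ℤ),
    ∑ᶠ i : ℕ, Ring.choose p i •
        VertexOperator.ncoeff (YM (VertexOperator.ncoeff (Y u) (r + i) v)) (p + q - i) x =
      ∑ᶠ i : ℕ, ((-1 : ℤ) ^ i * Ring.choose r i) •
        (VertexOperator.ncoeff (YM u) (p + r - i) (VertexOperator.ncoeff (YM v) (q + i) x) -
          ((-1 : ℂ) ^ r) •
            VertexOperator.ncoeff (YM v) (q + r - i) (VertexOperator.ncoeff (YM u) (p + i) x))

/-- A vertex operator algebra structure `(V, Y, 𝟏, ω)` of central charge `c` on `V`.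
The `n`-th mode `v(n)`, i.e. the coefficient of `z^(-n-1)` in `Y(v, z)`, is
`VertexOperator.ncoeff (Y v) n`, and `L(n) = ω(n+1)`. -/
structure VOA (V : Type*) [AddCommGroup V] [Module ℂ V] where
  Y : V →ₗ[ℂ] VertexOperator ℂ V
  vac : V
  omega : V
  c : ℂ
  vac_mode : ∀ n : ℤ, VertexOperator.ncoeff (Y vac) n = if n = -1 then 1 else 0
  mode_vac : ∀ (v : V) (n : ℤ), 0 ≤ n → VertexOperator.ncoeff (Y v) n vac = 0
  mode_neg_one_vac : ∀ v : V, VertexOperator.ncoeff (Y v) (-1) vac = v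
  borcherds : BorcherdsIdentity Y Y
  virasoro : ∀ (i j : ℤ) (x : V),
    VertexOperator.ncoeff (Y omega) (i + 1) (VertexOperator.ncoeff (Y omega) (j + 1) x) -
      VertexOperator.ncoeff (Y omega) (j + 1) (VertexOperator.ncoeff (Y omega) (i + 1) x) =
      ((i : ℂ) - j) • VertexOperator.ncoeff (Y omega) (i + j + 1) x +
        (if i + j = 0 then ((i : ℂ) ^ 3 - i) / 12 * c else 0) • x
  /-- `Y(L(-1)v, z) = d/dz Y(v, z)`. -/
  translation : ∀ (v : V) (n : ℤ),
    VertexOperator.ncoeff (Y (VertexOperator.ncoeff (Y omega) 0 v)) n =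
      (-(n : ℂ)) • VertexOperator.ncoeff (Y v) (n - 1)
  /-- `V` is the direct sum of the eigenspaces `V_n` of `L(0)`, `n ∈ ℤ`. -/
  grading : DirectSum.IsInternal
    fun n : ℤ => Module.End.eigenspace (VertexOperator.ncoeff (Y omega) 1) (n : ℂ)
  finite : ∀ n : ℤ, FiniteDimensional ℂ
    (Module.End.eigenspace (VertexOperator.ncoeff (Y omega) 1) (n : ℂ))
  bounded : ∃ N : ℤ, ∀ n < N,
    Module.End.eigenspace (VertexOperator.ncoeff (Y omega) 1) (n : ℂ) = ⊥

/-- An (ordinary) module for the vertex operator algebra `A`: the space `M` is the direct sum of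
the finite-dimensional eigenspaces of `L(0)` with eigenvalues `wt + N`, `N = 0, 1, 2, …`. -/
structure VOAModule {V : Type*} [AddCommGroup V] [Module ℂ V] (A : VOA V)
    (M : Type*) [AddCommGroup M] [Module ℂ M] where
  Y : V →ₗ[ℂ] VertexOperator ℂ M
  vac_mode : ∀ n : ℤ, VertexOperator.ncoeff (Y A.vac) n = if n = -1 then 1 else 0
  borcherds : BorcherdsIdentity A.Y Y
  /-- The conformal weight. -/
  wt : ℂ
  grading : DirectSum.IsInternal
    fun N : ℕ => Module.End.eigenspace (VertexOperator.ncoeff (Y A.omega) 1) (wt + N)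
  finite : ∀ N : ℕ, FiniteDimensional ℂ
    (Module.End.eigenspace (VertexOperator.ncoeff (Y A.omega) 1) (wt + N))

/-- The projection onto the `i`-th summand of an internal direct sum. -/
def proj {ι M : Type*} [DecidableEq ι] [AddCommGroup M] [Module ℂ M] {S : ι → Submodule ℂ M}
    (hS : DirectSum.IsInternal S) (i : ι) : M →ₗ[ℂ] S i :=
  DirectSum.component ℂ ι (fun i => S i) i ∘ₗ
    (LinearEquiv.ofBijective (DirectSum.coeLinearMap S) hS).symm.toLinearMap

/-- `exp(2πi z T)` for a semisimple operator `T` with integer eigenvalues: the operator that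
acts on the `t`-eigenspace of `T` as `ζᵗ = exp(2πi z t)`. -/
def zetaPow {M : Type*} [AddCommGroup M] [Module ℂ M] {T : Module.End ℂ M}
    (hT : DirectSum.IsInternal fun t : ℤ => T.eigenspace (t : ℂ)) (z : ℂ) : Module.End ℂ M :=
  DirectSum.toModule ℂ ℤ M
      (fun t => Complex.exp (2 * Real.pi * Complex.I * z * t) • (T.eigenspace (t : ℂ)).subtype) ∘ₗ
    (LinearEquiv.ofBijective
      (DirectSum.coeLinearMap fun t : ℤ => T.eigenspace (t : ℂ)) hT).symm.toLinearMap

namespace VOA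

variable {V : Type*} [AddCommGroup V] [Module ℂ V] (A : VOA V)

/-- The mode `v(n)` acting on `V`. -/
def mode (v : V) (n : ℤ) : Module.End ℂ V := VertexOperator.ncoeff (A.Y v) n

/-- The component of `v` of conformal weight `k`. -/
def homog (k : ℤ) (v : V) : V := (proj A.grading k v : V)

/-- The coefficient of `z^(-j-1)` in the Laurent series `e^(kz) (e^z - 1)^(-n-1)`. -/
def sqCoeff (k n j : ℤ) : ℂ :=
  (((PowerSeries.exp ℂ : PowerSeries ℂ) : LaurentSeries ℂ) ^ k *
    ((PowerSeries.exp ℂ - 1 : PowerSeries ℂ) : LaurentSeries ℂ) ^ (-n - 1)).coeff (-j - 1)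

/-- The square bracket mode `v[j]`, applied to `u`. The modes are defined by
`Y[v, z] = Y(e^(z L(0)) v, e^z - 1) = ∑ⱼ v[j] z^(-j-1)`; for `v` of weight `k` this gives
`v[j] = ∑ₙ sqCoeff k n j • v(n)`. -/
def sq (v : V) (j : ℤ) (u : V) : V :=
  ∑ᶠ k : ℤ, ∑ᶠ n : ℤ, sqCoeff k n j • A.mode (A.homog k v) n u

end VOA

/-- Condition H for `h₁, …, h_m ∈ V₁` with respect to the module `X`. -/
structure ConditionH {V M : Type*} [AddCommGroup V] [Module ℂ V] [AddCommGroup M] [Module ℂ M]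
    {A : VOA V} (X : VOAModule A M) {m : ℕ} (h : Fin m → V) : Prop where
  weight_one : ∀ j, A.mode A.omega 1 (h j) = h j
  linearIndependent : LinearIndependent ℂ h
  semisimple : ∀ j, DirectSum.IsInternal
    fun t : ℤ => Module.End.eigenspace (VertexOperator.ncoeff (X.Y (h j)) 0) (t : ℂ)
  commute : ∀ i j, A.mode (h i) 0 (h j) = 0

/-! ### Formal `n`-point functions

A formal function of `q₁, …, qₙ` and `q` is recorded by its coefficients: `F e` is the coefficient
of `q₁^(e 0) ⋯ qₙ^(e (n-1))`, a power series in `q`. The overall factor `q^(wt - c/24)` common to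
all the traces is left out of the formal series and put back in `VOAModule.value`. -/

/-- Formal series in `qᵢ^(±1)`, `i < n`, with coefficients in `ℂ[[q]]`. -/
abbrev Formal (n : ℕ) : Type := (Fin n → ℤ) → PowerSeries ℂ

namespace VOAModule

variable {V M : Type*} [AddCommGroup V] [Module ℂ V] [AddCommGroup M] [Module ℂ M]
  {A : VOA V} (X : VOAModule A M)

/-- The coefficient of `x^e` in `Y(x^(L(0)) v, x)`; for `v` of weight `k` it is `v(k-1-e)`. -/
def coefOp (v : V) (e : ℤ) : Module.End ℂ M :=
  ∑ᶠ k : ℤ, VertexOperator.ncoeff (X.Y (A.homog k v)) (k - 1 - e)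

/-- The zero mode `o(v)`; for `v` of weight `k` it is `v(k-1)`. -/
def zeroMode (v : V) : Module.End ℂ M := X.coefOp v 0

/-- The graded trace `tr_M T q^(L(0) - wt)`: the coefficient of `q^N` is the trace of the diagonal
block of `T` on the `L(0)`-eigenspace of eigenvalue `wt + N`. -/
def gradedTrace (T : Module.End ℂ M) : PowerSeries ℂ :=
  PowerSeries.mk fun N => LinearMap.trace ℂ _
    (proj X.grading N ∘ₗ T ∘ₗ
      (Module.End.eigenspace (VertexOperator.ncoeff (X.Y A.omega) 1) (X.wt + N)).subtype)

variable {X} {m : ℕ} {h : Fin m → V}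

/-- The operator `ζ₁^(h₁(0)) ⋯ ζ_m^(h_m(0))`, where `ζⱼ = exp(2πi zⱼ)`. -/
def zetaOp (hH : ConditionH X h) (z : Fin m → ℂ) : Module.End ℂ M :=
  (List.ofFn fun j => zetaPow (hH.semisimple j) (z j)).prod

/-- The `n`-point function
`tr_M Y(q₁^(L(0)) u₁, q₁) ⋯ Y(qₙ^(L(0)) uₙ, qₙ) ζ₁^(h₁(0)) ⋯ ζ_m^(h_m(0)) q^(L(0) - wt)`. -/
def nPoint (hH : ConditionH X h) (z : Fin m → ℂ) {n : ℕ} (u : Fin n → V) : Formal n :=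
  fun e => X.gradedTrace ((List.ofFn fun i => X.coefOp (u i) (e i)).prod * zetaOp hH z)

/-- The trace with an additional zero mode,
`tr_M o(v) Y(q₁^(L(0)) u₁, q₁) ⋯ Y(qₙ^(L(0)) uₙ, qₙ) ζ₁^(h₁(0)) ⋯ ζ_m^(h_m(0)) q^(L(0) - wt)`. -/
def zeroModePoint (hH : ConditionH X h) (z : Fin m → ℂ) (v : V) {n : ℕ} (u : Fin n → V) :
    Formal n :=
  fun e => X.gradedTrace
    (X.zeroMode v * (List.ofFn fun i => X.coefOp (u i) (e i)).prod * zetaOp hH z)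

end VOAModule

namespace Formal

/-- A formal function of `q₁, …, qₙ`, regarded as a function of `q₀, q₁, …, qₙ`. -/
def extend {n : ℕ} (F : Formal n) : Formal (n + 1) :=
  fun e => if e 0 = 0 then F (Fin.tail e) else 0

/-- The product of `F` with the series `∑_ℓ P(ℓ) (q_s/q_t)^ℓ`; in the cases of interest, for fixed
exponents of the `qᵢ` and of `q`, only finitely many `ℓ` contribute. -/
def mulRatio {n : ℕ} (P : ℤ → PowerSeries ℂ) (s t : Fin n) (F : Formal n) : Formal n :=
  fun e => PowerSeries.mk fun N =>
    ∑ᶠ l : ℤ, PowerSeries.coeff N (P l * F (e - Pi.single s l + Pi.single t l))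

/-- The term of `F`, times `q^a`, in which the `qᵢ` have exponents `r.1` and `q` has exponent
`r.2 + a`, evaluated at `qᵢ = exp(wᵢ)` and `q = exp(2πi τ)`. -/
def term {n : ℕ} (F : Formal n) (a : ℂ) (w : Fin n → ℂ) (τ : ℂ) (r : (Fin n → ℤ) × ℕ) : ℂ :=
  PowerSeries.coeff r.2 (F r.1) * Complex.exp (∑ i, r.1 i * w i) *
    Complex.exp (2 * Real.pi * Complex.I * τ * (r.2 + a))

end Formal

namespace VOAModule

variable {V M : Type*} [AddCommGroup V] [Module ℂ V] [AddCommGroup M] [Module ℂ M]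
  {A : VOA V} (X : VOAModule A M)

/-- The value of a trace function at `(w, τ)`, including the factor `q^(wt - c/24)`. -/
def value {n : ℕ} (F : Formal n) (w : Fin n → ℂ) (τ : ℂ) : ℂ :=
  ∑' r, F.term (X.wt - A.c / 24) w τ r

/-- All the `n`-point functions converge absolutely at `(w, τ)`. -/
def ConvergesAt {X : VOAModule A M} {m : ℕ} {h : Fin m → V} (hH : ConditionH X h)
    (z : Fin m → ℂ) {n : ℕ} (w : Fin n → ℂ) (τ : ℂ) : Prop :=
  ∀ u : Fin n → V, Summable ((nPoint hH z u).term (X.wt - A.c / 24) w τ)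

end VOAModule

/-! ### Twisted Weierstrass functions and twisted Eisenstein series

Throughout `ζ = exp(2πi Z)` and `q = exp(2πi τ)`. -/

/-- `Z` is an integer, i.e. `ζ = 1`. -/
def IsInt (Z : ℂ) : Prop := ∃ a : ℤ, Z = a

/-- `ζ = exp(2πi Z)`. -/
def zeta (Z : ℂ) : ℂ := Complex.exp (2 * Real.pi * Complex.I * Z)

/-- `1 / (1 - ζ⁻¹)`, to be left out if `ζ = 1`. -/
def zeroTerm (Z : ℂ) : ℂ := if IsInt Z then 0 else 1 / (1 - (zeta Z)⁻¹)

/-- The twisted Weierstrass function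
`P_k(w, Z, τ) = 1/(k-1)! ∑_{ℓ ∈ ℤ} ℓ^(k-1) e^(wℓ) / (1 - ζ⁻¹ q^ℓ)`, for `k ≥ 1` and
`|q| < |e^w| < 1`; the term `ℓ = 0` is left out if `ζ = 1`. -/
def twistedP (k : ℕ) (w Z τ : ℂ) : ℂ :=
  1 / ((k - 1).factorial : ℂ) * ∑' l : ℤ,
    if l = 0 then (0 : ℂ) ^ (k - 1) * zeroTerm Z
    else (l : ℂ) ^ (k - 1) * Complex.exp (w * l) /
      (1 - (zeta Z)⁻¹ * Complex.exp (2 * Real.pi * Complex.I * τ * l))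

/-- The constant term in `q` of the twisted Eisenstein series `E_k`. -/
def eisensteinConst (k : ℕ) (Z : ℂ) : ℂ :=
  if k = 1 then zeroTerm Z - 1 / 2
  else if Even k then 2 * riemannZeta k / (2 * Real.pi * Complex.I) ^ k
  else 0

/-- The twisted Eisenstein series `E_k(τ, Z)`, `k ≥ 1`. -/
def twistedE (k : ℕ) (τ Z : ℂ) : ℂ :=
  eisensteinConst k Z + 1 / ((k - 1).factorial : ℂ) * ∑' l : ℕ, ((l : ℂ) + 1) ^ (k - 1) *
    (Complex.exp (2 * Real.pi * Complex.I * τ * (l + 1)) * (zeta Z)⁻¹ /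
        (1 - Complex.exp (2 * Real.pi * Complex.I * τ * (l + 1)) * (zeta Z)⁻¹) +
      (-1) ^ k * (Complex.exp (2 * Real.pi * Complex.I * τ * (l + 1)) * zeta Z /
        (1 - Complex.exp (2 * Real.pi * Complex.I * τ * (l + 1)) * zeta Z)))

/-- The expansion in `ℂ[[q]]` of `a q^l / (1 - a q^l)`, for `l ≥ 1`. -/
def lambert (a : ℂ) (l : ℕ) : PowerSeries ℂ :=
  PowerSeries.C a * PowerSeries.X ^ l * (1 - PowerSeries.C a * PowerSeries.X ^ l)⁻¹

/-- The expansion of `P_k(w, Z, τ)`: the coefficient of `e^(wl)` as a power series in `q`, where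
`1 / (1 - ζ⁻¹ q^l)` is expanded as `-ζ q^(-l) / (1 - ζ q^(-l))` if `l < 0`. -/
def formalP (k : ℕ) (Z : ℂ) (l : ℤ) : PowerSeries ℂ :=
  PowerSeries.C ((l : ℂ) ^ (k - 1) / ((k - 1).factorial : ℂ)) *
    (if l = 0 then PowerSeries.C (zeroTerm Z)
    else if 0 < l then 1 + lambert (zeta Z)⁻¹ l.natAbs
    else -lambert (zeta Z) l.natAbs)

/-- The expansion of `E_k(τ, Z)` as a power series in `q`. (The `l`-th summand of the Lambert
series is divisible by `q^l`.) -/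
def formalE (k : ℕ) (Z : ℂ) : PowerSeries ℂ :=
  PowerSeries.C (eisensteinConst k Z) + PowerSeries.C (1 / ((k - 1).factorial : ℂ)) *
    PowerSeries.mk fun N => ∑ l ∈ Finset.Icc 1 N, PowerSeries.coeff N
      (PowerSeries.C ((l : ℂ) ^ (k - 1)) *
        (lambert (zeta Z)⁻¹ l + PowerSeries.C ((-1) ^ k) * lambert (zeta Z) l))

end JacobiTrace

end

/-! Write `v_a` for `X.coefOp v a`. It raises `L(0)` by `a`, and since each `h_j(0)` has eigenvalue
`μ_j` on `v`, moving `v_a` past the twist costs the factor `ζ = exp(2πi Z)`. Cyclicity of the trace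
then says that the trace of `[v_a, T]` is `1 - ζ⁻¹ q^(-a)` times the trace of `v_a T`
(`gradedTrace_coefOp_mul`). Dividing produces the kernel `1 / (1 - ζ⁻¹ q^ℓ)` at `ℓ = -a`. Division
fails only if `a = 0` and `ζ = 1`; there the trace of `o(v) T` simply remains, which is the
zero-mode term. The commutator of `v_a` with `u_b` is `∑ (-a)^j / j! (v[j]u)_(a+b)`
(`coefOp_commutator`), and `(-a)^j / j!` is the weight `ℓ^(k-1) / (k-1)!` of the Weierstrass series
with `k = j + 1`. Together these give (a). For (b) with `p = 1`, `coefOp_normalOrder` writes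
`v[-1]u`, corrected by Bernoulli multiples of the `v[j]u`, as a normally ordered product. Commuting
every `v` to the left reduces all terms to traces covered by (a). The slots `s ≥ 2` assemble into
Weierstrass series in `q_s / q_1`. In the first slot the kernels are summed over `ℓ` with the
commutator terms subtracted, and together with the Bernoulli numbers this is the Eisenstein series
(`coeff_formalE_succ`). Larger `p` follow by induction on replacing `v` by `L[-1]v`
(`nPoint_sq_neg`). For values, the difficulty is that `1 / (1 - ζ⁻¹ q^ℓ)` expanded in `q` may
diverge at the given point for finitely many `ℓ`. Multiplying by the finite product `denom`, which
does not vanish there, removes those denominators; all series then converge absolutely, and the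
product is cancelled at the end (`Formal.value_eq_of_denom`). If `Z` is an integer no clearing is
needed, and convergence of the zero-mode trace is itself a consequence of the formal identity. Sums
over square-bracket modes are finite with a cutoff depending on the states. Stating the lemmas for
all large cutoffs lets homogeneous components and several slots share one. -/

noncomputable section

namespace JacobiTrace

open scoped Classical

/-! ### Coefficients of `e^(kz) (e^z - 1)^(-n-1)` -/

/-- The Euler operator `z d/dz` on Laurent series. -/
def eulerOp (f : LaurentSeries ℂ) : LaurentSeries ℂ where
  coeff n := n * f.coeff n
  isPWO_support' := f.isPWO_support.mono fun n hn => by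
    simp only [Function.mem_support] at hn ⊢
    exact fun h => hn (by rw [h, mul_zero])

lemma coeff_eulerOp (f : LaurentSeries ℂ) (n : ℤ) : (eulerOp f).coeff n = n * f.coeff n := rfl

lemma support_eulerOp_subset (f : LaurentSeries ℂ) : (eulerOp f).support ⊆ f.support :=
  fun n hn => by
    simp only [HahnSeries.mem_support, coeff_eulerOp] at hn ⊢
    exact fun h => hn (by rw [h, mul_zero])

lemma eulerOp_mul (f g : LaurentSeries ℂ) :
    eulerOp (f * g) = eulerOp f * g + f * eulerOp g := by
  ext n
  -- Enlarging the supports to those of `f` and `g` puts all three products over the same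
  -- antidiagonal.
  rw [HahnSeries.coeff_add, coeff_eulerOp, HahnSeries.coeff_mul,
    HahnSeries.coeff_mul_left' f.isPWO_support (support_eulerOp_subset f),
    HahnSeries.coeff_mul_right' g.isPWO_support (support_eulerOp_subset g), Finset.mul_sum,
    ← Finset.sum_add_distrib]
  refine Finset.sum_congr rfl fun ij hij => ?_
  rw [Finset.mem_antidiagonal] at hij
  rw [coeff_eulerOp, coeff_eulerOp, ← hij.2.2]
  push_cast
  ring

lemma eulerOp_one : eulerOp 1 = 0 := by
  ext n
  rw [coeff_eulerOp, HahnSeries.coeff_one]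
  split_ifs with h <;> simp [h]

/-- Leibniz relates the exponents `n` and `n + 1`; the induction runs both ways, cancelling `f` on
the way down. -/
lemma eulerOp_zpow {f : LaurentSeries ℂ} (hf : f ≠ 0) (n : ℤ) :
    eulerOp (f ^ n) = n * f ^ (n - 1) * eulerOp f := by
  have step (n : ℤ) : eulerOp (f ^ (n + 1)) = eulerOp (f ^ n) * f + f ^ n * eulerOp f := by
    rw [zpow_add_one₀ hf, eulerOp_mul]
  induction n using Int.induction_on with
  | zero => simp [eulerOp_one]
  | succ i ih =>
    rw [step, ih, add_sub_cancel_right]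
    have : f ^ ((i : ℤ) - 1) * f = f ^ (i : ℤ) := by rw [← zpow_add_one₀ hf, sub_add_cancel]
    push_cast
    linear_combination (i * eulerOp f) * this
  | pred i ih =>
    have h1 := step (-(i : ℤ) - 1)
    rw [sub_add_cancel, ih] at h1
    have h2 : f ^ (-(i : ℤ) - 1) = f ^ (-(i : ℤ) - 1 - 1) * f := by
      rw [← zpow_add_one₀ hf, sub_add_cancel]
    apply mul_right_cancel₀ hf
    push_cast at h1 ⊢
    linear_combination -h1 - ((i : LaurentSeries ℂ) + 1) * eulerOp f * h2

/-- `e^z` as a Laurent series. -/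
def expL : LaurentSeries ℂ := ((PowerSeries.exp ℂ : PowerSeries ℂ) : LaurentSeries ℂ)

lemma coe_exp_sub_one :
    ((PowerSeries.exp ℂ - 1 : PowerSeries ℂ) : LaurentSeries ℂ) = expL - 1 := by
  rw [PowerSeries.coe_sub, PowerSeries.coe_one, expL]

lemma coeff_expL_natCast (n : ℕ) : expL.coeff n = 1 / (n.factorial : ℂ) := by
  simp [expL, PowerSeries.coeff_coe, PowerSeries.coeff_exp]

lemma coeff_expL_of_neg {n : ℤ} (hn : n < 0) : expL.coeff n = 0 := by
  simp [expL, PowerSeries.coeff_coe, hn]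

lemma expL_ne_zero : expL ≠ 0 := by
  intro h
  have := coeff_expL_natCast 0
  simp [h] at this

lemma expL_sub_one_ne_zero : expL - 1 ≠ 0 := by
  intro h
  have := congrArg (fun f : LaurentSeries ℂ => f.coeff (1 : ℕ)) h
  simp only [HahnSeries.coeff_sub, coeff_expL_natCast, HahnSeries.coeff_one] at this
  simp at this

lemma coeff_single_one_mul (f : LaurentSeries ℂ) (n : ℤ) :
    (HahnSeries.single 1 1 * f).coeff n = f.coeff (n - 1) := by
  have := HahnSeries.coeff_single_mul_add (r := (1 : ℂ)) (x := f) (a := n - 1) (b := (1 : ℤ))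
  rwa [sub_add_cancel, one_mul] at this

lemma eulerOp_expL : eulerOp expL = HahnSeries.single 1 1 * expL := by
  ext n
  rw [coeff_eulerOp, coeff_single_one_mul]
  rcases lt_trichotomy n 0 with hn | rfl | hn
  · rw [coeff_expL_of_neg hn, coeff_expL_of_neg (by lia), mul_zero]
  · rw [coeff_expL_of_neg (n := 0 - 1) (by norm_num)]; simp
  · obtain ⟨k, rfl⟩ : ∃ k : ℕ, n = k + 1 := ⟨(n - 1).toNat, by lia⟩
    have := coeff_expL_natCast (k + 1)
    push_cast at this
    rw [this, add_sub_cancel_right, coeff_expL_natCast, Nat.factorial_succ]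
    push_cast
    field_simp

lemma eulerOp_expL_sub_one : eulerOp (expL - 1) = HahnSeries.single 1 1 * expL := by
  rw [← eulerOp_expL]
  ext n
  rw [coeff_eulerOp, coeff_eulerOp, HahnSeries.coeff_sub, HahnSeries.coeff_one]
  split_ifs with h <;> simp [h]

namespace VOA

lemma sqCoeff_eq (k n j : ℤ) :
    sqCoeff k n j = (expL ^ k * (expL - 1) ^ (-n - 1)).coeff (-j - 1) := by
  rw [sqCoeff, coe_exp_sub_one, expL]

/-- The derivative of `e^(kz) (e^z - 1)^(-n-1)`, in terms of coefficients. -/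
lemma sqCoeff_derivative (k n j : ℤ) :
    -(n + 1) * sqCoeff (k + 1) (n + 1) j + k * sqCoeff k n j = -j * sqCoeff k n (j - 1) := by
  have h := congrArg (fun f : LaurentSeries ℂ => f.coeff (-j))
    (eulerOp_mul (expL ^ k) ((expL - 1) ^ (-n - 1)))
  -- The coefficient of `z^(-j)` belongs to index `j - 1`; the factor `z` pulled out on the right
  -- moves that side to index `j`.
  have e : eulerOp (expL ^ k) * (expL - 1) ^ (-n - 1) + expL ^ k * eulerOp ((expL - 1) ^ (-n - 1)) =
      HahnSeries.single 1 1 * (HahnSeries.C (k : ℂ) * (expL ^ k * (expL - 1) ^ (-n - 1)) +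
        HahnSeries.C (-(n + 1) : ℂ) * (expL ^ (k + 1) * (expL - 1) ^ (-(n + 1) - 1))) := by
    rw [eulerOp_zpow expL_ne_zero, eulerOp_zpow expL_sub_one_ne_zero, eulerOp_expL,
      eulerOp_expL_sub_one, zpow_add_one₀ expL_ne_zero,
      show expL ^ k = expL ^ (k - 1) * expL by rw [← zpow_add_one₀ expL_ne_zero, sub_add_cancel],
      show -n - 1 - 1 = -(n + 1) - 1 by ring]
    simp only [map_neg, map_add, map_intCast, map_one]
    push_cast
    ring
  simp only [e, coeff_eulerOp] at h
  rw [coeff_single_one_mul, HahnSeries.coeff_add, HahnSeries.C_mul_eq_smul,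
    HahnSeries.C_mul_eq_smul, HahnSeries.coeff_smul, HahnSeries.coeff_smul] at h
  rw [sqCoeff_eq, sqCoeff_eq, sqCoeff_eq, show -(j - 1) - 1 = -j by ring]
  simp only [smul_eq_mul] at h
  push_cast at h
  rw [h]; ring

end VOA

/-- The convolution is finite because `P` has no negative powers and `g` has none from degree `m -
K` downwards. -/
lemma coeff_coe_mul {P : PowerSeries ℂ} {g : LaurentSeries ℂ} {m : ℤ} {K : ℕ}
    (hg : ∀ i : ℕ, K ≤ i → g.coeff (m - i) = 0) :
    ((P : LaurentSeries ℂ) * g).coeff m =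
      ∑ i ∈ Finset.range K, PowerSeries.coeff i P * g.coeff (m - i) := by
  have hP (i : ℕ) : (P : LaurentSeries ℂ).coeff (i : ℤ) = PowerSeries.coeff i P := by
    simp [PowerSeries.coeff_coe]
  have hneg (i : ℤ) (hi : (P : LaurentSeries ℂ).coeff i ≠ 0) : 0 ≤ i := by
    by_contra h
    exact hi (by simp [PowerSeries.coeff_coe, not_le.mp h])
  rw [HahnSeries.coeff_mul]
  refine Finset.sum_bij_ne_zero (fun ij _ _ => ij.1.toNat) ?_ ?_ ?_ ?_
  · intro ij hij hne
    rw [Finset.mem_antidiagonal] at hij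
    have h0 := hneg _ hij.1
    rw [Finset.mem_range]
    by_contra hK
    apply hij.2.1
    have := hg ij.1.toNat (by lia)
    rwa [Int.toNat_of_nonneg h0, show m - ij.1 = ij.2 by lia] at this
  · intro a ha _ b hb _ hab
    rw [Finset.mem_antidiagonal] at ha hb
    have h0 := hneg _ ha.1
    have h1 := hneg _ hb.1
    ext <;> lia
  · intro i hi hne
    refine ⟨(i, m - i), ?_, ?_, by simp⟩
    · rw [Finset.mem_antidiagonal]
      refine ⟨?_, ?_, by simp⟩
      · simp only [HahnSeries.mem_support, hP]; exact left_ne_zero_of_mul hne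
      · exact right_ne_zero_of_mul hne
    · simpa [hP] using hne
  · intro ij hij _
    rw [Finset.mem_antidiagonal] at hij
    have h0 := hneg _ hij.1
    conv_lhs => rw [← Int.toNat_of_nonneg h0, hP]
    rw [Int.toNat_of_nonneg h0, show m - ij.1 = ij.2 by lia]

lemma expL_zpow (k : ℤ) :
    expL ^ k = ((PowerSeries.rescale (k : ℂ) (PowerSeries.exp ℂ) : PowerSeries ℂ) :
      LaurentSeries ℂ) := by
  have step (k : ℤ) : ((PowerSeries.rescale ((k + 1 : ℤ) : ℂ) (PowerSeries.exp ℂ) :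
      PowerSeries ℂ) : LaurentSeries ℂ) =
      ((PowerSeries.rescale (k : ℂ) (PowerSeries.exp ℂ) : PowerSeries ℂ) : LaurentSeries ℂ) *
        expL := by
    have := PowerSeries.exp_mul_exp_eq_exp_add (k : ℂ) 1
    rw [PowerSeries.rescale_one, RingHom.id_apply] at this
    rw [expL, ← PowerSeries.coe_mul, this]
    push_cast
    rfl
  induction k using Int.induction_on with
  | zero => simp [PowerSeries.rescale_zero]
  | succ i ih => rw [zpow_add_one₀ expL_ne_zero, ih, ← step]
  | pred i ih =>
    apply mul_right_cancel₀ expL_ne_zero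
    rw [← step, ← zpow_add_one₀ expL_ne_zero, sub_add_cancel, ih]

lemma coeff_rescale_exp (c : ℂ) (j : ℕ) :
    PowerSeries.coeff j (PowerSeries.rescale c (PowerSeries.exp ℂ)) = c ^ j / j.factorial := by
  simp [PowerSeries.coeff_rescale, PowerSeries.coeff_exp, div_eq_mul_inv]

/-- The coefficients `Bₙ / n!` of `z / (e^z - 1)`. -/
def bern (n : ℕ) : ℂ := PowerSeries.coeff n (bernoulliPowerSeries ℂ)

lemma inv_expL_sub_one : (expL - 1)⁻¹ =
    HahnSeries.single (-1) 1 * ((bernoulliPowerSeries ℂ : PowerSeries ℂ) : LaurentSeries ℂ) := by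
  have h := congrArg (fun P : PowerSeries ℂ => (P : LaurentSeries ℂ))
    (bernoulliPowerSeries_mul_exp_sub_one ℂ)
  simp only [PowerSeries.coe_mul, coe_exp_sub_one, PowerSeries.coe_X] at h
  apply inv_eq_of_mul_eq_one_left
  rw [mul_assoc, h, HahnSeries.single_mul_single]
  simp

/-- Both `(e^z - 1) / z` and its inverse, the Bernoulli series, are power series. -/
lemma exists_expL_sub_one_zpow (n : ℤ) :
    ∃ P : PowerSeries ℂ, (expL - 1) ^ n = HahnSeries.single n 1 * (P : LaurentSeries ℂ) := by
  obtain ⟨Q, hQ⟩ : ∃ Q : PowerSeries ℂ,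
      expL - 1 = HahnSeries.single 1 1 * (Q : LaurentSeries ℂ) := by
    obtain ⟨Q, hQ⟩ := (PowerSeries.X_dvd_iff (φ := PowerSeries.exp ℂ - 1)).mpr (by simp)
    exact ⟨Q, by rw [← coe_exp_sub_one, hQ, PowerSeries.coe_mul, PowerSeries.coe_X]⟩
  obtain ⟨k, rfl | rfl⟩ := n.eq_nat_or_neg
  · refine ⟨Q ^ k, ?_⟩
    rw [zpow_natCast, hQ, mul_pow, HahnSeries.single_pow, PowerSeries.coe_pow]
    simp
  · refine ⟨bernoulliPowerSeries ℂ ^ k, ?_⟩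
    rw [zpow_neg, zpow_natCast, ← inv_pow, inv_expL_sub_one, mul_pow, HahnSeries.single_pow,
      PowerSeries.coe_pow]
    simp

namespace VOA

/-- The Laurent series starts at `z^(-n-1)`. Hence `v[j]` involves only the `v(n)` with `n ≥ j`, and
is a finite sum on each vector. -/
lemma sqCoeff_of_lt {k n j : ℤ} (h : n < j) : sqCoeff k n j = 0 := by
  obtain ⟨P, hP⟩ := exists_expL_sub_one_zpow (-n - 1)
  rw [sqCoeff_eq, hP, expL_zpow, mul_left_comm, ← PowerSeries.coe_mul]
  have := HahnSeries.coeff_single_mul_add (r := (1 : ℂ)) (a := n - j) (b := -n - 1)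
    (x := ((PowerSeries.rescale (k : ℂ) (PowerSeries.exp ℂ) * P : PowerSeries ℂ) :
      LaurentSeries ℂ))
  rw [show n - j + (-n - 1) = -j - 1 by ring] at this
  rw [this, PowerSeries.coeff_coe, if_pos (by lia), mul_zero]

/-- Split off `e^(cz)` and take the residue. With `c = -a` this converts the binomials of the
commutator formula into the powers `(-a)^j / j!`. -/
lemma sqCoeff_add_zero (k c n : ℤ) {K : ℕ} (hK : n < K) :
    sqCoeff (k + c) n 0 = ∑ j ∈ Finset.range K, (c : ℂ) ^ j / j.factorial * sqCoeff k n j := by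
  have := coeff_coe_mul (P := PowerSeries.rescale (c : ℂ) (PowerSeries.exp ℂ))
    (g := expL ^ k * (expL - 1) ^ (-n - 1)) (m := -0 - 1) (K := K) fun i hi => by
      rw [show (-0 - 1 - i : ℤ) = -i - 1 by ring, ← sqCoeff_eq, sqCoeff_of_lt (by lia)]
  rw [sqCoeff_eq, zpow_add₀ expL_ne_zero, mul_comm (expL ^ k), mul_assoc, expL_zpow c, this]
  refine Finset.sum_congr rfl fun j _ => ?_
  rw [coeff_rescale_exp, sqCoeff_eq, show (-0 - 1 - j : ℤ) = -j - 1 by ring]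

/-- One factor `1 / (e^z - 1)`, expanded in Bernoulli numbers, is split off before taking the
residue. This is where the constant terms of the Eisenstein series originate. -/
lemma sqCoeff_succ_zero (k n : ℤ) {K : ℕ} (hK : n < K) :
    sqCoeff k (n + 1) 0 =
      sqCoeff k n (-1) + ∑ j ∈ Finset.range K, bern (j + 1) * sqCoeff k n j := by
  have := coeff_coe_mul (P := bernoulliPowerSeries ℂ)
    (g := expL ^ k * (expL - 1) ^ (-n - 1)) (m := 0) (K := K + 1) fun i hi => by
      rw [show (0 - i : ℤ) = -(i - 1 : ℤ) - 1 by ring, ← sqCoeff_eq, sqCoeff_of_lt (by lia)]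
  rw [Finset.sum_range_succ'] at this
  have h1 : expL ^ k * (expL - 1) ^ (-(n + 1) - 1) = HahnSeries.single (-1) 1 *
      (((bernoulliPowerSeries ℂ : PowerSeries ℂ) : LaurentSeries ℂ) *
        (expL ^ k * (expL - 1) ^ (-n - 1))) := by
    rw [show -(n + 1) - 1 = -n - 1 + -1 by ring, zpow_add₀ expL_sub_one_ne_zero, zpow_neg_one,
      inv_expL_sub_one]
    ring
  have h2 := HahnSeries.coeff_single_mul_add (r := (1 : ℂ)) (a := 0) (b := (-1 : ℤ))
    (x := ((bernoulliPowerSeries ℂ : PowerSeries ℂ) : LaurentSeries ℂ) *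
        (expL ^ k * (expL - 1) ^ (-n - 1)))
  rw [sqCoeff_eq, h1, show (-0 - 1 : ℤ) = 0 + -1 by ring, h2, this, one_mul, add_comm]
  congr 1
  · rw [sqCoeff_eq]
    simp [bernoulliPowerSeries]
  · refine Finset.sum_congr rfl fun j _ => ?_
    rw [sqCoeff_eq, bern, show (0 - ((j + 1 : ℕ) : ℤ)) = -j - 1 by push_cast; ring]

/-- Substitute `e^z = 1 + (e^z - 1)` for one factor. -/
lemma sqCoeff_pascal (k n j : ℤ) :
    sqCoeff (k + 1) (n + 1) j = sqCoeff k n j + sqCoeff k (n + 1) j := by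
  rw [sqCoeff_eq, sqCoeff_eq, sqCoeff_eq, ← HahnSeries.coeff_add,
    zpow_add_one₀ expL_ne_zero,
    show (expL - 1) ^ (-n - 1) = (expL - 1) ^ (-(n + 1) - 1) * (expL - 1) by
      rw [← zpow_add_one₀ expL_sub_one_ne_zero]; congr 1; ring]
  congr 1
  ring

/-- The residue of `e^((k+1)z) (e^z - 1)^(-n-1)`. -/
lemma sqCoeff_zero (k : ℤ) (n : ℕ) : sqCoeff (k + 1) n 0 = (Ring.choose k n : ℤ) := by
  induction n generalizing k with
  | zero =>
    have h := sqCoeff_succ_zero (k + 1) (-1) (K := 0) (by lia)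
    simp only [Finset.range_zero, Finset.sum_empty, add_zero] at h
    rw [show (-1 + 1 : ℤ) = 0 by norm_num] at h
    rw [Nat.cast_zero, h, sqCoeff_eq, expL_zpow]
    simp [PowerSeries.coeff_coe]
  | succ n ih =>
    have pas (k : ℤ) := sqCoeff_pascal (k + 1) n 0
    -- Here the series is a multiple of the derivative of `(e^z - 1)^(-n-1)`, so it has no residue.
    -- Pascal's rule then reaches every integer `k` in both directions.
    have h0 : sqCoeff (0 + 1) ((n : ℤ) + 1) 0 = 0 := by
      have := sqCoeff_derivative 0 n 0
      push_cast at this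
      simp only [zero_mul, add_zero, neg_zero, neg_mul, neg_eq_zero, mul_eq_zero] at this
      exact this.resolve_left (by exact_mod_cast Nat.succ_ne_zero n)
    push_cast
    induction k using Int.induction_on with
    | zero => rw [h0]; simp
    | succ i hi => rw [pas, hi, ih, Ring.choose_succ_succ]; push_cast; ring
    | pred i hi =>
      have h1 := pas (-i - 1)
      have h2 := Ring.choose_succ_succ (-i - 1 : ℤ) n
      rw [show (-i - 1 + 1 : ℤ) = -i by ring] at h1 h2 ⊢
      rw [hi] at h1
      have h3 := ih (-i - 1)
      rw [show (-i - 1 + 1 : ℤ) = -i by ring] at h3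
      rw [h3, h2] at h1
      push_cast at h1
      linear_combination -h1

end VOA

/-! ### Internal direct sums of eigenspaces -/

section Grading

variable {ι M : Type*} [DecidableEq ι] [AddCommGroup M] [Module ℂ M] {S : ι → Submodule ℂ M}

lemma internal_induction (hS : DirectSum.IsInternal S) {p : M → Prop}
    (hmem : ∀ i, ∀ x ∈ S i, p x) (hzero : p 0) (hadd : ∀ x y, p x → p y → p (x + y)) (x : M) :
    p x :=
  Submodule.iSup_induction S (motive := p) (by rw [hS.submodule_iSup_eq_top]; trivial) hmem hzero hadd

lemma decompose_of_mem (hS : DirectSum.IsInternal S) {i : ι} {x : M} (hx : x ∈ S i) :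
    (LinearEquiv.ofBijective (DirectSum.coeLinearMap S) hS).symm x =
      DirectSum.lof ℂ ι (fun i => S i) i ⟨x, hx⟩ := by
  rw [LinearEquiv.symm_apply_eq]
  exact (DirectSum.coeLinearMap_lof S i ⟨x, hx⟩).symm

lemma proj_of_mem (hS : DirectSum.IsInternal S) {i : ι} {x : M} (hx : x ∈ S i) :
    (proj hS i x : M) = x := by
  rw [proj, LinearMap.comp_apply, LinearEquiv.coe_coe, decompose_of_mem hS hx,
    DirectSum.component.lof_self]

lemma proj_of_mem_ne (hS : DirectSum.IsInternal S) {i j : ι} (hij : i ≠ j) {x : M}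
    (hx : x ∈ S i) : proj hS j x = 0 := by
  rw [proj, LinearMap.comp_apply, LinearEquiv.coe_coe, decompose_of_mem hS hx,
    DirectSum.component.of, dif_neg hij]

lemma finite_support_proj (hS : DirectSum.IsInternal S) (x : M) :
    (Function.support fun i => (proj hS i x : M)).Finite := by
  induction x using internal_induction hS with
  | hmem i x hx =>
    refine (Set.finite_singleton i).subset fun j hj => ?_
    by_contra h
    exact hj (by simp only [proj_of_mem_ne hS (fun hij => h hij.symm) hx, ZeroMemClass.coe_zero])
  | hzero => simp
  | hadd x y hx hy =>
    refine (hx.union hy).subset fun j hj => ?_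
    by_contra h
    simp only [Set.mem_union, Function.mem_support, not_or, not_not] at h
    exact hj (by simp only [map_add, Submodule.coe_add, h.1, h.2, add_zero])

lemma sum_proj (hS : DirectSum.IsInternal S) (x : M) :
    ∑ᶠ i, (proj hS i x : M) = x := by
  induction x using internal_induction hS with
  | hmem i x hx =>
    rw [finsum_eq_single _ i fun j hj => by
      rw [proj_of_mem_ne hS hj.symm hx, ZeroMemClass.coe_zero], proj_of_mem hS hx]
  | hzero => simp
  | hadd x y hx hy =>
    simp only [map_add, Submodule.coe_add]
    rw [finsum_add_distrib (finite_support_proj hS x) (finite_support_proj hS y), hx, hy]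

variable {T : Module.End ℂ M} {f : ι → ℂ}

/-- The components of an eigenvector with respect to the decomposition into eigenspaces. -/
lemma proj_eigenvector (hT : DirectSum.IsInternal fun i => T.eigenspace (f i)) {c : ℂ} {y : M}
    (hy : T y = c • y) {i : ι} (hi : f i ≠ c) : proj hT i y = 0 := by
  have key (x : M) : (proj hT i (T x) : M) = f i • (proj hT i x : M) := by
    induction x using internal_induction hT with
    | hmem j x hx =>
      rw [Module.End.mem_eigenspace_iff.mp hx, map_smul, Submodule.coe_smul]
      by_cases hij : j = i
      · subst hij; rfl
      · rw [proj_of_mem_ne hT hij hx]; simp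
    | hzero => simp
    | hadd x y hx hy => simp only [map_add, Submodule.coe_add, hx, hy, smul_add]
  have h := key y
  rw [hy, map_smul, Submodule.coe_smul, ← sub_eq_zero, ← sub_smul, smul_eq_zero] at h
  exact Subtype.ext (h.resolve_left (sub_ne_zero.mpr hi.symm))

lemma eq_zero_of_eigenvector (hT : DirectSum.IsInternal fun i => T.eigenspace (f i)) {c : ℂ}
    {y : M} (hy : T y = c • y) (hc : ∀ i, f i ≠ c) : y = 0 := by
  rw [← sum_proj hT y]
  simp [proj_eigenvector hT hy (hc _)]

end Grading

/-! ### Operators that shift the eigenvalues of another operator -/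

section Shift

variable {M : Type*} [AddCommGroup M] [Module ℂ M]

/-- `[S, T] = c T`, so that `T` maps the `s`-eigenspace of `S` into the `(s + c)`-eigenspace. -/
def IsShift (S : Module.End ℂ M) (c : ℂ) (T : Module.End ℂ M) : Prop :=
  ∀ x, S (T x) = T (S x) + c • T x

variable {S T U : Module.End ℂ M} {c : ℂ}

lemma IsShift.apply (h : IsShift S c T) {s : ℂ} {x : M} (hx : S x = s • x) :
    S (T x) = (s + c) • T x := by
  rw [h x, hx, map_smul, add_smul]

lemma IsShift.add (hT : IsShift S c T) (hU : IsShift S c U) : IsShift S c (T + U) := by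
  intro x
  simp only [LinearMap.add_apply, map_add, hT x, hU x, smul_add]
  abel

/-- `exp(2πi z T)` acts on eigenvectors of `T` as expected. -/
lemma zetaPow_apply (hT : DirectSum.IsInternal fun t : ℤ => T.eigenspace (t : ℂ)) (z : ℂ) {s : ℂ}
    {x : M} (hx : T x = s • x) :
    zetaPow hT z x = Complex.exp (2 * Real.pi * Complex.I * z * s) • x := by
  have key (t : ℤ) {y : M} (hy : y ∈ T.eigenspace (t : ℂ)) :
      zetaPow hT z y = Complex.exp (2 * Real.pi * Complex.I * z * t) • y := by
    rw [zetaPow, LinearMap.comp_apply, LinearEquiv.coe_coe, decompose_of_mem hT hy,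
      DirectSum.toModule_lof]
    rfl
  by_cases h : ∃ t : ℤ, (t : ℂ) = s
  · obtain ⟨t, rfl⟩ := h
    exact key t (Module.End.mem_eigenspace_iff.mpr hx)
  -- A non-integral eigenvalue `s` forces `x = 0`, so the formula needs no integrality. This matters
  -- because the shifts `μ_j` are arbitrary complex numbers.
  · rw [eq_zero_of_eigenvector hT hx fun t ht => h ⟨t, ht⟩]
    simp

/-- `exp(2πi z T) U = exp(2πi z c) U exp(2πi z T)` if `[T, U] = c U`. -/
lemma zetaPow_mul (hT : DirectSum.IsInternal fun t : ℤ => T.eigenspace (t : ℂ)) (z : ℂ)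
    (hU : IsShift T c U) :
    zetaPow hT z * U = Complex.exp (2 * Real.pi * Complex.I * z * c) • (U * zetaPow hT z) := by
  refine LinearMap.ext fun x => ?_
  induction x using internal_induction hT with
  | hmem t x hx =>
    have hx' := Module.End.mem_eigenspace_iff.mp hx
    rw [Module.End.mul_apply, zetaPow_apply hT z (hU.apply hx'), LinearMap.smul_apply,
      Module.End.mul_apply, zetaPow_apply hT z hx', map_smul, smul_smul, ← Complex.exp_add]
    congr 2
    ring
  | hzero => simp
  | hadd x y hx hy => rw [map_add, map_add, hx, hy]

end Shift

/-! ### Consequences of Borcherds' identity -/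

section Borcherds

variable {V M : Type*} [AddCommGroup V] [Module ℂ V] [AddCommGroup M] [Module ℂ M]

lemma exists_ncoeff_eq_zero (B : VertexOperator ℂ M) (x : M) :
    ∃ N : ℕ, ∀ n : ℤ, (N : ℤ) ≤ n → VertexOperator.ncoeff B n x = 0 :=
  ⟨(-HahnSeries.order ((HahnModule.of ℂ).symm (B x))).toNat, fun n hn =>
    VertexOperator.ncoeff_eq_zero_of_lt_order B n x (by lia)⟩

variable {Y : V →ₗ[ℂ] VertexOperator ℂ V} {YM : V →ₗ[ℂ] VertexOperator ℂ M}

/-- The case `r = 0`: since `C(0, i) = 0` for `i > 0`, one term survives on the right. -/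
lemma BorcherdsIdentity.commutator (hY : BorcherdsIdentity Y YM) (u v : V) (x : M) (p q : ℤ) :
    VertexOperator.ncoeff (YM u) p (VertexOperator.ncoeff (YM v) q x) -
      VertexOperator.ncoeff (YM v) q (VertexOperator.ncoeff (YM u) p x) =
    ∑ᶠ i : ℕ, Ring.choose p i •
      VertexOperator.ncoeff (YM (VertexOperator.ncoeff (Y u) i v)) (p + q - i) x := by
  have h := hY u v x p q 0
  simp only [zero_add, add_zero, zpow_zero, one_smul] at h
  rw [h, finsum_eq_single _ 0 fun i hi => by
    obtain ⟨k, rfl⟩ := Nat.exists_eq_succ_of_ne_zero hi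
    rw [Nat.succ_eq_add_one, Ring.choose_zero_succ, mul_zero, zero_smul]]
  simp

lemma neg_one_pow_mul_choose (r : ℕ) (i : ℕ) :
    (-1 : ℤ) ^ i * Ring.choose (-(r : ℤ)) i = Ring.multichoose (r : ℤ) i := by
  rw [Ring.choose_neg, ← Ring.multichoose_eq, Units.smul_def, smul_eq_mul, ← mul_assoc,
    Int.coe_negOnePow_natCast, ← mul_pow]
  simp

/-- The case `r = -1`, where every `(-1)^i C(-1, i)` equals `1`; the right side is a normally
ordered product. -/
lemma BorcherdsIdentity.associativity (hY : BorcherdsIdentity Y YM) (u v : V) (x : M) (p q : ℤ) :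
    ∑ᶠ i : ℕ, Ring.choose p i •
      VertexOperator.ncoeff (YM (VertexOperator.ncoeff (Y u) (i - 1) v)) (p + q - i) x =
    ∑ᶠ i : ℕ,
      (VertexOperator.ncoeff (YM u) (p - 1 - i) (VertexOperator.ncoeff (YM v) (q + i) x) +
        VertexOperator.ncoeff (YM v) (q - 1 - i) (VertexOperator.ncoeff (YM u) (p + i) x)) := by
  have h := hY u v x p q (-1)
  have hc (i : ℕ) : (-1 : ℤ) ^ i * Ring.choose (-1 : ℤ) i = 1 := by
    have := neg_one_pow_mul_choose 1 i
    rwa [Nat.cast_one, Ring.multichoose_one] at this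
  simp only [hc, one_smul, neg_add_eq_sub, zpow_neg_one, inv_neg, inv_one, neg_smul, sub_neg_eq_add,
    ← sub_eq_add_neg] at h
  exact h

/-- The case `p = 0`, `r = -2` with the vacuum as second state. Together with `translation_eq` it
yields the `L(-1)`-derivative property on modules, which is not among the axioms of `VOAModule`. -/
lemma BorcherdsIdentity.mode_neg_two_vac (hY : BorcherdsIdentity Y YM) {vac : V}
    (hvac : ∀ n : ℤ, VertexOperator.ncoeff (YM vac) n = if n = -1 then 1 else 0) (u : V) (q : ℤ) :
    VertexOperator.ncoeff (YM (VertexOperator.ncoeff (Y u) (-2) vac)) q =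
      (-(q : ℂ)) • VertexOperator.ncoeff (YM u) (q - 1) := by
  refine LinearMap.ext fun x => ?_
  have h := hY u vac x 0 q (-2)
  have hc (i : ℕ) : (-1 : ℤ) ^ i * Ring.choose (-2 : ℤ) i = i + 1 := by
    have := neg_one_pow_mul_choose 2 i
    rw [Nat.cast_ofNat, Ring.multichoose_two] at this
    exact_mod_cast this
  rw [finsum_eq_single _ 0 fun i hi => by
    obtain ⟨k, rfl⟩ := Nat.exists_eq_succ_of_ne_zero hi
    rw [Nat.succ_eq_add_one, Ring.choose_zero_succ, zero_smul]] at h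
  simp only [hc, Ring.choose_zero_right, one_smul, Nat.cast_zero, add_zero, zero_add, sub_zero,
    hvac] at h
  rw [h, LinearMap.smul_apply]
  -- A vacuum mode is nonzero only at index `-1`: this index is met once in the first product if `q
  -- < 0`, once in the second if `q > 0`, and never if `q = 0`.
  rcases lt_trichotomy q 0 with hq | rfl | hq
  · obtain ⟨k, rfl⟩ : ∃ k : ℕ, q = -1 - k := ⟨(-1 - q).toNat, by lia⟩
    rw [finsum_eq_single _ k fun i hi => by
      rw [if_neg (by lia), if_neg (by lia)]; simp]
    rw [if_pos (by lia), if_neg (by lia), show (-2 - k : ℤ) = -1 - k - 1 by ring,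
      Module.End.one_apply, LinearMap.zero_apply, smul_zero, sub_zero, ← Int.cast_smul_eq_zsmul ℂ]
    congr 1
    push_cast
    ring
  · simp only [Int.cast_zero, neg_zero, zero_smul]
    rw [finsum_eq_zero_of_forall_eq_zero]
    intro i
    rw [if_neg (by lia), if_neg (by lia)]; simp
  · obtain ⟨k, rfl⟩ : ∃ k : ℕ, q = k + 1 := ⟨(q - 1).toNat, by lia⟩
    rw [finsum_eq_single _ k fun i hi => by
      rw [if_neg (by lia), if_neg (by lia)]; simp]
    rw [if_neg (by lia), if_pos (by lia), add_sub_cancel_right, Module.End.one_apply,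
      LinearMap.zero_apply, map_zero, zero_sub, show ((-1 : ℂ) ^ (-2 : ℤ)) = 1 by norm_num,
      one_smul, smul_neg, ← Int.cast_smul_eq_zsmul ℂ, neg_smul]

end Borcherds

/-! ### Conformal weights and square-bracket modes on `V` -/

namespace VOA

variable {V : Type*} [AddCommGroup V] [Module ℂ V] (A : VOA V)

/-- `v` has conformal weight `k`. -/
def HasWt (k : ℤ) (v : V) : Prop := A.mode A.omega 1 v = (k : ℂ) • v

variable {A}

lemma HasWt.mem {k : ℤ} {v : V} (h : A.HasWt k v) :
    v ∈ Module.End.eigenspace (VertexOperator.ncoeff (A.Y A.omega) 1) (k : ℂ) :=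
  Module.End.mem_eigenspace_iff.mpr h

lemma homog_self {k : ℤ} {v : V} (h : A.HasWt k v) : A.homog k v = v :=
  proj_of_mem A.grading h.mem

lemma homog_of_ne {k l : ℤ} {v : V} (h : A.HasWt k v) (hl : l ≠ k) : A.homog l v = 0 := by
  rw [homog, proj_of_mem_ne A.grading hl.symm h.mem, ZeroMemClass.coe_zero]

lemma homog_add (k : ℤ) (u v : V) : A.homog k (u + v) = A.homog k u + A.homog k v := by
  simp only [homog, map_add, Submodule.coe_add]

lemma homog_smul (k : ℤ) (c : ℂ) (v : V) : A.homog k (c • v) = c • A.homog k v := by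
  simp only [homog, map_smul, Submodule.coe_smul]

lemma finite_support_homog (v : V) : (Function.support fun k => A.homog k v).Finite :=
  finite_support_proj A.grading v

variable (A) in
/-- To prove an additive property of states, it suffices to prove it for homogeneous ones. -/
lemma homog_induction {p : V → Prop} (hwt : ∀ k v, A.HasWt k v → p v)
    (hadd : ∀ u v, p u → p v → p (u + v)) (v : V) : p v := by
  refine internal_induction A.grading (fun k x hx => hwt k x (Module.End.mem_eigenspace_iff.mp hx))
    (hwt 0 0 ?_) hadd v
  simp [HasWt]

lemma mode_add_left (u v : V) (n : ℤ) : A.mode (u + v) n = A.mode u n + A.mode v n := by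
  simp only [mode, map_add, Pi.add_apply]

lemma mode_zero_left (n : ℤ) : A.mode 0 n = 0 := by
  simp only [mode, map_zero, Pi.zero_apply]

lemma mode_smul_left (c : ℂ) (v : V) (n : ℤ) : A.mode (c • v) n = c • A.mode v n := by
  simp only [mode, map_smul, Pi.smul_apply]

variable (A) in
lemma exists_mode_eq_zero (v u : V) : ∃ N : ℕ, ∀ n : ℤ, (N : ℤ) ≤ n → A.mode v n u = 0 :=
  exists_ncoeff_eq_zero _ _

variable (A) in
lemma finite_support_sq_term (k j : ℤ) (v u : V) :
    (Function.support fun n : ℤ => sqCoeff k n j • A.mode v n u).Finite := by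
  obtain ⟨N, hN⟩ := A.exists_mode_eq_zero v u
  refine (Set.finite_Ico j (N : ℤ)).subset fun n hn => ⟨?_, ?_⟩
  · by_contra h
    exact hn (by simp only [sqCoeff_of_lt (not_le.mp h), zero_smul])
  · by_contra h
    exact hn (by simp only [hN n (not_lt.mp h), smul_zero])

lemma sq_of_wt {k : ℤ} {v : V} (hv : A.HasWt k v) (j : ℤ) (u : V) :
    A.sq v j u = ∑ᶠ n : ℤ, sqCoeff k n j • A.mode v n u := by
  rw [sq, finsum_eq_single _ k fun l hl => by simp [homog_of_ne hv hl, mode_zero_left],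
    homog_self hv]

lemma finite_support_sq_homog (j : ℤ) (v u : V) :
    (Function.support fun k : ℤ => ∑ᶠ n : ℤ, sqCoeff k n j • A.mode (A.homog k v) n u).Finite := by
  refine (A.finite_support_homog v).subset fun k hk => ?_
  by_contra h
  simp only [Function.mem_support, not_not] at h
  exact hk (by simp [h, mode_zero_left])

lemma sq_add_left (v v' : V) (j : ℤ) (u : V) : A.sq (v + v') j u = A.sq v j u + A.sq v' j u := by
  simp only [sq]
  rw [← finsum_add_distrib (finite_support_sq_homog j v u) (finite_support_sq_homog j v' u)]
  refine finsum_congr fun k => ?_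
  rw [← finsum_add_distrib (finite_support_sq_term A k j _ u) (finite_support_sq_term A k j _ u)]
  simp [homog_add, mode_add_left]

lemma sq_add_right (v : V) (j : ℤ) (u u' : V) : A.sq v j (u + u') = A.sq v j u + A.sq v j u' := by
  simp only [sq]
  rw [← finsum_add_distrib (finite_support_sq_homog j v u) (finite_support_sq_homog j v u')]
  refine finsum_congr fun k => ?_
  rw [← finsum_add_distrib (finite_support_sq_term A k j _ u) (finite_support_sq_term A k j _ u')]
  simp

lemma sq_smul_left (c : ℂ) (v : V) (j : ℤ) (u : V) : A.sq (c • v) j u = c • A.sq v j u := by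
  simp only [sq, smul_finsum, homog_smul, mode_smul_left, LinearMap.smul_apply]
  simp only [smul_comm c]

/-- The square bracket modes `v[j]`, `j ≥ -p`, as finite sums. -/
lemma sq_eq_sum {k : ℤ} {v : V} (hv : A.HasWt k v) {u : V} {N : ℕ}
    (hN : ∀ n : ℤ, (N : ℤ) ≤ n → A.mode v n u = 0) (p : ℕ) {j : ℤ} (hj : -(p : ℤ) ≤ j) :
    A.sq v j u = ∑ i ∈ Finset.range (N + p), sqCoeff k (i - p) j • A.mode v (i - p) u := by
  rw [sq_of_wt hv, finsum_eq_sum_of_support_subset _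
    (s := (Finset.range (N + p)).map ⟨fun i : ℕ => (i : ℤ) - p, fun a b h => by simpa using h⟩),
    Finset.sum_map]
  · rfl
  · intro n hn
    have h1 : j ≤ n := by
      by_contra h
      exact hn (by simp only [sqCoeff_of_lt (not_le.mp h), zero_smul])
    have h2 : n < N := by
      by_contra h
      exact hn (by simp only [hN n (not_lt.mp h), smul_zero])
    simp only [Finset.coe_map, Set.mem_image, Finset.mem_coe, Finset.mem_range]
    refine ⟨(n + p).toNat, by lia, ?_⟩
    change ((n + p).toNat : ℤ) - p = n
    lia

variable (A) in
/-- `v[j] u = 0` if `j` is large. -/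
lemma eventually_sq_eq_zero (v u : V) : ∀ᶠ K : ℕ in Filter.atTop, ∀ j : ℕ, K ≤ j →
    A.sq v j u = 0 := by
  induction v using homog_induction A with
  | hwt k v hv =>
    obtain ⟨N, hN⟩ := A.exists_mode_eq_zero v u
    filter_upwards [Filter.eventually_ge_atTop N] with K hK j hj
    rw [sq_eq_sum hv hN 0 (by simp)]
    refine Finset.sum_eq_zero fun i hi => ?_
    rw [Finset.mem_range] at hi
    rw [sqCoeff_of_lt (by push_cast; lia), zero_smul]
  | hadd v v' h h' =>
    filter_upwards [h, h'] with K h h' j hj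
    rw [sq_add_left, h j hj, h' j hj, add_zero]

-- Compare the creation property of `L(-1)v` with the translation axiom at `n = -1`, both applied to
-- the vacuum.
variable (A) in
lemma translation_eq (v : V) : A.mode A.omega 0 v = A.mode v (-2) A.vac := by
  have h := A.translation v (-1)
  have h2 := A.mode_neg_one_vac (A.mode A.omega 0 v)
  rw [mode] at h2
  rw [h] at h2
  rw [mode, mode, ← h2]
  norm_num

/-- The modes of `L(-1) v`. -/
lemma mode_translate (v : V) (n : ℤ) :
    A.mode (A.mode A.omega 0 v) n = (-(n : ℂ)) • A.mode v (n - 1) :=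
  A.translation v n

end VOA

section Weight

variable {V M : Type*} [AddCommGroup V] [Module ℂ V] [AddCommGroup M] [Module ℂ M] {A : VOA V}

/-- In the commutator with `ω(1)` only `i = 0, 1` occur, namely `(L(-1)v)(n+1) = -(n+1) v(n)` and
`(L(0)v)(n) = k v(n)`. The derivative property is a hypothesis so that the lemma serves both `V`,
where it is an axiom, and `M`, where it is derived. -/
lemma isShift_mode {YM : V →ₗ[ℂ] VertexOperator ℂ M} (hY : BorcherdsIdentity A.Y YM)
    (htr : ∀ (v : V) (n : ℤ), VertexOperator.ncoeff (YM (A.mode A.omega 0 v)) n =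
      (-(n : ℂ)) • VertexOperator.ncoeff (YM v) (n - 1)) {k : ℤ} {v : V} (hv : A.HasWt k v)
    (n : ℤ) : IsShift (VertexOperator.ncoeff (YM A.omega) 1) ((k - n - 1 : ℤ) : ℂ)
      (VertexOperator.ncoeff (YM v) n) := by
  intro x
  have h := hY.commutator A.omega v x 1 n
  rw [finsum_eq_sum_of_support_subset _ (s := Finset.range 2)] at h
  · simp only [Finset.sum_range_succ, Finset.sum_range_zero, zero_add, Ring.choose_zero_right,
      Ring.choose_one_right, one_smul, Nat.cast_zero, Nat.cast_one, sub_zero] at h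
    have h0 := htr v (1 + n)
    have h1 : VertexOperator.ncoeff (A.Y A.omega) 1 v = (k : ℂ) • v := hv
    rw [VOA.mode] at h0
    rw [h0, h1, map_smul, map_smul, Pi.smul_apply, LinearMap.smul_apply, LinearMap.smul_apply,
      ← add_smul, sub_eq_iff_eq_add', add_sub_cancel_left] at h
    rw [h]
    congr 2
    push_cast
    ring
  · intro i hi
    simp only [Finset.coe_range, Set.mem_Iio]
    by_contra hlt
    refine hi ?_
    have : Ring.choose (1 : ℤ) i = 0 := by
      have := Ring.choose_natCast (R := ℤ) 1 i
      rw [Nat.cast_one] at this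
      rw [this, Nat.choose_eq_zero_of_lt (by lia), Nat.cast_zero]
    simp only [this, zero_smul]

lemma VOA.HasWt.mode {k l : ℤ} {v u : V} (hv : A.HasWt k v) (hu : A.HasWt l u) (n : ℤ) :
    A.HasWt (k + l - n - 1) (A.mode v n u) := by
  have h := (isShift_mode A.borcherds A.mode_translate hv n).apply hu
  rw [HasWt, VOA.mode, VOA.mode, h]
  congr 1
  push_cast
  ring

lemma VOA.HasWt.translate {k : ℤ} {v : V} (hv : A.HasWt k v) :
    A.HasWt (k + 1) (A.mode A.omega 0 v) := by
  have h1 : A.HasWt 0 A.vac := by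
    rw [HasWt, VOA.mode, A.mode_vac _ _ (by norm_num)]; simp
  have := hv.mode h1 (-2)
  rwa [← VOA.translation_eq, show k + 0 - -2 - 1 = k + 1 by ring] at this

end Weight

/-! ### The operators `coefOp v e` -/

namespace VOA

variable {V : Type*} [AddCommGroup V] [Module ℂ V] (A : VOA V)

/-- `L[-1] v = (L(-1) + L(0)) v`. -/
def sqTranslate (v : V) : V := A.mode A.omega 0 v + A.mode A.omega 1 v

variable {A}

/-- In generating form, `Y[L[-1]v, z] = d/dz Y[v, z]`; coefficientwise this is `sqCoeff_derivative`.
It drives the induction on `p`. -/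
lemma sq_sqTranslate (v : V) (j : ℤ) (u : V) :
    A.sq (A.sqTranslate v) j u = (-(j : ℂ)) • A.sq v (j - 1) u := by
  induction v using homog_induction A with
  | hwt k v hv =>
    have h1 : A.mode A.omega 1 v = (k : ℂ) • v := hv
    -- Mode `n + 1` of `L(-1)v` is a multiple of `v(n)`, so its sum is reindexed by one before the
    -- two are merged.
    rw [sqTranslate, sq_add_left, h1, sq_smul_left, sq_of_wt hv, sq_of_wt hv, sq_of_wt hv.translate,
      smul_finsum, smul_finsum, ← finsum_comp_equiv (Equiv.addRight (1 : ℤ)),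
      ← finsum_add_distrib]
    · refine finsum_congr fun n => ?_
      rw [Equiv.coe_addRight, mode_translate, add_sub_cancel_right, LinearMap.smul_apply, smul_smul,
        smul_smul, smul_smul, ← add_smul, ← sqCoeff_derivative]
      congr 1
      push_cast
      ring
    · refine ((finite_support_sq_term A (k + 1) j (A.mode A.omega 0 v) u).preimage
        (Equiv.addRight (1 : ℤ)).injective.injOn).subset fun n hn => hn
    · refine (finite_support_sq_term A k j v u).subset fun n hn h => hn ?_
      simp only [h, smul_zero]
  | hadd v v' h h' =>
    have : A.sqTranslate (v + v') = A.sqTranslate v + A.sqTranslate v' := by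
      simp only [sqTranslate, map_add]; abel
    rw [this, sq_add_left, sq_add_left, h, h', smul_add]

/-- `h(0)` commutes with `L(-1)` because `(L(-1)h)(0) = 0`, and with `L(0)` because `h` has weight
one. So `L[-1]v` has the same `μ`, hence the same `Z`. -/
lemma mode_zero_sqTranslate {h v : V} (hh : A.HasWt 1 h) {c : ℂ} (hv : A.mode h 0 v = c • v) :
    A.mode h 0 (A.sqTranslate v) = c • A.sqTranslate v := by
  have h0 := A.borcherds.commutator A.omega h v 0 0
  rw [finsum_eq_single _ 0 fun i hi => by
    obtain ⟨k, rfl⟩ := Nat.exists_eq_succ_of_ne_zero hi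
    rw [Nat.succ_eq_add_one, Ring.choose_zero_succ, zero_smul]] at h0
  have h1 := A.mode_translate h 0
  have h2 := isShift_mode A.borcherds A.mode_translate hh 0 v
  simp only [Int.cast_zero, neg_zero, zero_smul] at h1
  change A.mode A.omega 0 (A.mode h 0 v) - A.mode h 0 (A.mode A.omega 0 v) =
    _ • A.mode (A.mode A.omega 0 h) 0 v at h0
  change A.mode A.omega 1 (A.mode h 0 v) = A.mode h 0 (A.mode A.omega 1 v) + _ at h2
  simp only [h1, LinearMap.zero_apply, smul_zero, hv, map_smul, sub_eq_zero] at h0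
  simp only [sub_self, sub_zero, Int.cast_zero, zero_smul, hv, map_smul, add_zero] at h2
  rw [sqTranslate, map_add, ← h0, ← h2, smul_add]

/-- For weight one the coefficient of `h(n)` in `h[0]` is `C(0, n)`. -/
lemma sq_zero_of_wt_one {h : V} (hh : A.HasWt 1 h) (v : V) : A.sq h 0 v = A.mode h 0 v := by
  obtain ⟨N, hN⟩ := A.exists_mode_eq_zero h v
  rw [sq_eq_sum hh (N := N + 1) (fun n hn => hN n (by push_cast at hn; lia)) 0 (by simp)]
  rw [Finset.sum_eq_single 0]
  · have := sqCoeff_zero 0 0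
    simp only [zero_add, Nat.cast_zero, Ring.choose_zero_right, Int.cast_one] at this
    simp [this]
  · intro n _ hn
    have := sqCoeff_zero 0 n
    obtain ⟨k, rfl⟩ := Nat.exists_eq_succ_of_ne_zero hn
    rw [Nat.succ_eq_add_one, Ring.choose_zero_succ, Int.cast_zero, zero_add] at this
    simp only [Nat.succ_eq_add_one, Nat.cast_zero, sub_zero, this, zero_smul]
  · simp

end VOA

namespace VOAModule

variable {V M : Type*} [AddCommGroup V] [Module ℂ V] [AddCommGroup M] [Module ℂ M]
  {A : VOA V} (X : VOAModule A M)

lemma mode_translate (v : V) (n : ℤ) :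
    VertexOperator.ncoeff (X.Y (A.mode A.omega 0 v)) n =
      (-(n : ℂ)) • VertexOperator.ncoeff (X.Y v) (n - 1) := by
  rw [A.translation_eq, VOA.mode]
  exact X.borcherds.mode_neg_two_vac X.vac_mode v n

/-- The operator `L(0)` on `M`. -/
def L0 : Module.End ℂ M := VertexOperator.ncoeff (X.Y A.omega) 1

lemma coefOp_of_wt {k : ℤ} {v : V} (hv : A.HasWt k v) (e : ℤ) :
    X.coefOp v e = VertexOperator.ncoeff (X.Y v) (k - 1 - e) := by
  rw [coefOp, finsum_eq_single _ k fun l hl => by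
    simp only [VOA.homog_of_ne hv hl, map_zero, Pi.zero_apply], VOA.homog_self hv]

lemma finite_support_coefOp (v : V) (e : ℤ) : (Function.support fun k : ℤ =>
    VertexOperator.ncoeff (X.Y (A.homog k v)) (k - 1 - e)).Finite := by
  refine (A.finite_support_homog v).subset fun k hk h => hk ?_
  simp only [h, map_zero, Pi.zero_apply]

/-- `coefOp`, as a linear map in the state. -/
def coefOpL (e : ℤ) : V →ₗ[ℂ] Module.End ℂ M where
  toFun v := X.coefOp v e
  map_add' u v := by
    rw [coefOp, coefOp, coefOp,
      ← finsum_add_distrib (X.finite_support_coefOp u e) (X.finite_support_coefOp v e)]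
    simp [VOA.homog_add]
  map_smul' c v := by
    simp only [coefOp, smul_finsum, VOA.homog_smul, map_smul, Pi.smul_apply, RingHom.id_apply]

lemma coefOp_add (u v : V) (e : ℤ) : X.coefOp (u + v) e = X.coefOp u e + X.coefOp v e :=
  (X.coefOpL e).map_add u v

lemma coefOp_smul (c : ℂ) (v : V) (e : ℤ) : X.coefOp (c • v) e = c • X.coefOp v e :=
  (X.coefOpL e).map_smul c v

lemma coefOp_sum {ι : Type*} (s : Finset ι) (f : ι → V) (e : ℤ) :
    X.coefOp (∑ i ∈ s, f i) e = ∑ i ∈ s, X.coefOp (f i) e :=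
  map_sum (X.coefOpL e) f s

lemma coefOp_vac (e : ℤ) : X.coefOp A.vac e = if e = 0 then 1 else 0 := by
  have h1 : A.HasWt 0 A.vac := by
    rw [VOA.HasWt, VOA.mode, A.mode_vac _ _ (by norm_num)]; simp
  rw [X.coefOp_of_wt h1, X.vac_mode]
  congr 1
  simp

lemma isShift_coefOp (v : V) (e : ℤ) : IsShift X.L0 e (X.coefOp v e) := by
  induction v using VOA.homog_induction A with
  | hwt k v hv =>
    have := isShift_mode X.borcherds X.mode_translate hv (k - 1 - e)
    rwa [← X.coefOp_of_wt hv, show k - (k - 1 - e) - 1 = e by ring] at this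
  | hadd u v hu hv => rw [coefOp_add]; exact hu.add hv

/-- `L[-1]` acts as `x d/dx` on `Y(x^(L(0)) v, x)`. In particular `o(L[-1]v) = 0`, which is why the
zero-mode term is confined to `p = 1`. -/
lemma coefOp_sqTranslate (v : V) (e : ℤ) :
    X.coefOp (A.sqTranslate v) e = (e : ℂ) • X.coefOp v e := by
  induction v using VOA.homog_induction A with
  | hwt k v hv =>
    have h1 : A.mode A.omega 1 v = (k : ℂ) • v := hv
    rw [VOA.sqTranslate, coefOp_add, h1, coefOp_smul, X.coefOp_of_wt hv,
      X.coefOp_of_wt hv.translate, mode_translate, show k + 1 - 1 - e - 1 = k - 1 - e by ring,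
      ← add_smul]
    congr 1
    push_cast
    ring
  | hadd v v' h h' =>
    have : A.sqTranslate (v + v') = A.sqTranslate v + A.sqTranslate v' := by
      simp only [VOA.sqTranslate, map_add]; abel
    rw [this, coefOp_add, coefOp_add, h, h', smul_add]

/-- The commutator formula in terms of square bracket modes. -/
lemma coefOp_commutator (v u : V) : ∀ᶠ K : ℕ in Filter.atTop, ∀ a b : ℤ,
    X.coefOp v a * X.coefOp u b - X.coefOp u b * X.coefOp v a =
      ∑ j ∈ Finset.range K, ((-a : ℂ) ^ j / j.factorial) • X.coefOp (A.sq v j u) (a + b) := by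
  induction v using VOA.homog_induction A with
  | hwt k v hv =>
    induction u using VOA.homog_induction A with
    | hwt l u hu =>
      obtain ⟨N, hN⟩ := A.exists_mode_eq_zero v u
      filter_upwards [Filter.eventually_ge_atTop N] with K hK a b
      refine LinearMap.ext fun x => ?_
      rw [LinearMap.sub_apply, Module.End.mul_apply, Module.End.mul_apply, X.coefOp_of_wt hv,
        X.coefOp_of_wt hu, X.borcherds.commutator, finsum_eq_sum_of_support_subset _
          (s := Finset.range N)]
      · have hsq (j : ℕ) : ((-a : ℂ) ^ j / j.factorial) • X.coefOp (A.sq v j u) (a + b) x =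
            ∑ i ∈ Finset.range N, (((-a : ℤ) : ℂ) ^ j / j.factorial * VOA.sqCoeff k i j) •
              X.coefOp (A.mode v i u) (a + b) x := by
          rw [VOA.sq_eq_sum hv hN 0 (by simp), coefOp_sum, LinearMap.sum_apply, Finset.smul_sum,
            add_zero]
          simp only [Nat.cast_zero, sub_zero, coefOp_smul, LinearMap.smul_apply, smul_smul,
            Int.cast_neg]
        simp only [LinearMap.sum_apply, LinearMap.smul_apply, hsq]
        rw [Finset.sum_comm]
        refine Finset.sum_congr rfl fun i hi => ?_
        rw [Finset.mem_range] at hi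
        -- Borcherds' formula supplies `C(k-1-a, i)`, the residue of `e^((k-a)z) (e^z - 1)^(-i-1)`;
        -- splitting off `e^(-az)` gives the square-bracket modes.
        rw [← Finset.sum_smul, ← VOA.sqCoeff_add_zero k (-a) i (by lia : (i : ℤ) < K),
          show k + -a = k - 1 - a + 1 by ring, VOA.sqCoeff_zero, X.coefOp_of_wt (hv.mode hu i),
          Int.cast_smul_eq_zsmul, VOA.mode]
        congr 4
        ring_nf
      · intro i hi
        simp only [Finset.coe_range, Set.mem_Iio]
        by_contra h
        have := hN i (by lia)
        rw [VOA.mode] at this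
        exact hi (by simp [this])
    | hadd u u' h h' =>
      filter_upwards [h, h'] with K h h' a b
      simp only [VOA.sq_add_right, coefOp_add, smul_add, Finset.sum_add_distrib, ← h, ← h', mul_add,
        add_mul]
      abel
  | hadd v v' h h' =>
    filter_upwards [h, h'] with K h h' a b
    simp only [VOA.sq_add_left, coefOp_add, smul_add, Finset.sum_add_distrib, ← h, ← h', mul_add,
      add_mul]
    abel

/-- The normally ordered product, in terms of square bracket modes. -/
lemma coefOp_normalOrder (v u : V) : ∀ᶠ K : ℕ in Filter.atTop, ∀ (e : ℤ) (x : M),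
    ∀ᶠ L : ℕ in Filter.atTop,
      X.coefOp (A.sq v (-1) u) e x +
        ∑ j ∈ Finset.range K, bern (j + 1) • X.coefOp (A.sq v j u) e x =
      ∑ i ∈ Finset.range L, (X.coefOp v (1 + i) (X.coefOp u (e - 1 - i) x) +
        X.coefOp u (e + i) (X.coefOp v (-i) x)) := by
  induction v using VOA.homog_induction A with
  | hwt k v hv =>
    induction u using VOA.homog_induction A with
    | hwt l u hu =>
      obtain ⟨N, hN⟩ := A.exists_mode_eq_zero v u
      filter_upwards [Filter.eventually_ge_atTop N] with K hK e x
      obtain ⟨N₁, hN₁⟩ := exists_ncoeff_eq_zero (X.Y v) x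
      obtain ⟨N₂, hN₂⟩ := exists_ncoeff_eq_zero (X.Y u) x
      filter_upwards [Filter.eventually_ge_atTop (N₁ + N₂ + (1 - k).toNat + (e - l).toNat)]
        with L hL
      have h := X.borcherds.associativity v u x (k - 1) (l - e)
      rw [finsum_eq_sum_of_support_subset _ (s := Finset.range (N + 1)),
        finsum_eq_sum_of_support_subset _ (s := Finset.range L)] at h
      · have hR : ∑ i ∈ Finset.range L, (X.coefOp v (1 + i) (X.coefOp u (e - 1 - i) x) +
            X.coefOp u (e + i) (X.coefOp v (-i) x)) =
            ∑ i ∈ Finset.range L, (VertexOperator.ncoeff (X.Y v) (k - 1 - 1 - i)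
              (VertexOperator.ncoeff (X.Y u) (l - e + i) x) +
                VertexOperator.ncoeff (X.Y u) (l - e - 1 - i)
                  (VertexOperator.ncoeff (X.Y v) (k - 1 + i) x)) := by
          refine Finset.sum_congr rfl fun i _ => ?_
          rw [X.coefOp_of_wt hv, X.coefOp_of_wt hu, X.coefOp_of_wt hv, X.coefOp_of_wt hu,
            show k - 1 - (1 + i) = k - 1 - 1 - i by ring,
            show l - 1 - (e - 1 - i) = l - e + i by ring,
            show l - 1 - (e + i) = l - e - 1 - i by ring, show k - 1 - -i = k - 1 + (i : ℤ) by ring]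
        rw [hR, ← h, VOA.sq_eq_sum hv hN 1 (by simp), coefOp_sum, LinearMap.sum_apply]
        have hsq (j : ℕ) : bern (j + 1) • X.coefOp (A.sq v j u) e x =
            ∑ i ∈ Finset.range (N + 1), (bern (j + 1) * VOA.sqCoeff k (i - 1) j) •
              X.coefOp (A.mode v (i - 1) u) e x := by
          rw [VOA.sq_eq_sum hv hN 1 (by lia), coefOp_sum, LinearMap.sum_apply, Finset.smul_sum]
          simp only [Nat.cast_one, coefOp_smul, LinearMap.smul_apply, smul_smul]
        simp only [hsq]
        rw [Finset.sum_comm, ← Finset.sum_add_distrib]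
        refine Finset.sum_congr rfl fun i hi => ?_
        rw [Finset.mem_range] at hi
        -- `C(k-1, i)` is the residue of `e^(kz) (e^z - 1)^(-i-1)`; splitting off one factor `1 /
        -- (e^z - 1)` leaves `v[-1]` and the Bernoulli terms.
        have hc := VOA.sqCoeff_succ_zero k (i - 1) (by lia : (i : ℤ) - 1 < K)
        have hc2 := VOA.sqCoeff_zero (k - 1) i
        rw [sub_add_cancel] at hc hc2
        rw [← Finset.sum_smul, coefOp_smul, LinearMap.smul_apply, Nat.cast_one, ← add_smul, ← hc,
          hc2, X.coefOp_of_wt (hv.mode hu _), Int.cast_smul_eq_zsmul, VOA.mode]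
        congr 4
        ring_nf
      · intro i hi
        simp only [Finset.coe_range, Set.mem_Iio]
        by_contra hlt
        exact hi (by simp only [hN₁ (k - 1 + i) (by lia), hN₂ (l - e + i) (by lia), map_zero,
          add_zero])
      · intro i hi
        simp only [Finset.coe_range, Set.mem_Iio]
        by_contra hlt
        have := hN (i - 1) (by lia)
        rw [VOA.mode] at this
        exact hi (by simp [this])
    | hadd u u' h h' =>
      filter_upwards [h, h'] with K h h' e x
      filter_upwards [h e x, h' e x] with L h h'
      simp only [coefOp_add, VOA.sq_add_right, LinearMap.add_apply, map_add, smul_add,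
        Finset.sum_add_distrib] at h h' ⊢
      linear_combination (norm := abel) h + h'
  | hadd v v' h h' =>
    filter_upwards [h, h'] with K h h' e x
    filter_upwards [h e x, h' e x] with L h h'
    simp only [coefOp_add, VOA.sq_add_left, LinearMap.add_apply, map_add, smul_add,
      Finset.sum_add_distrib] at h h' ⊢
    linear_combination (norm := abel) h + h'

lemma coefOp_zero_of_wt_one {h : V} (hh : A.HasWt 1 h) :
    X.coefOp h 0 = VertexOperator.ncoeff (X.Y h) 0 := by
  rw [X.coefOp_of_wt hh]
  congr 1

/-- At `a = 0` only `j = 0` survives in `coefOp_commutator`, and `h[0]v = h(0)v`. -/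
lemma isShift_mode_zero {h v : V} (hh : A.HasWt 1 h) {c : ℂ} (hv : A.mode h 0 v = c • v) (e : ℤ) :
    IsShift (VertexOperator.ncoeff (X.Y h) 0) c (X.coefOp v e) := by
  intro x
  obtain ⟨K, hK⟩ := (X.coefOp_commutator h v).exists_forall_of_atTop
  have := hK (K + 1) (by lia) 0 e
  rw [Finset.sum_eq_single 0 (fun j _ hj => by simp [hj]) (by simp), Nat.cast_zero,
    VOA.sq_zero_of_wt_one hh, hv, coefOp_smul, X.coefOp_zero_of_wt_one hh] at this
  have := LinearMap.congr_fun this x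
  simp only [LinearMap.sub_apply, Module.End.mul_apply, LinearMap.smul_apply, zero_add] at this
  rw [← sub_eq_iff_eq_add', this]
  simp

end VOAModule

/-! ### Graded traces -/

namespace VOAModule

variable {V M : Type*} [AddCommGroup V] [Module ℂ V] [AddCommGroup M] [Module ℂ M]
  {A : VOA V} (X : VOAModule A M)

/-- The graded trace as a linear map. -/
def gradedTraceL : Module.End ℂ M →ₗ[ℂ] PowerSeries ℂ where
  toFun := X.gradedTrace
  map_add' T U := by
    ext N
    simp only [gradedTrace, PowerSeries.coeff_mk, map_add, LinearMap.add_comp, LinearMap.comp_add]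
  map_smul' c T := by
    ext N
    simp only [gradedTrace, PowerSeries.coeff_mk, map_smul, LinearMap.smul_comp,
      LinearMap.comp_smul, RingHom.id_apply]

lemma gradedTrace_add (T U : Module.End ℂ M) :
    X.gradedTrace (T + U) = X.gradedTrace T + X.gradedTrace U := X.gradedTraceL.map_add T U

lemma gradedTrace_sub (T U : Module.End ℂ M) :
    X.gradedTrace (T - U) = X.gradedTrace T - X.gradedTrace U := X.gradedTraceL.map_sub T U

lemma gradedTrace_smul (c : ℂ) (T : Module.End ℂ M) :
    X.gradedTrace (c • T) = PowerSeries.C c * X.gradedTrace T := by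
  rw [← PowerSeries.smul_eq_C_mul]
  exact X.gradedTraceL.map_smul c T

lemma gradedTrace_zero : X.gradedTrace 0 = 0 := X.gradedTraceL.map_zero

lemma gradedTrace_sum {ι : Type*} (s : Finset ι) (f : ι → Module.End ℂ M) :
    X.gradedTrace (∑ i ∈ s, f i) = ∑ i ∈ s, X.gradedTrace (f i) :=
  map_sum X.gradedTraceL f s

/-- Families of operators that eventually agree on each vector have eventually the same
coefficients in their graded traces. -/
lemma eventually_coeff_gradedTrace {ι : Type*} {F : Filter ι} {T U : ι → Module.End ℂ M}
    (h : ∀ x, ∀ᶠ i in F, T i x = U i x) (N : ℕ) :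
    ∀ᶠ i in F, ∀ n ≤ N, PowerSeries.coeff n (X.gradedTrace (T i)) =
      PowerSeries.coeff n (X.gradedTrace (U i)) := by
  have key (n : ℕ) : ∀ᶠ i in F, PowerSeries.coeff n (X.gradedTrace (T i)) =
      PowerSeries.coeff n (X.gradedTrace (U i)) := by
    have := X.finite n
    let b := Module.finBasis ℂ
      (Module.End.eigenspace (VertexOperator.ncoeff (X.Y A.omega) 1) (X.wt + n))
    -- Weight spaces are finite-dimensional, so agreement on finitely many basis vectors suffices.
    filter_upwards [Filter.eventually_all.mpr fun k => h (b k)] with i hi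
    simp only [gradedTrace, PowerSeries.coeff_mk]
    congr 1
    refine b.ext fun k => ?_
    simp only [LinearMap.comp_apply, Submodule.subtype_apply, hi]
  induction N with
  | zero =>
    filter_upwards [key 0] with i hi n hn
    rwa [Nat.le_zero.mp hn]
  | succ N ih =>
    filter_upwards [key (N + 1), ih] with i h1 h2 n hn
    rcases Nat.le_succ_iff.mp hn with h | rfl
    · exact h2 n h
    · exact h1

variable {X} {T : Module.End ℂ M} {a : ℤ}

lemma apply_eq_zero_of_shift (hT : IsShift X.L0 a T) {N : ℕ} (h : N + a < 0) {x : M}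
    (hx : X.L0 x = (X.wt + N) • x) : T x = 0 := by
  refine eq_zero_of_eigenvector X.grading (hT.apply hx) fun i hi => ?_
  have : ((i : ℤ) : ℂ) = ((N + a : ℤ) : ℂ) := by
    push_cast
    linear_combination hi
  have := Int.cast_injective this
  lia

lemma proj_shift (hT : IsShift X.L0 a T) {N N' : ℕ} (h : (N : ℤ) = N' + a) (x : M) :
    (proj X.grading N (T x) : M) = T (proj X.grading N' x) := by
  induction x using internal_induction X.grading with
  | hmem j x hx =>
    have hx' : X.L0 x = (X.wt + j) • x := Module.End.mem_eigenspace_iff.mp hx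
    have hTx := hT.apply hx'
    by_cases hj : j = N'
    · subst hj
      rw [proj_of_mem X.grading hx, proj_of_mem]
      refine Module.End.mem_eigenspace_iff.mpr (hTx.trans ?_)
      have : (N : ℂ) = j + a := by exact_mod_cast congrArg (Int.cast : ℤ → ℂ) h
      rw [this, add_assoc]
    · rw [proj_of_mem_ne X.grading hj hx, proj_eigenvector X.grading hTx]
      · simp
      · intro hi
        have : ((N : ℤ) : ℂ) = ((j + a : ℤ) : ℂ) := by
          push_cast
          linear_combination hi
        have := Int.cast_injective this
        lia
  | hzero => simp
  | hadd x y hx hy => simp only [map_add, Submodule.coe_add, hx, hy]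

lemma proj_shift_eq_zero (hT : IsShift X.L0 a T) {N : ℕ} (h : (N : ℤ) < a) (x : M) :
    proj X.grading N (T x) = 0 := by
  induction x using internal_induction X.grading with
  | hmem j x hx =>
    refine proj_eigenvector X.grading (hT.apply (Module.End.mem_eigenspace_iff.mp hx)) ?_
    intro hi
    have : ((N : ℤ) : ℂ) = ((j + a : ℤ) : ℂ) := by
      push_cast
      linear_combination hi
    have := Int.cast_injective this
    lia
  | hzero => simp
  | hadd x y hx hy => rw [map_add, map_add, hx, hy, add_zero]

/-- `T` carries weight space `N'` to `N`, and only `N'` contributes to `N`. The two traces are those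
of `BC` and `CB` for rectangular blocks between these spaces; the change of degree is the factor
`q^a` of the next two lemmas. -/
lemma coeff_gradedTrace_mul_comm (hT : IsShift X.L0 a T) {N N' : ℕ} (h : (N : ℤ) = N' + a)
    (U : Module.End ℂ M) :
    PowerSeries.coeff N (X.gradedTrace (T * U)) = PowerSeries.coeff N' (X.gradedTrace (U * T)) := by
  have := X.finite N
  have := X.finite N'
  let ι (n : ℕ) := (Module.End.eigenspace (VertexOperator.ncoeff (X.Y A.omega) 1)
    (X.wt + n)).subtype
  have h1 : proj X.grading N ∘ₗ (T * U) ∘ₗ ι N =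
      (proj X.grading N ∘ₗ T ∘ₗ ι N') ∘ₗ (proj X.grading N' ∘ₗ U ∘ₗ ι N) := by
    refine LinearMap.ext fun x => Subtype.ext ?_
    simp only [LinearMap.comp_apply, Module.End.mul_apply, ι, Submodule.subtype_apply]
    rw [← proj_shift hT h (U x), proj_of_mem X.grading (Subtype.coe_prop _)]
  have h2 : proj X.grading N' ∘ₗ (U * T) ∘ₗ ι N' =
      (proj X.grading N' ∘ₗ U ∘ₗ ι N) ∘ₗ (proj X.grading N ∘ₗ T ∘ₗ ι N') := by
    refine LinearMap.ext fun x => Subtype.ext ?_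
    simp only [LinearMap.comp_apply, Module.End.mul_apply, ι, Submodule.subtype_apply]
    rw [proj_shift hT h, proj_of_mem X.grading x.2]
  simp only [gradedTrace, PowerSeries.coeff_mk]
  rw [h1, h2, LinearMap.trace_comp_comm']

/-- Cyclicity, for operators that raise the weight. -/
lemma gradedTrace_mul_of_shift {a : ℕ} (hT : IsShift X.L0 a T) (U : Module.End ℂ M) :
    X.gradedTrace (T * U) = PowerSeries.X ^ a * X.gradedTrace (U * T) := by
  ext N
  have hT' : IsShift X.L0 ((a : ℤ) : ℂ) T := by exact_mod_cast hT
  rw [PowerSeries.coeff_X_pow_mul']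
  split_ifs with h
  · exact coeff_gradedTrace_mul_comm hT' (by lia) U
  · rw [gradedTrace, PowerSeries.coeff_mk]
    refine (congrArg _ (LinearMap.ext fun x => ?_)).trans (map_zero _)
    exact proj_shift_eq_zero hT' (by lia) _

/-- Cyclicity, for operators that lower the weight. -/
lemma gradedTrace_mul_of_shift_neg {a : ℕ} (hT : IsShift X.L0 (-a) T) (U : Module.End ℂ M) :
    X.gradedTrace (U * T) = PowerSeries.X ^ a * X.gradedTrace (T * U) := by
  ext N
  have hT' : IsShift X.L0 ((-a : ℤ) : ℂ) T := by exact_mod_cast hT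
  rw [PowerSeries.coeff_X_pow_mul']
  split_ifs with h
  · exact (coeff_gradedTrace_mul_comm hT' (by lia) U).symm
  · rw [gradedTrace, PowerSeries.coeff_mk]
    refine (congrArg _ (LinearMap.ext fun x => ?_)).trans (map_zero _)
    simp only [LinearMap.comp_apply, Module.End.mul_apply, Submodule.subtype_apply]
    rw [apply_eq_zero_of_shift hT' (by lia) (Module.End.mem_eigenspace_iff.mp x.2), map_zero,
      map_zero, LinearMap.zero_apply]

variable (X) in
lemma eventually_coefOp_apply_eq_zero (u : V) (x : M) :
    ∃ B : ℤ, ∀ b ≤ B, X.coefOp u b x = 0 := by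
  induction u using VOA.homog_induction A with
  | hwt k u hu =>
    obtain ⟨N, hN⟩ := exists_ncoeff_eq_zero (X.Y u) x
    exact ⟨k - 1 - N, fun b hb => by rw [X.coefOp_of_wt hu]; exact hN _ (by lia)⟩
  | hadd u v hu hv =>
    obtain ⟨B, hB⟩ := hu
    obtain ⟨C, hC⟩ := hv
    refine ⟨min B C, fun b hb => ?_⟩
    rw [coefOp_add, LinearMap.add_apply, hB b (by lia), hC b (by lia), add_zero]

end VOAModule

/-! ### Products of lists of operators -/

section ListProd

variable {R : Type*} [Ring R]

/-- The commutator with `T` is a derivation. -/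
lemma commutator_list_prod (T : R) {n : ℕ} (f : Fin n → R) :
    T * (List.ofFn f).prod - (List.ofFn f).prod * T =
      ∑ s, (List.ofFn (Function.update f s (T * f s - f s * T))).prod := by
  induction n with
  | zero => simp
  | succ n ih =>
    have h0 (y : R) : (List.ofFn (Function.update f 0 y)).prod =
        y * (List.ofFn fun i : Fin n => f i.succ).prod := by
      rw [List.ofFn_succ, List.prod_cons, Function.update_self]
      congr 3
    have hs (s : Fin n) (y : R) : (List.ofFn (Function.update f s.succ y)).prod =
        f 0 * (List.ofFn (Function.update (fun i : Fin n => f i.succ) s y)).prod := by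
      rw [List.ofFn_succ, List.prod_cons, Function.update_of_ne (Fin.succ_ne_zero s).symm]
      congr 3
      funext i
      by_cases h : i = s
      · subst h; simp
      · rw [Function.update_of_ne h, Function.update_of_ne (by simpa using h)]
    rw [Fin.sum_univ_succ, h0]
    simp only [hs]
    rw [← Finset.mul_sum, ← ih, List.ofFn_succ, List.prod_cons]
    noncomm_ring

lemma list_prod_mul_of_commute_smul {B : Type*} [Ring B] [Algebra ℂ B] {m : ℕ} {f : Fin m → B}
    {c : Fin m → ℂ} {U : B} (h : ∀ j, f j * U = c j • (U * f j)) :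
    (List.ofFn f).prod * U = (∏ j, c j) • (U * (List.ofFn f).prod) := by
  induction m with
  | zero => simp
  | succ m ih =>
    rw [List.ofFn_succ, List.prod_cons, mul_assoc, ih fun j => h j.succ, mul_smul_comm, ← mul_assoc,
      h 0, Fin.prod_univ_succ, smul_mul_assoc, smul_smul, mul_assoc, mul_comm (c 0)]

end ListProd

/-! ### The recursion for an additional point -/

/-- The expansion of `1 / (1 - ζ⁻¹ q^l)`, which is left out if `l = 0` and `ζ = 1`. -/
def kernelP (Z : ℂ) (l : ℤ) : PowerSeries ℂ :=
  if l = 0 then PowerSeries.C (zeroTerm Z)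
  else if 0 < l then 1 + lambert (zeta Z)⁻¹ l.natAbs
  else -lambert (zeta Z) l.natAbs

lemma formalP_eq (k : ℕ) (Z : ℂ) (l : ℤ) :
    formalP k Z l = PowerSeries.C ((l : ℂ) ^ (k - 1) / ((k - 1).factorial : ℂ)) * kernelP Z l := rfl

lemma zeta_ne_zero (Z : ℂ) : zeta Z ≠ 0 := Complex.exp_ne_zero _

lemma zeta_eq_one_iff (Z : ℂ) : zeta Z = 1 ↔ IsInt Z := by
  rw [zeta, Complex.exp_eq_one_iff, IsInt]
  refine exists_congr fun n => ?_
  have h : (2 * Real.pi * Complex.I : ℂ) ≠ 0 := Complex.two_pi_I_ne_zero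
  rw [mul_comm (n : ℂ)]
  exact mul_right_inj' h

lemma one_sub_mul_lambert (a : ℂ) {l : ℕ} (hl : l ≠ 0) :
    (1 - PowerSeries.C a * PowerSeries.X ^ l) * lambert a l =
      PowerSeries.C a * PowerSeries.X ^ l := by
  rw [lambert, mul_left_comm, PowerSeries.mul_inv_cancel, mul_one]
  simp [hl]

lemma one_sub_ne_zero (a : ℂ) {l : ℕ} (hl : l ≠ 0) :
    (1 - PowerSeries.C a * PowerSeries.X ^ l : PowerSeries ℂ) ≠ 0 := by
  intro h
  have := congrArg PowerSeries.constantCoeff h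
  simp [hl] at this

namespace VOAModule

variable {V M : Type*} [AddCommGroup V] [Module ℂ V] [AddCommGroup M] [Module ℂ M]
  {A : VOA V} (X : VOAModule A M) {n : ℕ}

/-- The coefficient of `∏ᵢ qᵢ^(eᵢ)` in the product of vertex operators of an `n`-point function. -/
def opProd (u : Fin n → V) (e : Fin n → ℤ) : Module.End ℂ M :=
  (List.ofFn fun i => X.coefOp (u i) (e i)).prod

lemma opProd_cons (v : V) (u : Fin n → V) (a : ℤ) (e : Fin n → ℤ) :
    X.opProd (Fin.cons v u : Fin (n + 1) → V) (Fin.cons a e : Fin (n + 1) → ℤ) =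
      X.coefOp v a * X.opProd u e := by
  rw [opProd, List.ofFn_succ, List.prod_cons]
  rfl

/-- Expressing the product through a multilinear map lets sums and scalars be pulled out of a single
slot. -/
lemma opProd_update (u : Fin n → V) (e : Fin n → ℤ) (s : Fin n) (w : V) (b : ℤ) :
    X.opProd (Function.update u s w) (e + Pi.single s b) =
      MultilinearMap.mkPiAlgebraFin ℂ n (Module.End ℂ M)
        (Function.update (fun i => X.coefOp (u i) (e i)) s (X.coefOp w (b + e s))) := by
  rw [opProd, MultilinearMap.mkPiAlgebraFin_apply]
  congr 2
  funext i
  by_cases h : i = s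
  · subst h; simp [add_comm]
  · simp [h]

lemma opProd_commutator (v : V) (u : Fin n → V) : ∀ᶠ K : ℕ in Filter.atTop, ∀ (a : ℤ)
    (e : Fin n → ℤ), X.coefOp v a * X.opProd u e - X.opProd u e * X.coefOp v a =
      ∑ s, ∑ j ∈ Finset.range K, ((-a : ℂ) ^ j / j.factorial) •
        X.opProd (Function.update u s (A.sq v j (u s))) (e + Pi.single s a) := by
  filter_upwards [Filter.eventually_all.mpr fun s => X.coefOp_commutator v (u s)] with K hK a e
  rw [opProd, commutator_list_prod]
  refine Finset.sum_congr rfl fun s _ => ?_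
  rw [hK s a (e s), ← MultilinearMap.mkPiAlgebraFin_apply (R := ℂ), MultilinearMap.map_update_sum]
  refine Finset.sum_congr rfl fun j _ => ?_
  rw [MultilinearMap.map_update_smul, opProd_update]

variable {X} {m : ℕ} {h : Fin m → V} (hH : ConditionH X h) (z : Fin m → ℂ)

lemma hasWt_one (hH : ConditionH X h) (j : Fin m) : A.HasWt 1 (h j) := by
  rw [VOA.HasWt, hH.weight_one, Int.cast_one, one_smul]

lemma nPoint_apply (u : Fin n → V) (e : Fin n → ℤ) :
    nPoint hH z u e = X.gradedTrace (X.opProd u e * zetaOp hH z) := rfl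

lemma zeroModePoint_apply (v : V) (u : Fin n → V) (e : Fin n → ℤ) :
    zeroModePoint hH z v u e =
      X.gradedTrace (X.coefOp v 0 * X.opProd u e * zetaOp hH z) := rfl

variable {v : V} {μ : Fin m → ℂ}

lemma zetaOp_mul_coefOp (hv : ∀ j, A.mode (h j) 0 v = μ j • v) (e : ℤ) :
    zetaOp hH z * X.coefOp v e =
      zeta (∑ j, z j * μ j) • (X.coefOp v e * zetaOp hH z) := by
  rw [zetaOp, list_prod_mul_of_commute_smul (c := fun j =>
    Complex.exp (2 * Real.pi * Complex.I * z j * μ j)) fun j =>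
      zetaPow_mul (hH.semisimple j) (z j) (X.isShift_mode_zero (hasWt_one hH j) (hv j) e),
    ← Complex.exp_sum, zeta, Finset.mul_sum]
  simp only [mul_assoc]

/-- The trace of `coefOp v a * T` is determined by that of the commutator. -/
lemma gradedTrace_coefOp_mul (hv : ∀ j, A.mode (h j) 0 v = μ j • v) (a : ℤ)
    (T : Module.End ℂ M) :
    X.gradedTrace (X.coefOp v a * T * zetaOp hH z) =
      (if IsInt (∑ j, z j * μ j) ∧ a = 0 then X.gradedTrace (X.coefOp v a * T * zetaOp hH z)
        else 0) +
      kernelP (∑ j, z j * μ j) (-a) *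
        X.gradedTrace ((X.coefOp v a * T - T * X.coefOp v a) * zetaOp hH z) := by
  set Z := ∑ j, z j * μ j with hZ
  set J := X.gradedTrace (X.coefOp v a * T * zetaOp hH z) with hJ
  set J' := X.gradedTrace (T * zetaOp hH z * X.coefOp v a) with hJ'
  -- Moving `v_a` through the twist brings the second trace into cyclic position at the cost of
  -- `ζ⁻¹`.
  have hK : X.gradedTrace ((X.coefOp v a * T - T * X.coefOp v a) * zetaOp hH z) =
      J - PowerSeries.C (zeta Z)⁻¹ * J' := by
    rw [sub_mul, gradedTrace_sub, ← hJ, hJ', ← gradedTrace_smul, mul_assoc T (zetaOp hH z),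
      zetaOp_mul_coefOp hH z hv, ← hZ, mul_smul_comm, smul_smul, inv_mul_cancel₀ (zeta_ne_zero Z),
      one_smul, mul_assoc]
  have hC : (PowerSeries.C (zeta Z) : PowerSeries ℂ) * PowerSeries.C (zeta Z)⁻¹ = 1 := by
    rw [← map_mul, mul_inv_cancel₀ (zeta_ne_zero Z), map_one]
  rw [hK]
  have hsh := X.isShift_coefOp v a
  -- Formally `J' = q^(-a) J`, but only non-negative powers of `q` are available: for `a > 0` the
  -- relation reads `J = q^a J'`. This is what selects the expansion of the kernel for each sign.
  rcases lt_trichotomy a 0 with ha | ha | ha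
  · obtain ⟨l, rfl⟩ : ∃ l : ℕ, a = -l := ⟨a.natAbs, by lia⟩
    have hl : l ≠ 0 := by lia
    have hcyc : J' = PowerSeries.X ^ l * J := by
      rw [hJ', gradedTrace_mul_of_shift_neg (by exact_mod_cast hsh), ← mul_assoc]
    rw [if_neg (by lia), zero_add, neg_neg, kernelP, if_neg (by lia), if_pos (by lia),
      Int.natAbs_natCast]
    apply mul_left_cancel₀ (one_sub_ne_zero (zeta Z)⁻¹ hl)
    have := one_sub_mul_lambert (zeta Z)⁻¹ hl
    rw [hcyc]
    linear_combination -(J - PowerSeries.C (zeta Z)⁻¹ * (PowerSeries.X ^ l * J)) * this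
  · have hcyc : J' = J := by
      have : IsShift X.L0 ((0 : ℕ) : ℂ) (X.coefOp v a) := by
        simpa [ha] using hsh
      rw [hJ, mul_assoc, gradedTrace_mul_of_shift this, pow_zero, one_mul]
    rw [hcyc, ha, neg_zero, kernelP, if_pos rfl, zeroTerm]
    by_cases hint : IsInt Z
    · simp [hint]
    · have h1 : 1 - (zeta Z)⁻¹ ≠ 0 := by
        rw [sub_ne_zero]
        intro h
        exact hint ((zeta_eq_one_iff Z).mp (by rw [← inv_inv (zeta Z), ← h, inv_one]))
      rw [if_neg (by tauto), if_neg hint, zero_add,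
        show J - PowerSeries.C (zeta Z)⁻¹ * J = PowerSeries.C (1 - (zeta Z)⁻¹) * J by
          rw [map_sub, map_one]; ring, ← mul_assoc, ← map_mul, one_div_mul_cancel h1, map_one,
        one_mul]
  · obtain ⟨l, rfl⟩ : ∃ l : ℕ, a = l := ⟨a.natAbs, by lia⟩
    have hl : l ≠ 0 := by lia
    have hcyc : J = PowerSeries.X ^ l * J' := by
      rw [hJ, mul_assoc, gradedTrace_mul_of_shift (by exact_mod_cast hsh)]
    rw [if_neg (by lia), zero_add, kernelP, if_neg (by lia), if_neg (by lia), Int.natAbs_neg,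
      Int.natAbs_natCast]
    apply mul_left_cancel₀ (one_sub_ne_zero (zeta Z) hl)
    have := one_sub_mul_lambert (zeta Z) hl
    rw [hcyc]
    linear_combination (PowerSeries.X ^ l * J' - PowerSeries.C (zeta Z)⁻¹ * J') * this -
      PowerSeries.X ^ l * J' * hC

/-- The recursion for an additional point, coefficient by coefficient. -/
lemma nPoint_cons (hv : ∀ j, A.mode (h j) 0 v = μ j • v) (u : Fin n → V) :
    ∀ᶠ K : ℕ in Filter.atTop, ∀ (a : ℤ) (e : Fin n → ℤ),
      X.gradedTrace (X.coefOp v a * X.opProd u e * zetaOp hH z) =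
        (if IsInt (∑ j, z j * μ j) ∧ a = 0 then zeroModePoint hH z v u e else 0) +
        ∑ s, ∑ j ∈ Finset.range K, formalP (j + 1) (∑ j, z j * μ j) (-a) *
          nPoint hH z (Function.update u s (A.sq v j (u s))) (e + Pi.single s a) := by
  filter_upwards [X.opProd_commutator v u] with K hK a e
  rw [gradedTrace_coefOp_mul hH z hv, hK, Finset.sum_mul, gradedTrace_sum, Finset.mul_sum]
  congr 1
  · refine if_ctx_congr Iff.rfl (fun h => ?_) fun _ => rfl
    rw [h.2, zeroModePoint_apply]
  · refine Finset.sum_congr rfl fun s _ => ?_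
    rw [Finset.sum_mul, gradedTrace_sum, Finset.mul_sum]
    refine Finset.sum_congr rfl fun j _ => ?_
    rw [smul_mul_assoc, gradedTrace_smul, ← nPoint_apply, formalP_eq, add_tsub_cancel_right,
      Int.cast_neg]
    ring

end VOAModule

/-! ### Products with series in a ratio `q_s / q_t` -/

namespace Formal

variable {n : ℕ}

lemma mulRatio_zero (P : ℤ → PowerSeries ℂ) (s t : Fin n) : mulRatio P s t (0 : Formal n) = 0 := by
  funext e
  ext N
  simp [mulRatio]

lemma mulRatio_C_mul (P : ℤ → PowerSeries ℂ) (s t : Fin n) (c : ℂ) (F : Formal n) :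
    mulRatio P s t (fun e => PowerSeries.C c * F e) =
      fun e => PowerSeries.C c * mulRatio P s t F e := by
  funext e
  ext N
  simp only [mulRatio, PowerSeries.coeff_mk, PowerSeries.coeff_C_mul, ← smul_eq_mul (a := c),
    smul_finsum]
  refine finsum_congr fun l => ?_
  rw [mul_left_comm, PowerSeries.coeff_C_mul, smul_eq_mul]

lemma extend_zero : (0 : Formal n).extend = 0 := by
  funext e
  simp [extend]

/-- `F.extend` lives in exponent `0` of the new variable, so a single `ℓ` can produce exponent `a`
there. -/
lemma mulRatio_extend (P : ℤ → PowerSeries ℂ) (s : Fin n) (F : Formal n) (a : ℤ) (e : Fin n → ℤ) :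
    mulRatio P s.succ 0 F.extend (Fin.cons a e : Fin (n + 1) → ℤ) =
      P (-a) * F (e + Pi.single s a) := by
  ext N
  rw [mulRatio, PowerSeries.coeff_mk, finsum_eq_single _ (-a)]
  · congr 2
    rw [extend, if_pos (by simp [(Fin.succ_ne_zero s).symm])]
    congr 1
    funext i
    by_cases h : i = s
    · subst h; simp [Fin.tail]
    · simp [Fin.tail, h]
  · intro l hl
    rw [extend, if_neg, mul_zero, map_zero]
    simp [(Fin.succ_ne_zero s).symm]
    lia

/-- The coefficients of `F` vanish far out in the direction of `q_t / q_s`. -/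
def VanishesFar (F : Formal n) (s t : Fin n) : Prop :=
  ∀ (e : Fin n → ℤ) (N : ℕ), ∃ B : ℤ, ∀ l, B ≤ l → ∀ i ≤ N,
    PowerSeries.coeff i (F (e - Pi.single s l + Pi.single t l)) = 0

lemma coeff_mul_eq_zero_of_le {P F : PowerSeries ℂ} {N : ℕ}
    (h : ∀ i ≤ N, PowerSeries.coeff i F = 0) : PowerSeries.coeff N (P * F) = 0 := by
  rw [PowerSeries.coeff_mul]
  refine Finset.sum_eq_zero fun ij hij => ?_
  rw [h _ (by have := Finset.HasAntidiagonal.mem_antidiagonal.mp hij; lia), mul_zero]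

lemma coeff_mul_eq_zero_of_dvd {P F : PowerSeries ℂ} {N l : ℕ} (h : PowerSeries.X ^ l ∣ P)
    (hl : N < l) : PowerSeries.coeff N (P * F) = 0 :=
  PowerSeries.X_pow_dvd_iff.mp (h.mul_right F) N hl

/-- Large positive `ℓ` are killed by `F`, large negative `ℓ` by the divisibility of `P ℓ` by
`q^|ℓ|`. -/
lemma VanishesFar.exists_bound {F : Formal n} {s t : Fin n} (hF : F.VanishesFar s t)
    {P : ℤ → PowerSeries ℂ} (hP : ∀ l < 0, PowerSeries.X ^ l.natAbs ∣ P l) (e : Fin n → ℤ)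
    (N : ℕ) : ∃ B : ℕ, ∀ l : ℤ, PowerSeries.coeff N
      (P l * F (e - Pi.single s l + Pi.single t l)) ≠ 0 → l.natAbs ≤ B := by
  obtain ⟨B, hB⟩ := hF e N
  refine ⟨B.natAbs + N, fun l hl => ?_⟩
  by_contra hlt
  apply hl
  rcases lt_or_ge l 0 with h | h
  · exact coeff_mul_eq_zero_of_dvd (hP l h) (by lia)
  · exact coeff_mul_eq_zero_of_le (hB l (by lia))

lemma VanishesFar.finite_support {F : Formal n} {s t : Fin n} (hF : F.VanishesFar s t)
    {P : ℤ → PowerSeries ℂ} (hP : ∀ l < 0, PowerSeries.X ^ l.natAbs ∣ P l) (e : Fin n → ℤ)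
    (N : ℕ) : (Function.support fun l : ℤ => PowerSeries.coeff N
      (P l * F (e - Pi.single s l + Pi.single t l))).Finite := by
  obtain ⟨B, hB⟩ := hF.exists_bound hP e N
  exact (Set.finite_Icc (-B : ℤ) B).subset fun l hl => by
    have := hB l hl
    exact ⟨by lia, by lia⟩

/-- Pairing `-(1 + i)` with `i` matches the two halves of the normally ordered product. -/
lemma finsum_int_eq_sum_range {R : Type*} [AddCommMonoid R] {f : ℤ → R} {B L : ℕ}
    (hf : ∀ l, f l ≠ 0 → l.natAbs ≤ B) (hL : B < L) :
    ∑ᶠ l, f l = ∑ i ∈ Finset.range L, (f (-(1 + i)) + f i) := by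
  rw [finsum_eq_sum_of_support_subset f (s := Finset.Ico (-L : ℤ) L)]
  · clear hf hL
    induction L with
    | zero => simp
    | succ L ih =>
      have : Finset.Ico (-((L + 1 : ℕ) : ℤ)) (L + 1 : ℕ) =
          insert (-(1 + L) : ℤ) (insert (L : ℤ) (Finset.Ico (-L : ℤ) L)) := by
        ext x
        simp only [Finset.mem_Ico, Finset.mem_insert]
        lia
      rw [this, Finset.sum_insert, Finset.sum_insert, ih, Finset.sum_range_succ]
      · rw [← add_assoc, add_comm]
      · simp
      · simp only [Finset.mem_Ico, Finset.mem_insert]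
        lia
  · intro l hl
    have := hf l hl
    simp only [Finset.coe_Ico, Set.mem_Ico]
    lia

lemma VanishesFar.coeff_mulRatio {F : Formal n} {s t : Fin n} (hF : F.VanishesFar s t)
    {P : ℤ → PowerSeries ℂ} (hP : ∀ l < 0, PowerSeries.X ^ l.natAbs ∣ P l) (e : Fin n → ℤ)
    (N : ℕ) : ∀ᶠ L : ℕ in Filter.atTop, PowerSeries.coeff N (mulRatio P s t F e) =
      PowerSeries.coeff N (∑ i ∈ Finset.range L,
        (P (-(1 + i)) * F (e - Pi.single s (-(1 + i) : ℤ) + Pi.single t (-(1 + i) : ℤ)) +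
          P i * F (e - Pi.single s (i : ℤ) + Pi.single t (i : ℤ)))) := by
  obtain ⟨B, hB⟩ := hF.exists_bound hP e N
  filter_upwards [Filter.eventually_gt_atTop B] with L hL
  rw [mulRatio, PowerSeries.coeff_mk, finsum_int_eq_sum_range hB hL]
  simp only [map_sum, map_add]

lemma mul_mulRatio {F : Formal n} {s t : Fin n} (hF : F.VanishesFar s t)
    {P : ℤ → PowerSeries ℂ} (hP : ∀ l < 0, PowerSeries.X ^ l.natAbs ∣ P l) (D : PowerSeries ℂ) :
    (fun e => D * mulRatio P s t F e) = mulRatio (fun l => D * P l) s t F := by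
  funext e
  ext N
  simp only [mulRatio, PowerSeries.coeff_mul _ D, PowerSeries.coeff_mk, mul_assoc]
  rw [finsum_sum_comm]
  · refine Finset.sum_congr rfl fun ij _ => ?_
    simp only [← smul_eq_mul (a := PowerSeries.coeff ij.1 D), smul_finsum]
  · intro ij _
    refine (hF.finite_support hP e ij.2).subset fun l hl h => hl ?_
    simp only [h, mul_zero]

lemma vanishesFar_extend (F : Formal n) (s : Fin n) : F.extend.VanishesFar s.succ 0 := by
  intro e N
  refine ⟨-e 0 + 1, fun l hl i _ => ?_⟩
  rw [extend, if_neg, map_zero]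
  simp [(Fin.succ_ne_zero s).symm]
  lia

end Formal

lemma X_pow_dvd_lambert (a : ℂ) (l : ℕ) : (PowerSeries.X : PowerSeries ℂ) ^ l ∣ lambert a l :=
  (Dvd.intro_left _ rfl).mul_right _

lemma X_pow_dvd_formalP (k : ℕ) (Z : ℂ) (l : ℤ) (hl : l < 0) :
    (PowerSeries.X : PowerSeries ℂ) ^ l.natAbs ∣ formalP k Z l := by
  rw [formalP_eq, kernelP, if_neg hl.ne, if_neg hl.not_gt]
  exact ((dvd_neg.mpr (X_pow_dvd_lambert _ _))).mul_left _

/-! ### Twisted Eisenstein series as sums of twisted Weierstrass kernels -/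

lemma bern_eq (k : ℕ) : bern k = (bernoulli k : ℂ) / k.factorial := by
  simp [bern, bernoulliPowerSeries]

/-- Euler's formula for even zeta values gives `-B_k / k!`. For `k = 1`, the value `B_1 = -1/2`
leaves the extra `zeroTerm Z - 1`, which is the `ℓ = 0` kernel after its commutator correction. -/
lemma eisensteinConst_succ (j : ℕ) (Z : ℂ) :
    eisensteinConst (j + 1) Z = -bern (j + 1) + (0 : ℂ) ^ j / j.factorial * (zeroTerm Z - 1) := by
  rw [bern_eq]
  rcases Nat.eq_zero_or_pos j with rfl | hj
  · simp [eisensteinConst, bernoulli_one]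
    ring
  · rw [eisensteinConst, if_neg (by lia), zero_pow (by lia), zero_div, zero_mul, add_zero]
    split_ifs with h
    · obtain ⟨r, hr⟩ := h
      have h2 : j + 1 = 2 * r := by lia
      have hr0 : r ≠ 0 := by lia
      have hpi : (Real.pi : ℂ) ≠ 0 := by exact_mod_cast Real.pi_ne_zero
      have hf : ((2 * r).factorial : ℂ) ≠ 0 := by exact_mod_cast (2 * r).factorial_ne_zero
      have hz := riemannZeta_two_mul_nat hr0
      rw [h2]
      push_cast
      rw [hz, mul_pow, mul_pow, pow_mul Complex.I, Complex.I_sq]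
      have hp : (2 : ℂ) ^ (2 * r) = 2 * 2 ^ (2 * r - 1) := by
        rw [← pow_succ']; congr 1; lia
      rw [hp, pow_succ]
      have h1 : ((-1 : ℂ) ^ r) * (-1) ^ r = 1 := by rw [← mul_pow]; simp
      have h3 : ((-1 : ℂ) ^ r) ≠ 0 := by simp
      field_simp
    · rw [bernoulli_eq_zero_of_odd (Nat.not_even_iff_odd.mp h) (by lia)]
      simp

lemma coeff_lambert_of_lt (a : ℂ) {l N : ℕ} (h : N < l) :
    PowerSeries.coeff N (lambert a l) = 0 :=
  PowerSeries.X_pow_dvd_iff.mp (X_pow_dvd_lambert a l) N h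

/-- The Weierstrass series cannot be summed at `w = 0` because of the constant `1` in each kernel
with `ℓ > 0`. Subtracting `ℓ^j / j!` leaves Lambert series starting at `q^|ℓ|`, so terms with `|ℓ| >
N` do not affect the coefficient of `q^N`. -/
lemma coeff_formalE_succ (j : ℕ) (Z : ℂ) {N L : ℕ} (hL : N < L) :
    PowerSeries.coeff N (formalE (j + 1) Z) = PowerSeries.coeff N (PowerSeries.C (-bern (j + 1)) +
      ∑ i ∈ Finset.range L, (formalP (j + 1) Z (-(1 + i)) + (formalP (j + 1) Z i -
        PowerSeries.C ((i : ℂ) ^ j / j.factorial)))) := by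
  have hneg : ∑ i ∈ Finset.range L, PowerSeries.coeff N (formalP (j + 1) Z (-(1 + i))) =
      ∑ l ∈ Finset.Icc 1 N, (l : ℂ) ^ j / j.factorial * ((-1) ^ (j + 1) *
        PowerSeries.coeff N (lambert (zeta Z) l)) := by
    have h1 (i : ℕ) : PowerSeries.coeff N (formalP (j + 1) Z (-(1 + i))) =
        ((1 + i : ℕ) : ℂ) ^ j / j.factorial * ((-1) ^ (j + 1) *
          PowerSeries.coeff N (lambert (zeta Z) (1 + i))) := by
      rw [formalP_eq, kernelP, if_neg (by lia), if_neg (by lia), PowerSeries.coeff_C_mul,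
        show (-(1 + i : ℤ)).natAbs = 1 + i by lia]
      push_cast
      rw [neg_pow, pow_succ, map_neg]
      ring
    simp only [h1]
    rw [Finset.range_eq_Ico, Finset.sum_Ico_add (fun l : ℕ => (l : ℂ) ^ j / j.factorial *
      ((-1) ^ (j + 1) * PowerSeries.coeff N (lambert (zeta Z) l))) 0 L 1]
    symm
    refine Finset.sum_subset (fun l hl => ?_) fun l _ hl => ?_
    · simp only [Finset.mem_Icc, Finset.mem_Ico] at hl ⊢; lia
    · simp only [Finset.mem_Icc, Finset.mem_Ico] at *
      rw [coeff_lambert_of_lt _ (by lia), mul_zero, mul_zero]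
  have hpos : ∑ i ∈ Finset.range L, PowerSeries.coeff N (formalP (j + 1) Z i -
        PowerSeries.C ((i : ℂ) ^ j / j.factorial)) =
      PowerSeries.coeff N (PowerSeries.C ((0 : ℂ) ^ j / j.factorial * (zeroTerm Z - 1))) +
        ∑ l ∈ Finset.Icc 1 N, (l : ℂ) ^ j / j.factorial *
          PowerSeries.coeff N (lambert (zeta Z)⁻¹ l) := by
    rw [Finset.range_eq_Ico, Finset.sum_eq_sum_Ico_succ_bot (by lia)]
    congr 1
    · rw [formalP_eq, kernelP, if_pos (by simp), ← map_mul, ← map_sub]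
      congr 2
      push_cast
      ring
    · rw [zero_add, ← Finset.sum_subset (s₁ := Finset.Icc 1 N)]
      · refine Finset.sum_congr rfl fun l hl => ?_
        rw [Finset.mem_Icc] at hl
        rw [formalP_eq, kernelP, if_neg (by lia), if_pos (by lia), Int.natAbs_natCast, mul_add,
          mul_one, add_tsub_cancel_right, Int.cast_natCast, add_sub_cancel_left,
          PowerSeries.coeff_C_mul]
      · intro l hl
        simp only [Finset.mem_Icc, Finset.mem_Ico] at hl ⊢; lia
      · intro l hl1 hl
        simp only [Finset.mem_Icc, Finset.mem_Ico] at *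
        rw [formalP_eq, kernelP, if_neg (by lia), if_pos (by lia), Int.natAbs_natCast, mul_add,
          mul_one, add_tsub_cancel_right, Int.cast_natCast, add_sub_cancel_left,
          PowerSeries.coeff_C_mul, coeff_lambert_of_lt _ (by lia), mul_zero]
  rw [map_add, map_sum]
  simp only [map_add]
  rw [Finset.sum_add_distrib, hneg, hpos, formalE, eisensteinConst_succ, map_add, map_add, map_add,
    PowerSeries.coeff_C_mul, PowerSeries.coeff_mk, Finset.mul_sum]
  rw [add_assoc, add_left_comm (∑ l ∈ Finset.Icc 1 N, _), ← Finset.sum_add_distrib]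
  congr 2
  refine Finset.sum_congr rfl fun l _ => ?_
  rw [PowerSeries.coeff_C_mul, map_add, PowerSeries.coeff_C_mul, add_tsub_cancel_right]
  ring

lemma coeff_mul_congr {P Q F : PowerSeries ℂ} {N : ℕ}
    (h : ∀ i ≤ N, PowerSeries.coeff i P = PowerSeries.coeff i Q) :
    PowerSeries.coeff N (P * F) = PowerSeries.coeff N (Q * F) := by
  rw [PowerSeries.coeff_mul, PowerSeries.coeff_mul]
  refine Finset.sum_congr rfl fun ij hij => ?_
  rw [h _ (by have := Finset.HasAntidiagonal.mem_antidiagonal.mp hij; lia)]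

/-! ### The formal recursions -/

namespace VOAModule

variable {V M : Type*} [AddCommGroup V] [Module ℂ V] [AddCommGroup M] [Module ℂ M]
  {A : VOA V} {X : VOAModule A M} {n : ℕ} {m : ℕ} {h : Fin m → V}

-- The factors to the right of slot `s` are constant in `l` and produce one fixed vector, which the
-- operator in slot `s` annihilates once its exponent is low enough. The factors to the left are
-- irrelevant.
variable (X) in
lemma eventually_opProd_apply_eq_zero (u : Fin n → V) (e : ℤ → Fin n → ℤ) (s : Fin n)
    (hs : Filter.Tendsto (fun l => e l s) Filter.atTop Filter.atBot)
    (hc : ∀ i, s < i → ∀ l, e l i = e 0 i) (y : M) :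
    ∀ᶠ l in Filter.atTop, X.opProd u (e l) y = 0 := by
  induction n with
  | zero => exact s.elim0
  | succ n ih =>
    have hcons (l : ℤ) : X.opProd u (e l) =
        X.coefOp (u 0) (e l 0) * X.opProd (Fin.tail u) (Fin.tail (e l)) := by
      rw [opProd, List.ofFn_succ, List.prod_cons]
      rfl
    simp only [hcons, Module.End.mul_apply]
    refine Fin.cases (fun hs hc => ?_) (fun s hs hc => ?_) s hs hc
    · obtain ⟨B, hB⟩ := X.eventually_coefOp_apply_eq_zero (u 0)
        (X.opProd (Fin.tail u) (Fin.tail (e 0)) y)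
      filter_upwards [hs.eventually (Filter.eventually_le_atBot B)] with l hl
      have : Fin.tail (e l) = Fin.tail (e 0) := funext fun i => hc i.succ (Fin.succ_pos i) l
      rw [this]
      exact hB _ hl
    · filter_upwards [ih (Fin.tail u) (fun l => Fin.tail (e l)) s hs
        fun i hi l => hc i.succ (Fin.succ_lt_succ_iff.mpr hi) l] with l hl
      rw [hl, map_zero]

variable (hH : ConditionH X h) (z : Fin m → ℂ)

lemma vanishesFar_nPoint (u : Fin (n + 1) → V) (s : Fin n) :
    (nPoint hH z u).VanishesFar s.succ 0 := by
  intro e N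
  have hzero (x : M) : ∀ᶠ l : ℤ in Filter.atTop,
      (X.opProd u (e - Pi.single s.succ l + Pi.single 0 l) * zetaOp hH z) x =
        (0 : Module.End ℂ M) x := by
    have := X.eventually_opProd_apply_eq_zero u
      (fun l : ℤ => e - Pi.single s.succ l + Pi.single 0 l) s.succ ?_ ?_ (zetaOp hH z x)
    · filter_upwards [this] with l hl
      rw [Module.End.mul_apply, hl, LinearMap.zero_apply]
    · simp only [Pi.add_apply, Pi.sub_apply, Pi.single_eq_same,
        Pi.single_eq_of_ne (Fin.succ_ne_zero s), add_zero]
      exact Filter.tendsto_atBot.mpr fun b => by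
        filter_upwards [Filter.eventually_ge_atTop (e s.succ - b)] with l hl
        lia
    · intro i hi l
      simp [Pi.single_eq_of_ne hi.ne', Pi.single_eq_of_ne ((Fin.succ_pos s).trans hi).ne']
  have := X.eventually_coeff_gradedTrace hzero N
  obtain ⟨B, hB⟩ := this.exists_forall_of_atTop
  refine ⟨B, fun l hl i hi => ?_⟩
  rw [nPoint_apply, hB l hl i hi, gradedTrace_zero, map_zero]

lemma nPoint_update_smul (u : Fin n → V) (s : Fin n) (c : ℂ) (w : V) :
    nPoint hH z (Function.update u s (c • w)) =
      fun e => PowerSeries.C c * nPoint hH z (Function.update u s w) e := by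
  funext e
  have h1 := X.opProd_update u e s (c • w) 0
  have h2 := X.opProd_update u e s w 0
  rw [Pi.single_zero, add_zero] at h1 h2
  rw [nPoint_apply, nPoint_apply, h1, h2, coefOp_smul, MultilinearMap.map_update_smul,
    smul_mul_assoc, gradedTrace_smul]

lemma nPoint_update_zero (u : Fin n → V) (s : Fin n) :
    nPoint hH z (Function.update u s 0) = 0 := by
  have := nPoint_update_smul hH z u s 0 0
  rw [smul_zero] at this
  rw [this]
  funext e
  simp

lemma finsum_eq_sum_range {R : Type*} [AddCommMonoid R] {f : ℕ → R} {K : ℕ}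
    (hf : ∀ k, K ≤ k → f k = 0) : ∑ᶠ k, f k = ∑ k ∈ Finset.range K, f k :=
  finsum_eq_sum_of_support_subset f fun k hk => by
    simp only [Finset.coe_range, Set.mem_Iio]
    by_contra hlt
    exact hk (hf k (not_lt.mp hlt))

variable {v : V} {μ : Fin m → ℂ}

/-- The recursion for an additional point, as an identity of formal series. -/
theorem nPoint_cons_formal (hv : ∀ j, A.mode (h j) 0 v = μ j • v) (u : Fin n → V) :
    X.nPoint hH z (Fin.cons v u : Fin (n + 1) → V) =
      (if IsInt (∑ j, z j * μ j) then (zeroModePoint hH z v u).extend else 0) +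
      ∑ s : Fin n, ∑ᶠ k : ℕ,
        Formal.mulRatio (formalP (k + 1) (∑ j, z j * μ j)) s.succ 0
          (nPoint hH z (Function.update u s (A.sq v k (u s)))).extend := by
  -- One cutoff serves the coefficientwise recursion and kills every later `v[k]u_s`, so the
  -- `finsum`s become sums over `range K`.
  obtain ⟨K, hK, hsq⟩ := ((nPoint_cons hH z hv u).and
    (Filter.eventually_all.mpr fun s => A.eventually_sq_eq_zero v (u s))).exists
  have hfin (s : Fin n) := finsum_eq_sum_range (K := K) (f := fun k : ℕ =>
    Formal.mulRatio (formalP (k + 1) (∑ j, z j * μ j)) s.succ 0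
      (nPoint hH z (Function.update u s (A.sq v k (u s)))).extend) fun k hk => by
        rw [hsq s k hk, nPoint_update_zero, Formal.extend_zero, Formal.mulRatio_zero]
  simp only [hfin]
  funext e
  obtain ⟨a, e, rfl⟩ : ∃ a e', e = (Fin.cons a e' : Fin (n + 1) → ℤ) :=
    ⟨e 0, Fin.tail e, (Fin.cons_self_tail e).symm⟩
  simp only [Pi.add_apply, Finset.sum_apply, Formal.mulRatio_extend]
  rw [nPoint_apply, opProd_cons, hK]
  congr 1
  by_cases hint : IsInt (∑ j, z j * μ j)
  · simp [hint, Formal.extend]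
  · simp [hint]

lemma opProd_eq (u : Fin (n + 1) → V) (e : Fin (n + 1) → ℤ) (a : ℤ) :
    X.opProd u (e - Pi.single 0 a) =
      X.coefOp (u 0) (e 0 - a) * X.opProd (Fin.tail u) (Fin.tail e) := by
  have h1 : e - Pi.single 0 a = (Fin.cons (e 0 - a) (Fin.tail e) : Fin (n + 1) → ℤ) := by
    funext i
    refine Fin.cases ?_ (fun i => ?_) i <;> simp [Fin.tail]
  rw [h1, ← Fin.cons_self_tail u, opProd_cons]
  simp

lemma opProd_update_zero (u : Fin (n + 1) → V) (e : Fin (n + 1) → ℤ) (w : V) :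
    X.opProd (Function.update u 0 w) e =
      X.coefOp w (e 0) * X.opProd (Fin.tail u) (Fin.tail e) := by
  have := opProd_eq (X := X) (Function.update u 0 w) e 0
  rw [Pi.single_zero, sub_zero, sub_zero, Function.update_self] at this
  rw [this]
  congr 2

/-- The recursion for `v[-1]u₁`, before the coefficients are collected. -/
lemma nPoint_sq_neg_one_expand (v : V) (u : Fin (n + 1) → V) :
    ∀ᶠ K : ℕ in Filter.atTop, ∀ (e : Fin (n + 1) → ℤ) (N : ℕ), ∀ᶠ L : ℕ in Filter.atTop,
      PowerSeries.coeff N (nPoint hH z (Function.update u 0 (A.sq v (-1) (u 0))) e +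
        ∑ j ∈ Finset.range K, PowerSeries.C (bern (j + 1)) *
          nPoint hH z (Function.update u 0 (A.sq v j (u 0))) e) =
      PowerSeries.coeff N (∑ i ∈ Finset.range L,
        (X.gradedTrace (X.coefOp v (1 + i) * X.opProd u (e - Pi.single 0 (1 + i : ℤ)) *
            zetaOp hH z) +
          (X.gradedTrace (X.coefOp v (-i) * X.opProd u (e - Pi.single 0 (-i : ℤ)) * zetaOp hH z) -
            ∑ j ∈ Finset.range K, PowerSeries.C ((i : ℂ) ^ j / j.factorial) *
              nPoint hH z (Function.update u 0 (A.sq v j (u 0))) e))) := by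
  filter_upwards [X.coefOp_normalOrder v (u 0), X.coefOp_commutator v (u 0)] with K hK hcomm e N
  set R := X.opProd (Fin.tail u) (Fin.tail e) * zetaOp hH z with hR
  have key := X.eventually_coeff_gradedTrace (F := Filter.atTop)
    (T := fun _ : ℕ => X.coefOp (A.sq v (-1) (u 0)) (e 0) * R +
      ∑ j ∈ Finset.range K, bern (j + 1) • (X.coefOp (A.sq v j (u 0)) (e 0) * R))
    (U := fun L => ∑ i ∈ Finset.range L,
      (X.coefOp v (1 + i) * X.coefOp (u 0) (e 0 - 1 - i) * R +
        X.coefOp (u 0) (e 0 + i) * X.coefOp v (-i) * R)) (fun x => by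
          filter_upwards [hK (e 0) (R x)] with L hL
          simp only [LinearMap.add_apply, LinearMap.sum_apply, LinearMap.smul_apply,
            Module.End.mul_apply]
          exact hL) N
  have hn (w : V) : nPoint hH z (Function.update u 0 w) e =
      X.gradedTrace (X.coefOp w (e 0) * R) := by
    rw [nPoint_apply, opProd_update_zero, hR, mul_assoc]
  filter_upwards [key] with L hL
  have hL := hL N le_rfl
  rw [gradedTrace_add, gradedTrace_sum, gradedTrace_sum] at hL
  simp only [gradedTrace_smul, ← hn] at hL
  rw [hL]
  congr 1
  refine Finset.sum_congr rfl fun i _ => ?_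
  rw [gradedTrace_add]
  have hc := hcomm (-i) (e 0 + i)
  congr 1
  · rw [opProd_eq, hR, sub_sub]
    simp only [mul_assoc]
  · rw [opProd_eq, sub_neg_eq_add]
    -- Commuting `v_(-i)` to the left costs the coefficients `i^j / j!`, the very terms that
    -- regularize the kernel sum at `w = 0`.
    have h2 : X.coefOp (u 0) (e 0 + i) * X.coefOp v (-i) * R =
        X.coefOp v (-i) * X.coefOp (u 0) (e 0 + i) * R - ∑ j ∈ Finset.range K,
          ((i : ℂ) ^ j / j.factorial) • (X.coefOp (A.sq v j (u 0)) (e 0) * R) := by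
      have h3 : X.coefOp (u 0) (e 0 + i) * X.coefOp v (-i) =
          X.coefOp v (-i) * X.coefOp (u 0) (e 0 + i) - ∑ j ∈ Finset.range K,
            ((i : ℂ) ^ j / j.factorial) • X.coefOp (A.sq v j (u 0)) (e 0) := by
        rw [eq_sub_iff_add_eq', ← eq_sub_iff_add_eq, hc]
        simp
      rw [h3, sub_mul, Finset.sum_mul]
      simp only [smul_mul_assoc]
    rw [h2, gradedTrace_sub, gradedTrace_sum, hR]
    simp only [gradedTrace_smul, ← hR, hn, mul_assoc]

/-- Reordering of finite sums only: `p` are kernels, `b` Bernoulli terms, `c` commutator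
corrections, `a` the zero-mode part, `G` traces modified in the first slot and `H` kernel times
trace in the other slots. -/
lemma collect_kernel_terms {R ι : Type*} [CommRing R] [Fintype ι] (K L : ℕ) (p : ℕ → ℤ → R)
    (b : ℕ → R) (c : ℕ → ℕ → R) (a : ℕ → R) (G : ℕ → R) (H : ι → ℕ → ℤ → R) :
    ∑ i ∈ Finset.range L,
        (∑ k ∈ Finset.range K, p k (-(1 + i)) * G k + ∑ s, ∑ k ∈ Finset.range K, H s k (-(1 + i)) +
          (a i + (∑ k ∈ Finset.range K, p k i * G k + ∑ s, ∑ k ∈ Finset.range K, H s k i) -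
            ∑ k ∈ Finset.range K, c i k * G k)) - ∑ k ∈ Finset.range K, b k * G k =
      ∑ i ∈ Finset.range L, a i + ∑ k ∈ Finset.range K,
        (-b k + ∑ i ∈ Finset.range L, (p k (-(1 + i)) + (p k i - c i k))) * G k +
      ∑ s, ∑ k ∈ Finset.range K, ∑ i ∈ Finset.range L, (H s k (-(1 + i)) + H s k i) := by
  have hcomm (F : ℕ → ℕ → R) : ∑ k ∈ Finset.range K, ∑ i ∈ Finset.range L, F k i =
    ∑ i ∈ Finset.range L, ∑ k ∈ Finset.range K, F k i := Finset.sum_comm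
  have hcomm' (F : ι → ℕ → R) : ∑ s, ∑ i ∈ Finset.range L, F s i =
    ∑ i ∈ Finset.range L, ∑ s, F s i := Finset.sum_comm
  simp only [add_mul, sub_mul, neg_mul, Finset.sum_mul, Finset.sum_add_distrib,
    Finset.sum_sub_distrib, Finset.sum_neg_distrib, hcomm, hcomm']
  ring

/-- The recursion for `v[-1]u₁`, as an identity of formal series. -/
lemma nPoint_sq_neg_one (hv : ∀ j, A.mode (h j) 0 v = μ j • v) (u : Fin (n + 1) → V) :
    ∀ᶠ K : ℕ in Filter.atTop, ∀ e : Fin (n + 1) → ℤ,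
      nPoint hH z (Function.update u 0 (A.sq v (-1) (u 0))) e =
        (if IsInt (∑ j, z j * μ j) then zeroModePoint hH z v u e else 0) +
        (∑ k ∈ Finset.range K, formalE (k + 1) (∑ j, z j * μ j) *
          nPoint hH z (Function.update u 0 (A.sq v k (u 0))) e) +
        ∑ s : Fin n, ∑ k ∈ Finset.range K,
          Formal.mulRatio (formalP (k + 1) (∑ j, z j * μ j)) s.succ 0
            (nPoint hH z (Function.update u s.succ (A.sq v k (u s.succ)))) e := by
  filter_upwards [nPoint_sq_neg_one_expand hH z v u, nPoint_cons hH z hv u] with K hK hcons e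
  set Z := ∑ j, z j * μ j
  ext N
  have hfar (s : Fin n) (k : ℕ) := (vanishesFar_nPoint hH z
    (Function.update u s.succ (A.sq v k (u s.succ))) s).coeff_mulRatio
      (X_pow_dvd_formalP (k + 1) Z) e N
  -- With the coefficient of `q^N` fixed, a single `L` truncates the normally ordered product, the
  -- ratio series and the Eisenstein series.
  obtain ⟨L, hL, hfar, hLN⟩ := ((hK e N).and ((Filter.eventually_all.mpr fun s =>
    (Finset.eventually_all (Finset.range K)).mpr fun k _ => hfar s k).and
      (Filter.eventually_gt_atTop N))).exists
  obtain ⟨G, hG⟩ : ∃ G : ℕ → PowerSeries ℂ, ∀ k : ℕ,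
      nPoint hH z (Function.update u 0 (A.sq v k (u 0))) e = G k := ⟨_, fun _ => rfl⟩
  obtain ⟨H, hHdef⟩ : ∃ H : Fin n → ℕ → ℤ → PowerSeries ℂ, ∀ s (k : ℕ) l, formalP (k + 1) Z l *
    nPoint hH z (Function.update u s.succ (A.sq v k (u s.succ)))
      (e - Pi.single s.succ l + Pi.single 0 l) = H s k l := ⟨_, fun _ _ _ => rfl⟩
  -- In slot `0` the exponent shift of the recursion undoes the one already present, so the trace is
  -- independent of `l`; in the other slots the two shifts form `(q_s / q_1)^l`.
  have hexp (l : ℤ) : X.gradedTrace (X.coefOp v (-l) * X.opProd u (e - Pi.single 0 (-l)) *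
      zetaOp hH z) = (if IsInt Z ∧ l = 0 then zeroModePoint hH z v u e else 0) +
        (∑ k ∈ Finset.range K, formalP (k + 1) Z l * G k +
          ∑ s : Fin n, ∑ k ∈ Finset.range K, H s k l) := by
    rw [hcons, Fin.sum_univ_succ, neg_neg]
    refine congrArg₂ (· + ·) ?_ (congrArg₂ (· + ·) ?_ ?_)
    · by_cases hl : l = 0
      · subst hl; simp
      · simp [hl]
    · simp only [sub_add_cancel, hG]
    · refine Finset.sum_congr rfl fun s _ => Finset.sum_congr rfl fun k _ => ?_
      rw [← hHdef, Pi.single_neg, Pi.single_neg, sub_neg_eq_add, ← sub_eq_add_neg,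
        add_sub_right_comm]
  have hfar' (s : Fin n) (k : ℕ) (hk : k ∈ Finset.range K) :
      PowerSeries.coeff N (Formal.mulRatio (formalP (k + 1) Z) s.succ 0
        (nPoint hH z (Function.update u s.succ (A.sq v k (u s.succ)))) e) =
      PowerSeries.coeff N (∑ i ∈ Finset.range L, (H s k (-(1 + i)) + H s k i)) := by
    simp only [← hHdef]
    exact hfar s k hk
  have hE (k : ℕ) : PowerSeries.coeff N (formalE (k + 1) Z * G k) =
      PowerSeries.coeff N ((PowerSeries.C (-bern (k + 1)) +
        ∑ i ∈ Finset.range L, (formalP (k + 1) Z (-(1 + i)) + (formalP (k + 1) Z i -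
          PowerSeries.C ((i : ℂ) ^ k / k.factorial)))) * G k) :=
    coeff_mul_congr fun i hi => coeff_formalE_succ k Z (by lia)
  simp only [hG] at hL ⊢
  have hL' := eq_sub_iff_add_eq.mpr ((map_add _ _ _).symm.trans hL)
  have h1 (i : ℕ) : X.gradedTrace (X.coefOp v (1 + i) * X.opProd u (e - Pi.single 0 (1 + i : ℤ)) *
      zetaOp hH z) = ∑ k ∈ Finset.range K, formalP (k + 1) Z (-(1 + i)) * G k +
          ∑ s : Fin n, ∑ k ∈ Finset.range K, H s k (-(1 + i)) := by
    have := hexp (-(1 + i))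
    rwa [neg_neg, if_neg (by lia), zero_add] at this
  -- Among all terms of the normally ordered product only `i = 0` of the second family has `v` with
  -- exponent `0`.
  have h0 : ∑ i ∈ Finset.range L, (if IsInt Z ∧ (i : ℤ) = 0 then zeroModePoint hH z v u e else 0) =
      if IsInt Z then zeroModePoint hH z v u e else 0 := by
    rw [Finset.sum_eq_single 0 (fun i _ hi => by rw [if_neg (by lia)])
      (fun h => absurd (Finset.mem_range.mpr (by lia)) h)]
    simp
  have hsum₁ : PowerSeries.coeff N (∑ k ∈ Finset.range K, formalE (k + 1) Z * G k) =
      PowerSeries.coeff N (∑ k ∈ Finset.range K, (-PowerSeries.C (bern (k + 1)) +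
        ∑ i ∈ Finset.range L, (formalP (k + 1) Z (-(1 + i)) + (formalP (k + 1) Z i -
          PowerSeries.C ((i : ℂ) ^ k / k.factorial)))) * G k) := by
    rw [map_sum, map_sum]
    exact Finset.sum_congr rfl fun k _ => by rw [hE, map_neg]
  have hsum₂ : PowerSeries.coeff N (∑ s : Fin n, ∑ k ∈ Finset.range K,
      Formal.mulRatio (formalP (k + 1) Z) s.succ 0
        (nPoint hH z (Function.update u s.succ (A.sq v k (u s.succ)))) e) =
      PowerSeries.coeff N (∑ s, ∑ k ∈ Finset.range K, ∑ i ∈ Finset.range L,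
        (H s k (-(1 + i)) + H s k i)) := by
    rw [map_sum, map_sum]
    refine Finset.sum_congr rfl fun s _ => ?_
    rw [map_sum, map_sum]
    exact Finset.sum_congr rfl fun k hk => hfar' s k hk
  have hcol := collect_kernel_terms K L (fun k l => formalP (k + 1) Z l)
    (fun k => PowerSeries.C (bern (k + 1))) (fun i k => PowerSeries.C ((i : ℂ) ^ k / k.factorial))
    (fun i => if IsInt Z ∧ (i : ℤ) = 0 then zeroModePoint hH z v u e else 0) G H
  simp only [h1, hexp] at hL'
  rw [hL', ← map_sub, hcol, h0, map_add, map_add, map_add, map_add, hsum₁, hsum₂]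

end VOAModule

/-! ### From `v[-1]` to `v[-p]` by means of `L[-1]` -/

namespace VOAModule

variable {V M : Type*} [AddCommGroup V] [Module ℂ V] [AddCommGroup M] [Module ℂ M]
  {A : VOA V} {X : VOAModule A M} {n : ℕ} {m : ℕ} {h : Fin m → V}
  (hH : ConditionH X h) (z : Fin m → ℂ)

lemma zeroModePoint_sqTranslate (v : V) (u : Fin n → V) (e : Fin n → ℤ) :
    zeroModePoint hH z (A.sqTranslate v) u e = 0 := by
  rw [zeroModePoint_apply, coefOp_sqTranslate]
  simp [gradedTrace_zero]

/-- Balances the factor `-(k+1)` from `(L[-1]v)[k+1]` against the factor `p+1` from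
`(L[-1]v)[-p-1]`; the sign advances `(-1)^p`. -/
lemma choose_mul_neg_succ (k p : ℕ) :
    ((k + 1 + p).choose p : PowerSeries ℂ) * PowerSeries.C (-((k + 1 : ℕ) : ℂ)) =
      -(PowerSeries.C ((p : ℂ) + 1) * ((k + (p + 1)).choose (p + 1) : PowerSeries ℂ)) := by
  have h1 := Nat.choose_succ_right_eq (k + 1 + p) p
  rw [show k + 1 + p - p = k + 1 by lia] at h1
  have h2 := congrArg (Nat.cast : ℕ → PowerSeries ℂ) h1
  push_cast at h2
  rw [show k + (p + 1) = k + 1 + p by lia]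
  simp only [map_neg, map_add, map_natCast, map_one]
  push_cast
  linear_combination h2

/-- The recursion for `v[-p-1]u₁`, coefficient by coefficient. -/
lemma nPoint_sq_neg (u : Fin (n + 1) → V) (p : ℕ) {v : V} {μ : Fin m → ℂ}
    (hv : ∀ j, A.mode (h j) 0 v = μ j • v) :
    ∀ᶠ K : ℕ in Filter.atTop, ∀ e : Fin (n + 1) → ℤ,
      nPoint hH z (Function.update u 0 (A.sq v (-(p + 1 : ℕ)) (u 0))) e =
        (if IsInt (∑ j, z j * μ j) ∧ p = 0 then zeroModePoint hH z v u e else 0) +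
        (-1) ^ p * (∑ k ∈ Finset.range K, ((k + p).choose p : PowerSeries ℂ) *
          formalE (k + (p + 1)) (∑ j, z j * μ j) *
            nPoint hH z (Function.update u 0 (A.sq v k (u 0))) e) +
        (-1) ^ p * ∑ s : Fin n, ∑ k ∈ Finset.range K, ((k + p).choose p : PowerSeries ℂ) *
          Formal.mulRatio (formalP (k + (p + 1)) (∑ j, z j * μ j)) s.succ 0
            (nPoint hH z (Function.update u s.succ (A.sq v k (u s.succ)))) e := by
  induction p generalizing v with
  | zero =>
    filter_upwards [nPoint_sq_neg_one hH z hv u] with K hK e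
    simpa using hK e
  | succ p ih =>
    have hv' (j : Fin m) := VOA.mode_zero_sqTranslate (hasWt_one hH j) (hv j)
    -- The induction hypothesis is used for `L[-1]v` with cutoff `K + 1`: its `k = 0` summand
    -- vanishes and the summand `k + 1` becomes summand `k` for `v`.
    filter_upwards [(Filter.tendsto_add_atTop_nat 1).eventually (ih hv')] with K hK e
    have hc : (PowerSeries.C ((p : ℂ) + 1) : PowerSeries ℂ) ≠ 0 := by
      rw [Ne, map_eq_zero_iff _ PowerSeries.C_injective]
      exact_mod_cast Nat.succ_ne_zero p
    apply mul_left_cancel₀ hc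
    have hsq0 (u : V) : A.sq (A.sqTranslate v) (0 : ℕ) u = 0 := by
      rw [VOA.sq_sqTranslate]; simp
    have hsq (k : ℕ) (u : V) : A.sq (A.sqTranslate v) (k + 1 : ℕ) u =
        (-((k + 1 : ℕ) : ℂ)) • A.sq v k u := by
      rw [VOA.sq_sqTranslate]
      push_cast
      rw [add_sub_cancel_right]
    have hL := hK e
    have hneg : A.sq (A.sqTranslate v) (-(p + 1 : ℕ)) (u 0) =
        ((p : ℂ) + 1) • A.sq v (-(p + 1 + 1 : ℕ)) (u 0) := by
      rw [VOA.sq_sqTranslate]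
      push_cast
      rw [neg_neg, show (-((p : ℤ) + 1) - 1) = -((p : ℤ) + 1 + 1) by ring]
    rw [hneg, nPoint_update_smul, zeroModePoint_sqTranslate, ite_self, zero_add] at hL
    simp only [Finset.sum_range_succ', hsq0, hsq, nPoint_update_zero, nPoint_update_smul,
      Formal.mulRatio_zero, Formal.mulRatio_C_mul, Pi.zero_apply, mul_zero, add_zero] at hL
    rw [hL, if_neg (by lia), zero_add, mul_add, pow_succ]
    refine congrArg₂ (· + ·) ?_ ?_
    · rw [Finset.mul_sum, Finset.mul_sum, Finset.mul_sum]
      refine Finset.sum_congr rfl fun k _ => ?_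
      rw [show k + (p + 1 + 1) = k + 1 + (p + 1) by lia]
      linear_combination ((-1) ^ p * formalE (k + 1 + (p + 1)) (∑ j, z j * μ j) *
        nPoint hH z (Function.update u 0 (A.sq v k (u 0))) e) * choose_mul_neg_succ k p
    · rw [Finset.mul_sum, Finset.mul_sum, Finset.mul_sum]
      refine Finset.sum_congr rfl fun s _ => ?_
      rw [Finset.mul_sum, Finset.mul_sum, Finset.mul_sum]
      refine Finset.sum_congr rfl fun k _ => ?_
      rw [show k + (p + 1 + 1) = k + 1 + (p + 1) by lia]
      linear_combination ((-1) ^ p * Formal.mulRatio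
        (formalP (k + 1 + (p + 1)) (∑ j, z j * μ j)) s.succ 0
          (nPoint hH z (Function.update u s.succ (A.sq v k (u s.succ)))) e) *
            choose_mul_neg_succ k p

variable {v : V} {μ : Fin m → ℂ}

/-- The recursion for `v[-p]u₁`, as an identity of formal series. -/
theorem nPoint_sq_neg_formal (hv : ∀ j, A.mode (h j) 0 v = μ j • v) (u : Fin (n + 1) → V) (p : ℕ)
    (hp : 1 ≤ p) :
    nPoint hH z (Function.update u 0 (A.sq v (-p) (u 0))) =
      (if IsInt (∑ j, z j * μ j) ∧ p = 1 then zeroModePoint hH z v u else 0) +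
      (-1) ^ (p + 1) * (∑ᶠ k : ℕ, fun e =>
        ((k + p - 1).choose (p - 1) : PowerSeries ℂ) * formalE (k + p) (∑ j, z j * μ j) *
          nPoint hH z (Function.update u 0 (A.sq v k (u 0))) e) +
      (-1) ^ (p + 1) * ∑ s : Fin n, ∑ᶠ k : ℕ, fun e =>
        ((k + p - 1).choose (p - 1) : PowerSeries ℂ) *
          Formal.mulRatio (formalP (k + p) (∑ j, z j * μ j)) s.succ 0
            (nPoint hH z (Function.update u s.succ (A.sq v k (u s.succ)))) e := by
  obtain ⟨p, rfl⟩ : ∃ r, p = r + 1 := ⟨p - 1, by lia⟩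
  obtain ⟨K, hK, hsq⟩ := ((nPoint_sq_neg hH z u p hv).and
    (Filter.eventually_all.mpr fun s => A.eventually_sq_eq_zero v (u s))).exists
  rw [finsum_eq_sum_range (K := K) fun k hk => by
    rw [hsq 0 k hk, nPoint_update_zero]; funext e; simp]
  rw [Finset.sum_congr rfl fun s _ => finsum_eq_sum_range (K := K) fun k hk => by
    rw [hsq s.succ k hk, nPoint_update_zero, Formal.mulRatio_zero]; funext e; simp]
  funext e
  rw [hK e, show ((-1 : Formal (n + 1)) ^ (p + 1 + 1)) = (-1) ^ p by rw [pow_succ, pow_succ]; simp]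
  simp only [Pi.add_apply, Pi.mul_apply, Pi.pow_apply, Pi.neg_apply, Pi.one_apply,
    Finset.sum_apply, ← add_assoc, add_tsub_cancel_right]
  congr 2
  by_cases hc : IsInt (∑ j, z j * μ j) ∧ p = 0
  · rw [if_pos hc, if_pos ⟨hc.1, by rw [hc.2]⟩]
  · rw [if_neg hc, if_neg (by rintro ⟨h1, h2⟩; exact hc ⟨h1, by lia⟩)]
    rfl

end VOAModule

/-! ### Values of formal series -/

namespace Formal

variable {n : ℕ}

lemma term_eq (F : Formal n) (a : ℂ) (w : Fin n → ℂ) (τ : ℂ) (r : (Fin n → ℤ) × ℕ) :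
    F.term a w τ r = PowerSeries.coeff r.2 (F r.1) * Complex.exp (∑ i, r.1 i * w i) *
      (Complex.exp (2 * Real.pi * Complex.I * τ) ^ r.2 *
        Complex.exp (2 * Real.pi * Complex.I * τ * a)) := by
  rw [term, ← Complex.exp_nat_mul, ← Complex.exp_add]
  congr 2
  ring

lemma sum_shift_mul (e : Fin n → ℤ) (s t : Fin n) (l : ℤ) (w : Fin n → ℂ) :
    ∑ i, ((e - Pi.single s l + Pi.single t l : Fin n → ℤ) i : ℂ) * w i =
      ∑ i, (e i : ℂ) * w i - (w s - w t) * l := by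
  have h1 (s : Fin n) : ∑ i, (((Pi.single s l : Fin n → ℤ) i : ℤ) : ℂ) * w i = l * w s := by
    rw [Finset.sum_eq_single s (fun i _ hi => by simp [hi]) (by simp), Pi.single_eq_same]
  simp only [Pi.add_apply, Pi.sub_apply, Int.cast_add, Int.cast_sub, add_mul, sub_mul,
    Finset.sum_add_distrib, Finset.sum_sub_distrib, h1]
  ring

/-- The index of a summand of `F` that is paired with the `l`-th term of a series in `q_s / q_t`. -/
def pairIndex (s t : Fin n)
    (x : Σ r : (Fin n → ℤ) × ℕ, ℤ × Finset.HasAntidiagonal.antidiagonal r.2) :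
    (ℤ × ℕ) × ((Fin n → ℤ) × ℕ) :=
  ((x.2.1, x.2.2.1.1), (x.1.1 - Pi.single s x.2.1 + Pi.single t x.2.1, x.2.2.1.2))

lemma pairIndex_bijective (s t : Fin n) : Function.Bijective (pairIndex s t) := by
  constructor
  · rintro ⟨⟨e, N⟩, l, ⟨⟨i, j⟩, hij⟩⟩ ⟨⟨e', N'⟩, l', ⟨⟨i', j'⟩, hij'⟩⟩ h
    have h1 := Finset.HasAntidiagonal.mem_antidiagonal.mp hij
    have h2 := Finset.HasAntidiagonal.mem_antidiagonal.mp hij'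
    simp only at h1 h2
    subst h1 h2
    simp only [pairIndex, Prod.mk.injEq] at h
    obtain ⟨⟨rfl, rfl⟩, he, rfl⟩ := h
    have : e = e' := by simpa using he
    subst this
    rfl
  · rintro ⟨⟨l, i⟩, e, j⟩
    refine ⟨⟨(e + Pi.single s l - Pi.single t l, i + j), l, ⟨(i, j), by simp⟩⟩, ?_⟩
    simp only [pairIndex, Prod.mk.injEq, true_and, and_true]
    abel

lemma tsum_antidiagonal (P F : PowerSeries ℂ) (N : ℕ) (c : ℂ) :
    ∑' b : Finset.HasAntidiagonal.antidiagonal N,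
      (PowerSeries.coeff b.1.1 P * PowerSeries.coeff b.1.2 F) * c =
    PowerSeries.coeff N (P * F) * c := by
  rw [tsum_fintype, ← Finset.sum_mul, PowerSeries.coeff_mul,
    ← Finset.sum_coe_sort (Finset.HasAntidiagonal.antidiagonal N)]

/-- The value of `mulRatio P s t F` is the product of the values. -/
lemma hasSum_mulRatio {F : Formal n} {a : ℂ} {w : Fin n → ℂ} {τ x y : ℂ}
    (hF : HasSum (F.term a w τ) x) {P : ℤ → PowerSeries ℂ} {s t : Fin n}
    (hP : HasSum (fun r : ℤ × ℕ => PowerSeries.coeff r.2 (P r.1) *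
      Complex.exp ((w s - w t) * r.1) * Complex.exp (2 * Real.pi * Complex.I * τ) ^ r.2) y)
    (hfin : ∀ (e : Fin n → ℤ) (N : ℕ), (Function.support fun l : ℤ => PowerSeries.coeff N
      (P l * F (e - Pi.single s l + Pi.single t l))).Finite) :
    HasSum ((mulRatio P s t F).term a w τ) (y * x) := by
  obtain ⟨f, hf⟩ : ∃ f : ℤ × ℕ → ℂ, ∀ r, f r = PowerSeries.coeff r.2 (P r.1) *
      Complex.exp ((w s - w t) * r.1) * Complex.exp (2 * Real.pi * Complex.I * τ) ^ r.2 :=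
    ⟨_, fun _ => rfl⟩
  obtain ⟨g, hg⟩ : ∃ g : (Fin n → ℤ) × ℕ → ℂ, ∀ r, g r = F.term a w τ r := ⟨_, fun _ => rfl⟩
  rw [← funext hf] at hP
  rw [← funext hg] at hF
  have hprod : HasSum (fun z : (ℤ × ℕ) × ((Fin n → ℤ) × ℕ) => f z.1 * g z.2) (y * x) :=
    hP.mul hF (summable_mul_of_summable_norm hP.summable.norm hF.summable.norm)
  -- The absolutely convergent product is regrouped by total exponents `(e, N)`; each fibre runs
  -- over `ℓ` and the splittings of `N`, and its sum is the `mulRatio` coefficient.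
  rw [← (Equiv.ofBijective _ (pairIndex_bijective s t)).hasSum_iff] at hprod
  have hsig := hprod.sigma fun r => (hprod.summable.sigma_factor r).hasSum
  refine (congrArg (fun f => HasSum f (y * x)) (funext fun r => ?_)).mpr hsig
  obtain ⟨e, N⟩ := r
  have hterm (l : ℤ) (b : Finset.HasAntidiagonal.antidiagonal N) :
      ((fun z : (ℤ × ℕ) × ((Fin n → ℤ) × ℕ) => f z.1 * g z.2) ∘
        (Equiv.ofBijective _ (pairIndex_bijective s t))) ⟨(e, N), l, b⟩ =
      (PowerSeries.coeff b.1.1 (P l) *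
        PowerSeries.coeff b.1.2 (F (e - Pi.single s l + Pi.single t l))) *
        (Complex.exp (∑ i, e i * w i) * (Complex.exp (2 * Real.pi * Complex.I * τ) ^ N *
          Complex.exp (2 * Real.pi * Complex.I * τ * a))) := by
    obtain ⟨⟨i, j⟩, hij⟩ := b
    have h1 := Finset.HasAntidiagonal.mem_antidiagonal.mp hij
    simp only at h1
    simp only [Function.comp_apply, Equiv.ofBijective_apply, pairIndex, hf, hg, term_eq, sum_shift_mul]
    have h2 : Complex.exp ((w s - w t) * l) *
        Complex.exp (∑ i, (e i : ℂ) * w i - (w s - w t) * l) = Complex.exp (∑ i, (e i : ℂ) * w i) := by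
      rw [← Complex.exp_add]
      congr 1
      ring
    rw [← h1, pow_add, ← h2]
    ring
  rw [(hprod.summable.sigma_factor (e, N)).tsum_prod]
  simp only [hterm]
  simp only [tsum_antidiagonal]
  rw [tsum_mul_right, tsum_eq_finsum (hfin e N), term_eq, mulRatio, PowerSeries.coeff_mk]
  simp only [mul_assoc]

/-- A series in `q` alone is a ratio series concentrated at `ℓ = 0`, so this is a case of
`hasSum_mulRatio`. -/
lemma hasSum_term_mul {F : Formal (n + 1)} {a : ℂ} {w : Fin (n + 1) → ℂ} {τ x y : ℂ}
    (hF : HasSum (F.term a w τ) x) {G : PowerSeries ℂ}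
    (hG : HasSum (fun N => PowerSeries.coeff N G *
      Complex.exp (2 * Real.pi * Complex.I * τ) ^ N) y) :
    HasSum (Formal.term (fun e => G * F e) a w τ) (y * x) := by
  have hP : HasSum (fun r : ℤ × ℕ => PowerSeries.coeff r.2 ((Pi.single 0 G : ℤ → PowerSeries ℂ) r.1) *
      Complex.exp ((w 0 - w 0) * r.1) * Complex.exp (2 * Real.pi * Complex.I * τ) ^ r.2) y := by
    have hinj : Function.Injective fun N : ℕ => ((0, N) : ℤ × ℕ) := fun a b h => by simpa using h
    rw [← hinj.hasSum_iff]
    · refine (congrArg (fun f => HasSum f y) (funext fun N => ?_)).mp hG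
      simp
    · rintro ⟨l, N⟩ h
      have : l ≠ 0 := by
        rintro rfl
        exact h ⟨N, rfl⟩
      simp [this]
  have := hasSum_mulRatio hF hP fun e N => by
    refine (Set.finite_singleton 0).subset fun l hl => ?_
    by_contra hne
    exact hl (by simp [Pi.single_eq_of_ne hne])
  convert this using 2
  funext e
  ext N
  rw [mulRatio, PowerSeries.coeff_mk, finsum_eq_single _ 0 fun l hl => by
    rw [Pi.single_eq_of_ne hl, zero_mul, map_zero]]
  simp

lemma hasSum_term_add {F G : Formal n} {a : ℂ} {w : Fin n → ℂ} {τ x y : ℂ}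
    (hF : HasSum (F.term a w τ) x) (hG : HasSum (G.term a w τ) y) :
    HasSum (Formal.term (F + G) a w τ) (x + y) := by
  refine (congrArg (fun f => HasSum f (x + y)) (funext fun r => ?_)).mpr (hF.add hG)
  simp only [term, Pi.add_apply, map_add, add_mul]

lemma hasSum_term_sub {F G : Formal n} {a : ℂ} {w : Fin n → ℂ} {τ x y : ℂ}
    (hF : HasSum (F.term a w τ) x) (hG : HasSum (G.term a w τ) y) :
    HasSum (Formal.term (F - G) a w τ) (x - y) := by
  refine (congrArg (fun f => HasSum f (x - y)) (funext fun r => ?_)).mpr (hF.sub hG)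
  simp only [term, Pi.sub_apply, map_sub, sub_mul]

lemma hasSum_term_zero (a : ℂ) (w : Fin n → ℂ) (τ : ℂ) :
    HasSum (Formal.term (0 : Formal n) a w τ) 0 := by
  refine (congrArg (fun f => HasSum f 0) (funext fun r => ?_)).mpr hasSum_zero
  simp [term]

lemma hasSum_term_sum {ι : Type*} {S : Finset ι} {F : ι → Formal n} {a : ℂ} {w : Fin n → ℂ} {τ : ℂ}
    {x : ι → ℂ} (hF : ∀ i ∈ S, HasSum ((F i).term a w τ) (x i)) :
    HasSum (Formal.term (∑ i ∈ S, F i) a w τ) (∑ i ∈ S, x i) := by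
  refine (congrArg (fun f => HasSum f (∑ i ∈ S, x i)) (funext fun r => ?_)).mpr (hasSum_sum hF)
  simp only [term, Finset.sum_apply, map_sum, Finset.sum_mul]

lemma hasSum_term_C_mul {F : Formal n} {a : ℂ} {w : Fin n → ℂ} {τ x : ℂ} (c : ℂ)
    (hF : HasSum (F.term a w τ) x) :
    HasSum (Formal.term (fun e => PowerSeries.C c * F e) a w τ) (c * x) := by
  refine (congrArg (fun f => HasSum f (c * x)) (funext fun r => ?_)).mpr (hF.mul_left c)
  simp only [term, PowerSeries.coeff_C_mul, mul_assoc]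

lemma hasSum_term_extend {F : Formal n} {a : ℂ} {w : Fin (n + 1) → ℂ} {τ x : ℂ} :
    HasSum (F.extend.term a w τ) x ↔ HasSum (F.term a (Fin.tail w) τ) x := by
  have hinj : Function.Injective fun r : (Fin n → ℤ) × ℕ =>
      (((Fin.cons 0 r.1 : Fin (n + 1) → ℤ), r.2) : (Fin (n + 1) → ℤ) × ℕ) := fun a b h => by
    simp only [Prod.mk.injEq] at h
    exact Prod.ext (Fin.cons_injective2 h.1).2 h.2
  rw [← hinj.hasSum_iff]
  · refine Eq.to_iff (congrArg (fun f => HasSum f x) ?_)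
    funext r
    simp only [Function.comp_apply, term, extend, Fin.cons_zero, if_true, Fin.tail_cons,
      Fin.sum_univ_succ, Fin.cons_succ, Int.cast_zero, zero_mul, zero_add]
    rfl
  · rintro ⟨e, N⟩ h
    have : e 0 ≠ 0 := by
      intro h0
      exact h ⟨(Fin.tail e, N), by simp only [Prod.mk.injEq, and_true]; rw [← h0, Fin.cons_self_tail]⟩
    simp [term, extend, this]

end Formal

/-! ### Evaluation of power series -/

/-- The power series `G` converges absolutely at `q`, with value `x`. -/
def EvalAt (G : PowerSeries ℂ) (q x : ℂ) : Prop :=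
  HasSum (fun N => PowerSeries.coeff N G * q ^ N) x

/-- The sum of the absolute values of the terms of `G` at `q`. -/
def absSum (G : PowerSeries ℂ) (q : ℂ) : ℝ := ∑' N, ‖PowerSeries.coeff N G * q ^ N‖

namespace EvalAt

variable {F G : PowerSeries ℂ} {q x y : ℂ}

lemma coeff_mul_mul_pow (F G : PowerSeries ℂ) (q : ℂ) (N : ℕ) :
    PowerSeries.coeff N (F * G) * q ^ N = ∑ ij ∈ Finset.HasAntidiagonal.antidiagonal N,
      (PowerSeries.coeff ij.1 F * q ^ ij.1) * (PowerSeries.coeff ij.2 G * q ^ ij.2) := by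
  rw [PowerSeries.coeff_mul, Finset.sum_mul]
  refine Finset.sum_congr rfl fun ij hij => ?_
  rw [← Finset.HasAntidiagonal.mem_antidiagonal.mp hij, pow_add]
  ring

lemma mul (hF : EvalAt F q x) (hG : EvalAt G q y) : EvalAt (F * G) q (x * y) := by
  have h1 := summable_norm_sum_mul_antidiagonal_of_summable_norm hF.summable.norm hG.summable.norm
  have h2 := tsum_mul_tsum_eq_tsum_sum_antidiagonal_of_summable_norm hF.summable.norm
    hG.summable.norm
  rw [hF.tsum_eq, hG.tsum_eq] at h2
  rw [EvalAt, h2]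
  simp only [coeff_mul_mul_pow]
  exact h1.of_norm.hasSum

lemma absSum_mul_le (hF : EvalAt F q x) (hG : EvalAt G q y) :
    absSum (F * G) q ≤ absSum F q * absSum G q := by
  obtain ⟨f, hf⟩ : ∃ f : ℕ → ℝ, ∀ N, f N = ‖PowerSeries.coeff N F * q ^ N‖ := ⟨_, fun _ => rfl⟩
  obtain ⟨g, hg⟩ : ∃ g : ℕ → ℝ, ∀ N, g N = ‖PowerSeries.coeff N G * q ^ N‖ := ⟨_, fun _ => rfl⟩
  have hF' : Summable f := by rw [funext hf]; exact hF.summable.norm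
  have hG' : Summable g := by rw [funext hg]; exact hG.summable.norm
  have hfg : Summable fun x : ℕ × ℕ => f x.1 * g x.2 :=
    hF'.mul_of_nonneg hG' (fun N => by rw [hf]; exact norm_nonneg _)
      (fun N => by rw [hg]; exact norm_nonneg _)
  have h3 := summable_sum_mul_antidiagonal_of_summable_mul hfg
  have h2 := hF'.tsum_mul_tsum_eq_tsum_sum_antidiagonal hG' hfg
  rw [absSum, absSum, absSum, ← funext hf, ← funext hg, h2]
  refine (hF.mul hG).summable.norm.tsum_le_tsum (fun N => ?_) h3
  rw [coeff_mul_mul_pow]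
  refine (norm_sum_le _ _).trans (le_of_eq ?_)
  simp only [norm_mul, hf, hg]

lemma C (c : ℂ) (q : ℂ) : EvalAt (PowerSeries.C c) q c := by
  have := hasSum_single (f := fun N => PowerSeries.coeff N (PowerSeries.C c) * q ^ N) 0
    fun N hN => by simp [PowerSeries.coeff_C, hN]
  simpa [EvalAt] using this

lemma one (q : ℂ) : EvalAt 1 q 1 := by simpa using EvalAt.C 1 q

lemma C_mul_X_pow (c : ℂ) (l : ℕ) (q : ℂ) :
    EvalAt (PowerSeries.C c * PowerSeries.X ^ l) q (c * q ^ l) := by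
  have := hasSum_single (f := fun N =>
    PowerSeries.coeff N (PowerSeries.C c * PowerSeries.X ^ l) * q ^ N) l
    fun N hN => by simp [PowerSeries.coeff_X_pow, hN]
  simpa [EvalAt, PowerSeries.coeff_X_pow] using this

lemma sub (hF : EvalAt F q x) (hG : EvalAt G q y) : EvalAt (F - G) q (x - y) := by
  have := HasSum.sub hF hG
  simpa only [EvalAt, map_sub, sub_mul] using this

lemma neg (hF : EvalAt F q x) : EvalAt (-F) q (-x) := by
  have := HasSum.neg hF
  simpa only [EvalAt, map_neg, neg_mul] using this

lemma prod {ι : Type*} {S : Finset ι} {F : ι → PowerSeries ℂ} {x : ι → ℂ}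
    (h : ∀ i ∈ S, EvalAt (F i) q (x i)) : EvalAt (∏ i ∈ S, F i) q (∏ i ∈ S, x i) := by
  induction S using Finset.induction_on with
  | empty => simpa using EvalAt.one q
  | insert i S hi ih =>
    rw [Finset.prod_insert hi, Finset.prod_insert hi]
    exact (h i (Finset.mem_insert_self i S)).mul
      (ih fun j hj => h j (Finset.mem_insert_of_mem hj))

end EvalAt

lemma absSum_neg (G : PowerSeries ℂ) (q : ℂ) : absSum (-G) q = absSum G q := by
  simp only [absSum, map_neg, neg_mul, norm_neg]

/-! ### Lambert series -/

lemma lambert_eq_mk (a : ℂ) {l : ℕ} (hl : l ≠ 0) :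
    lambert a l = PowerSeries.mk fun N => if l ∣ N ∧ N ≠ 0 then a ^ (N / l) else 0 := by
  apply mul_left_cancel₀ (one_sub_ne_zero a hl)
  rw [one_sub_mul_lambert a hl]
  ext N
  rw [sub_mul, one_mul, mul_assoc, map_sub, PowerSeries.coeff_C_mul, PowerSeries.coeff_C_mul,
    PowerSeries.coeff_X_pow, PowerSeries.coeff_X_pow_mul', PowerSeries.coeff_mk]
  by_cases hN : l ≤ N
  · obtain ⟨M, rfl⟩ := Nat.exists_eq_add_of_le hN
    rw [if_pos hN, PowerSeries.coeff_mk, add_tsub_cancel_left,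
      Nat.add_div_left _ (Nat.pos_of_ne_zero hl)]
    have hiff : l ∣ l + M ↔ l ∣ M := Nat.dvd_add_right (dvd_refl l)
    by_cases hM : M = 0
    · subst hM
      simp [hl]
    · by_cases hd : l ∣ M
      · rw [if_neg (by lia), if_pos ⟨hiff.mpr hd, by lia⟩, if_pos ⟨hd, hM⟩, pow_succ]
        ring
      · rw [if_neg (by lia), if_neg (by tauto), if_neg (by tauto)]
        ring
  · rw [if_neg hN, if_neg (by lia), if_neg]
    · simp
    · rintro ⟨h1, h2⟩
      exact hN (Nat.le_of_dvd (Nat.pos_of_ne_zero h2) h1)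

/-- Only multiples of `l` occur as exponents. A general `φ` covers both the value and the sum of
norms. -/
lemma hasSum_lambert {R : Type*} [AddCommMonoid R] [TopologicalSpace R] (a q : ℂ) {l : ℕ}
    (hl : l ≠ 0) (φ : ℂ → R) (hφ : φ 0 = 0) (x : R) :
    HasSum (fun N => φ (PowerSeries.coeff N (lambert a l) * q ^ N)) x ↔
      HasSum (fun j : ℕ => φ ((a * q ^ l) ^ (j + 1))) x := by
  have hinj : Function.Injective fun j : ℕ => l * (j + 1) := fun i j h => by
    have := Nat.eq_of_mul_eq_mul_left (Nat.pos_of_ne_zero hl) h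
    lia
  rw [← hinj.hasSum_iff]
  · refine Eq.to_iff (congrArg (fun f => HasSum f x) (funext fun j => ?_))
    rw [Function.comp_apply, lambert_eq_mk a hl, PowerSeries.coeff_mk,
      if_pos ⟨dvd_mul_right _ _, by positivity⟩, Nat.mul_div_cancel_left _ (Nat.pos_of_ne_zero hl),
      mul_pow, ← pow_mul]
  · intro N hN
    rw [lambert_eq_mk a hl, PowerSeries.coeff_mk, if_neg, zero_mul, hφ]
    rintro ⟨⟨j, rfl⟩, h2⟩
    refine hN ⟨j - 1, ?_⟩
    have : j ≠ 0 := by rintro rfl; simp at h2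
    simp only
    congr 1
    lia

lemma evalAt_lambert {a q : ℂ} {l : ℕ} (hl : l ≠ 0) (h : ‖a * q ^ l‖ < 1) :
    EvalAt (lambert a l) q (a * q ^ l / (1 - a * q ^ l)) := by
  refine (hasSum_lambert a q hl (fun x => x) rfl _).mpr ?_
  have := (hasSum_geometric_of_norm_lt_one h).mul_left (a * q ^ l)
  simpa only [← pow_succ', ← div_eq_mul_inv] using this

lemma absSum_lambert {a q : ℂ} {l : ℕ} (hl : l ≠ 0) (h : ‖a * q ^ l‖ < 1) :
    absSum (lambert a l) q = ‖a * q ^ l‖ / (1 - ‖a * q ^ l‖) := by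
  refine HasSum.tsum_eq ((hasSum_lambert a q hl norm norm_zero _).mpr ?_)
  have := (hasSum_geometric_of_norm_lt_one (ξ := ‖a * q ^ l‖) (by simpa using h)).mul_left ‖a * q ^ l‖
  simpa only [← pow_succ', ← div_eq_mul_inv, norm_pow] using this

/-- A product of finitely many factors `1 - a q^l` that clears denominators of Lambert series. -/
def denom (Z : ℂ) (L : ℕ) : PowerSeries ℂ :=
  ∏ x ∈ Finset.range L ×ˢ ({(zeta Z)⁻¹, zeta Z} : Finset ℂ),
    (1 - PowerSeries.C x.2 * PowerSeries.X ^ (x.1 + 1))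

/-- The value of `denom Z L` at `q`. -/
def denomVal (Z : ℂ) (L : ℕ) (q : ℂ) : ℂ :=
  ∏ x ∈ Finset.range L ×ˢ ({(zeta Z)⁻¹, zeta Z} : Finset ℂ), (1 - x.2 * q ^ (x.1 + 1))

lemma evalAt_one_sub (a : ℂ) (l : ℕ) (q : ℂ) :
    EvalAt (1 - PowerSeries.C a * PowerSeries.X ^ l) q (1 - a * q ^ l) :=
  (EvalAt.one q).sub (EvalAt.C_mul_X_pow a l q)

lemma evalAt_denom (Z : ℂ) (L : ℕ) (q : ℂ) : EvalAt (denom Z L) q (denomVal Z L q) :=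
  EvalAt.prod fun _ _ => evalAt_one_sub _ _ q

/-- For `l > L` the Lambert series converges by itself; for `l ≤ L` its denominator is a factor of
`denom Z L` and cancels, leaving a polynomial. -/
lemma evalAt_denom_mul_lambert {Z q a : ℂ} {L l : ℕ}
    (ha : a ∈ ({(zeta Z)⁻¹, zeta Z} : Finset ℂ)) (hl : l ≠ 0)
    (hconv : L < l → ‖a * q ^ l‖ < 1) (hne : 1 - a * q ^ l ≠ 0) :
    EvalAt (denom Z L * lambert a l) q (denomVal Z L q * (a * q ^ l / (1 - a * q ^ l))) := by
  by_cases hL : L < l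
  · exact (evalAt_denom Z L q).mul (evalAt_lambert hl (hconv hL))
  · have hmem : ((l - 1, a) : ℕ × ℂ) ∈
        Finset.range L ×ˢ ({(zeta Z)⁻¹, zeta Z} : Finset ℂ) :=
      Finset.mem_product.mpr ⟨Finset.mem_range.mpr (by simp only; lia), ha⟩
    have hl1 : l - 1 + 1 = l := by lia
    rw [denom, denomVal, ← Finset.prod_erase_mul _ _ hmem, ← Finset.prod_erase_mul _ _ hmem]
    simp only [hl1]
    rw [mul_assoc, one_sub_mul_lambert a hl, mul_assoc, mul_div_cancel₀ _ hne]
    exact (EvalAt.prod fun _ _ => evalAt_one_sub _ _ q).mul (EvalAt.C_mul_X_pow a l q)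

/-- The part of the expansion of `1 / (1 - ζ⁻¹ q^l)` that is divisible by `q^|l|`. -/
def lam (Z : ℂ) (l : ℤ) : PowerSeries ℂ :=
  if l = 0 then 0 else if 0 < l then lambert (zeta Z)⁻¹ l.natAbs else -lambert (zeta Z) l.natAbs

/-- The value of `lam Z l` at `q`. -/
def lamVal (Z : ℂ) (q : ℂ) (l : ℤ) : ℂ :=
  if l = 0 then 0
  else if 0 < l then (zeta Z)⁻¹ * q ^ l.natAbs / (1 - (zeta Z)⁻¹ * q ^ l.natAbs)
  else -(zeta Z * q ^ l.natAbs / (1 - zeta Z * q ^ l.natAbs))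

/-- Lambert kernels can be evaluated termwise after multiplication by `denom Z L`. -/
lemma hasSum_denom_mul_lam {Z q : ℂ} {L : ℕ} {r : ℝ} (hr : r < 1)
    (hL : ∀ l, L < l → ‖(zeta Z)⁻¹ * q ^ l‖ ≤ r ∧ ‖zeta Z * q ^ l‖ ≤ r)
    (hne : ∀ l : ℕ, l ≠ 0 → 1 - (zeta Z)⁻¹ * q ^ l ≠ 0 ∧ 1 - zeta Z * q ^ l ≠ 0)
    {γ : ℤ → ℂ} (hγ : Summable fun l : ℤ => ‖γ l‖ * ‖q‖ ^ l.natAbs) :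
    HasSum (fun x : ℤ × ℕ => γ x.1 * (PowerSeries.coeff x.2 (denom Z L * lam Z x.1) * q ^ x.2))
        (∑' l, γ l * (denomVal Z L q * lamVal Z q l)) ∧
      Summable fun l => γ l * (denomVal Z L q * lamVal Z q l) := by
  have hev (l : ℤ) : EvalAt (denom Z L * lam Z l) q (denomVal Z L q * lamVal Z q l) := by
    rcases lt_trichotomy l 0 with hl | rfl | hl
    · rw [lam, lamVal, if_neg hl.ne, if_neg hl.not_gt, if_neg hl.ne, if_neg hl.not_gt, mul_neg,
        mul_neg]
      exact (evalAt_denom_mul_lambert (by simp) (by lia)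
        (fun h => (hL _ h).2.trans_lt hr) (hne _ (by lia)).2).neg
    · simp only [lam, lamVal, if_true, mul_zero]
      simpa using EvalAt.C 0 q
    · rw [lam, lamVal, if_neg hl.ne', if_pos hl, if_neg hl.ne', if_pos hl]
      exact evalAt_denom_mul_lambert (by simp) (by lia)
        (fun h => (hL _ h).1.trans_lt hr) (hne _ (by lia)).1
  set B : ℝ := absSum (denom Z L) q * (max ‖(zeta Z)⁻¹‖ ‖zeta Z‖ / (1 - r)) with hB
  have habs0 : 0 ≤ absSum (denom Z L) q := tsum_nonneg fun _ => norm_nonneg _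
  have hlam (a : ℂ) (ha : ‖a‖ ≤ max ‖(zeta Z)⁻¹‖ ‖zeta Z‖) (l : ℕ) (hl : l ≠ 0)
      (hlr : ‖a * q ^ l‖ ≤ r) :
      absSum (denom Z L * lambert a l) q ≤ B * ‖q‖ ^ l := by
    refine ((evalAt_denom Z L q).absSum_mul_le
      (evalAt_lambert hl (hlr.trans_lt hr))).trans ?_
    rw [absSum_lambert hl (hlr.trans_lt hr), hB, mul_assoc]
    refine mul_le_mul_of_nonneg_left ?_ habs0
    rw [div_mul_eq_mul_div]
    have h1 : (0 : ℝ) < 1 - r := by linarith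
    refine div_le_div₀ (by positivity) ?_ h1 (by linarith)
    rw [norm_mul, norm_pow]
    exact mul_le_mul_of_nonneg_right ha (by positivity)
  have hbound (l : ℤ) (hl : L < l.natAbs) :
      absSum (denom Z L * lam Z l) q ≤ B * ‖q‖ ^ l.natAbs := by
    rcases lt_or_gt_of_ne (show l ≠ 0 by lia) with h | h
    · rw [lam, if_neg h.ne, if_neg h.not_gt, mul_neg, absSum_neg]
      exact hlam _ (le_max_right _ _) _ (by lia) (hL _ hl).2
    · rw [lam, if_neg h.ne', if_pos h]
      exact hlam _ (le_max_left _ _) _ (by lia) (hL _ hl).1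
  have hsum : Summable fun x : ℤ × ℕ =>
      γ x.1 * (PowerSeries.coeff x.2 (denom Z L * lam Z x.1) * q ^ x.2) := by
    apply Summable.of_norm
    rw [summable_prod_of_nonneg fun _ => norm_nonneg _]
    refine ⟨fun l => ((hev l).mul_left (γ l)).summable.norm, ?_⟩
    have heq (l : ℤ) : ∑' N, ‖γ l * (PowerSeries.coeff N (denom Z L * lam Z l) * q ^ N)‖ =
        ‖γ l‖ * absSum (denom Z L * lam Z l) q := by
      simp only [norm_mul (γ l)]
      rw [tsum_mul_left, absSum]
    simp only [heq]
    -- The geometric bound holds only for `|l| > L`; the finitely many other `l` do not affect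
    -- summability.
    refine Summable.of_norm_bounded_eventually (hγ.mul_left B) ?_
    have hfin : {l : ℤ | l.natAbs ≤ L}.Finite :=
      (Set.finite_Icc (-L : ℤ) L).subset fun l hl => by
        simp only [Set.mem_ofPred_eq] at hl
        exact ⟨by lia, by lia⟩
    filter_upwards [hfin.compl_mem_cofinite] with l hl
    simp only [Set.mem_compl_iff, Set.mem_ofPred_eq, not_le] at hl
    have h0 : 0 ≤ absSum (denom Z L * lam Z l) q := tsum_nonneg fun _ => norm_nonneg _
    rw [Real.norm_of_nonneg (by positivity), mul_left_comm]
    exact mul_le_mul_of_nonneg_left (hbound l hl) (norm_nonneg _)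
  have hfib (l : ℤ) := (hev l).mul_left (γ l)
  have h2 := hsum.hasSum.prod_fiberwise hfib
  exact ⟨by rw [h2.tsum_eq]; exact hsum.hasSum, h2.summable⟩

/-! ### Values of the twisted Weierstrass functions and Eisenstein series -/

/-- The Lambert series with parameters `ζ^(±1)` converge at `q` after multiplication by
`denom Z L`, which does not vanish at `q`. -/
structure Clears (Z q : ℂ) (L : ℕ) (r : ℝ) : Prop where
  lt_one : r < 1
  bound : ∀ l, L < l → ‖(zeta Z)⁻¹ * q ^ l‖ ≤ r ∧ ‖zeta Z * q ^ l‖ ≤ r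
  ne_zero : ∀ l : ℕ, l ≠ 0 → 1 - (zeta Z)⁻¹ * q ^ l ≠ 0 ∧ 1 - zeta Z * q ^ l ≠ 0

lemma Clears.denomVal_ne_zero {Z q : ℂ} {L : ℕ} {r : ℝ} (h : Clears Z q L r) :
    denomVal Z L q ≠ 0 := by
  rw [denomVal, Finset.prod_ne_zero_iff]
  rintro ⟨l, a⟩ hx
  have ha := (Finset.mem_product.mp hx).2
  simp only [Finset.mem_insert, Finset.mem_singleton] at ha
  rcases ha with rfl | rfl
  · exact (h.ne_zero (l + 1) (by lia)).1
  · exact (h.ne_zero (l + 1) (by lia)).2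

/-- `ζ q^l = 1` would put `Z + lτ` in `ℤ`. -/
lemma zeta_mul_pow_ne_one {Z τ : ℂ} (hZ : ∀ a b : ℤ, Z = a + b * τ → b = 0) (l : ℤ)
    (hl : l ≠ 0) : zeta Z * Complex.exp (2 * Real.pi * Complex.I * τ * l) ≠ 1 := by
  rw [zeta, ← Complex.exp_add]
  intro h
  obtain ⟨a, ha⟩ := Complex.exp_eq_one_iff.mp h
  have h2 : Z + τ * l = a := by
    apply mul_left_cancel₀ Complex.two_pi_I_ne_zero
    linear_combination ha
  have := hZ a (-l) (by push_cast; linear_combination h2)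
  lia

lemma exp_pow_eq (τ : ℂ) (l : ℕ) : Complex.exp (2 * Real.pi * Complex.I * τ) ^ l =
    Complex.exp (2 * Real.pi * Complex.I * τ * l) := by
  rw [← Complex.exp_nat_mul, mul_comm]

lemma norm_exp_lt_one {τ : ℂ} (hτ : 0 < τ.im) :
    ‖Complex.exp (2 * Real.pi * Complex.I * τ)‖ < 1 := by
  have h : (2 * Real.pi * Complex.I * τ).re = -(2 * Real.pi * τ.im) := by simp
  rw [Complex.norm_exp, h, Real.exp_lt_one_iff]
  have := Real.pi_pos
  have : 0 < 2 * Real.pi * τ.im := by positivity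
  linarith

/-- Since `|q| < 1`, both `ζ^(±1) q^l` are eventually small. For integral `Z` one has `ζ = 1`, so `L
= 0` and `r = |q|` work; `value_eq_of_denom` relies on this when the zero-mode term is present. -/
lemma exists_clears {Z τ : ℂ} (hτ : 0 < τ.im) (hZ : ∀ a b : ℤ, Z = a + b * τ → b = 0) :
    ∃ L r, Clears Z (Complex.exp (2 * Real.pi * Complex.I * τ)) L r ∧ (IsInt Z → L = 0) := by
  have hq := norm_exp_lt_one hτ
  have hne (l : ℕ) (hl : l ≠ 0) :
      1 - (zeta Z)⁻¹ * Complex.exp (2 * Real.pi * Complex.I * τ) ^ l ≠ 0 ∧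
        1 - zeta Z * Complex.exp (2 * Real.pi * Complex.I * τ) ^ l ≠ 0 := by
    rw [exp_pow_eq]
    constructor
    · intro h
      apply zeta_mul_pow_ne_one hZ (-l) (by lia)
      have h1 : Complex.exp (2 * Real.pi * Complex.I * τ * l) = zeta Z := by
        have := zeta_ne_zero Z
        field_simp at h
        linear_combination -h
      rw [← h1, ← Complex.exp_add, Complex.exp_eq_one_iff]
      exact ⟨0, by push_cast; ring⟩
    · intro h
      apply zeta_mul_pow_ne_one hZ l (by lia)
      push_cast
      linear_combination -h
  generalize Complex.exp (2 * Real.pi * Complex.I * τ) = q at hq hne ⊢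
  by_cases hI : IsInt Z
  · refine ⟨0, ‖q‖, ⟨hq, fun l hl => ?_, hne⟩, fun _ => rfl⟩
    rw [(zeta_eq_one_iff Z).mpr hI, inv_one, one_mul, norm_pow]
    exact ⟨pow_le_of_le_one (norm_nonneg _) hq.le (by lia),
      pow_le_of_le_one (norm_nonneg _) hq.le (by lia)⟩
  · have ht (a : ℂ) : Filter.Tendsto (fun l : ℕ => ‖a * q ^ l‖) Filter.atTop (nhds 0) := by
      have := ((tendsto_pow_atTop_nhds_zero_of_norm_lt_one hq).const_mul a).norm
      simpa using this
    have h1 := ((ht (zeta Z)⁻¹).eventually_le_const (u := 1 / 2) (by norm_num)).and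
      ((ht (zeta Z)).eventually_le_const (u := 1 / 2) (by norm_num))
    obtain ⟨L, hL⟩ := Filter.eventually_atTop.mp h1
    exact ⟨L, 1 / 2, ⟨by norm_num, fun l hl => hL l hl.le, hne⟩, fun h => absurd h hI⟩

/-- Termwise evaluation of a Lambert kernel with constant terms `κ l`, weighted by `γ l`. -/
lemma Clears.hasSum_kernel {Z q : ℂ} {L : ℕ} {r : ℝ} (h : Clears Z q L r) {γ κ : ℤ → ℂ}
    (hγ : Summable fun l : ℤ => ‖γ l‖ * ‖q‖ ^ l.natAbs) (hκ : Summable fun l => γ l * κ l) :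
    HasSum (fun x : ℤ × ℕ => γ x.1 * (PowerSeries.coeff x.2
        (denom Z L * (PowerSeries.C (κ x.1) + lam Z x.1)) * q ^ x.2))
      (denomVal Z L q * ∑' l, γ l * (κ l + lamVal Z q l)) ∧
      Summable fun l => γ l * (κ l + lamVal Z q l) := by
  obtain ⟨h1, h2⟩ := hasSum_denom_mul_lam h.lt_one h.bound h.ne_zero hγ
  have h2' : Summable fun l => γ l * lamVal Z q l := by
    have := h2.mul_left (denomVal Z L q)⁻¹
    refine this.congr fun l => ?_
    have := h.denomVal_ne_zero
    field_simp
  have hD := evalAt_denom Z L q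
  obtain ⟨f, hf⟩ : ∃ f : ℕ → ℂ, ∀ N, f N = PowerSeries.coeff N (denom Z L) * q ^ N :=
    ⟨_, fun _ => rfl⟩
  obtain ⟨g, hg⟩ : ∃ g : ℤ → ℂ, ∀ l, g l = γ l * κ l := ⟨_, fun _ => rfl⟩
  rw [EvalAt, ← funext hf] at hD
  rw [← funext hg] at hκ
  have h3 : HasSum (fun x : ℤ × ℕ => g x.1 * f x.2) ((∑' l, g l) * denomVal Z L q) :=
    hκ.hasSum.mul hD (summable_mul_of_summable_norm hκ.norm hD.summable.norm)
  have h4 := h3.add h1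
  have hval : (∑' l, g l) * denomVal Z L q + ∑' l, γ l * (denomVal Z L q * lamVal Z q l) =
      denomVal Z L q * ∑' l, γ l * (κ l + lamVal Z q l) := by
    have h5 : ∑' l, γ l * (κ l + lamVal Z q l) = ∑' l, g l + ∑' l, γ l * lamVal Z q l := by
      rw [← hκ.tsum_add h2']
      simp only [hg, mul_add]
    rw [h5, mul_add, ← tsum_mul_left (f := fun l => γ l * lamVal Z q l), mul_comm]
    refine congrArg₂ (· + ·) rfl (tsum_congr fun l => ?_)
    ring
  rw [hval] at h4
  refine ⟨(congrArg (fun f => HasSum f _) (funext fun x => ?_)).mpr h4, ?_⟩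
  · simp only [hf, hg, mul_add, map_add, mul_comm (denom Z L) (PowerSeries.C _),
      PowerSeries.coeff_C_mul]
    ring
  · have heq : (fun l => γ l * (κ l + lamVal Z q l)) = fun l => g l + γ l * lamVal Z q l :=
      funext fun l => by rw [hg, mul_add]
    have hadd := hκ.add h2'
    rwa [heq]

/-- The positive half is geometric with ratio `|e^w q|`, the negative half with ratio `|q / e^w|`.
-/
lemma summable_int_pow_mul_exp (k : ℕ) {w q : ℂ} (h1 : ‖q‖ < ‖Complex.exp w‖)
    (h2 : ‖Complex.exp w‖ * ‖q‖ < 1) :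
    Summable fun l : ℤ => ‖(l : ℂ) ^ k / (k.factorial : ℂ) * Complex.exp (w * l)‖ *
      ‖q‖ ^ l.natAbs := by
  have hs (x : ℝ) (hx0 : 0 ≤ x) (hx : x < 1) :
      Summable fun n : ℕ => (k.factorial : ℝ)⁻¹ * ((n : ℝ) ^ k * x ^ n) := by
    have := summable_pow_mul_geometric_of_norm_lt_one (R := ℝ) k (r := x)
      (by rwa [Real.norm_of_nonneg hx0])
    exact this.mul_left _
  have h0 : 0 < ‖Complex.exp w‖ := norm_pos_iff.mpr (Complex.exp_ne_zero w)
  refine Summable.of_nat_of_neg ?_ ?_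
  · refine (hs (‖Complex.exp w‖ * ‖q‖) (by positivity) h2).congr fun n => ?_
    have : Complex.exp (w * ((n : ℤ) : ℂ)) = Complex.exp w ^ n := by
      rw [← Complex.exp_nat_mul, mul_comm]; simp
    rw [this]
    simp only [norm_mul, norm_div, norm_pow, Int.cast_natCast, Complex.norm_natCast,
      Int.natAbs_natCast, mul_pow]
    ring
  · refine (hs (‖q‖ / ‖Complex.exp w‖) (by positivity) ((div_lt_one h0).mpr h1)).congr
      fun n => ?_
    have : Complex.exp (w * ((-(n : ℤ) : ℤ) : ℂ)) = (Complex.exp w ^ n)⁻¹ := by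
      rw [← Complex.exp_nat_mul, ← Complex.exp_neg]
      congr 1
      push_cast
      ring
    rw [this]
    simp only [norm_mul, norm_div, norm_pow, Int.cast_neg, norm_neg, Int.cast_natCast,
      Complex.norm_natCast, Int.natAbs_neg, Int.natAbs_natCast, div_pow, norm_inv]
    ring

lemma kernelP_eq (Z : ℂ) (l : ℤ) : kernelP Z l =
    PowerSeries.C (if l = 0 then zeroTerm Z else if 0 < l then 1 else 0) + lam Z l := by
  rw [kernelP, lam]
  split_ifs <;> simp

/-- The expansions for `l > 0` and `l < 0` represent the same rational function, even at points
where the power series themselves diverge. -/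
lemma one_add_lamVal {Z τ : ℂ} {L : ℕ} {r : ℝ}
    (h : Clears Z (Complex.exp (2 * Real.pi * Complex.I * τ)) L r) {l : ℤ} (hl : l ≠ 0) :
    (if l = 0 then zeroTerm Z else if 0 < l then 1 else 0) +
      lamVal Z (Complex.exp (2 * Real.pi * Complex.I * τ)) l =
      1 / (1 - (zeta Z)⁻¹ * Complex.exp (2 * Real.pi * Complex.I * τ * l)) := by
  have hne := h.ne_zero l.natAbs (by lia)
  have hz := zeta_ne_zero Z
  rw [lamVal, if_neg hl, if_neg hl]
  rw [exp_pow_eq] at *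
  rcases lt_or_gt_of_ne hl with hl | hl
  · rw [if_neg hl.not_gt, if_neg hl.not_gt]
    have h1 : Complex.exp (2 * Real.pi * Complex.I * τ * l) =
        (Complex.exp (2 * Real.pi * Complex.I * τ * l.natAbs))⁻¹ := by
      rw [← Complex.exp_neg]
      congr 1
      have : (l.natAbs : ℂ) = -(l : ℂ) := by
        rw [← Int.cast_natCast, Int.ofNat_natAbs_of_nonpos hl.le]; simp
      rw [this]
      ring
    have h2 := Complex.exp_ne_zero (2 * Real.pi * Complex.I * τ * l.natAbs)
    rw [h1]
    generalize Complex.exp (2 * Real.pi * Complex.I * τ * l.natAbs) = y at *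
    have h3 : 1 - (zeta Z)⁻¹ * y⁻¹ ≠ 0 := by
      intro h
      apply hne.2
      field_simp at h
      linear_combination -h
    have h4 := hne.2
    have h5 : zeta Z * y - 1 ≠ 0 := fun h => h4 (by linear_combination -h)
    have h6 : 1 - (zeta Z)⁻¹ * y⁻¹ = (zeta Z * y - 1) / (zeta Z * y) := by field_simp
    rw [h6, one_div_div, zero_add, ← div_neg, neg_sub]
  · rw [if_pos hl, if_pos hl]
    have : (l : ℂ) = (l.natAbs : ℂ) := by
      rw [← Int.cast_natCast, Int.natAbs_of_nonneg hl.le]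
    rw [this]
    have h1 := hne.1
    generalize (zeta Z)⁻¹ * Complex.exp (2 * Real.pi * Complex.I * τ * l.natAbs) = y at *
    field_simp
    ring

/-- The value of the twisted Weierstrass function, after clearing denominators. -/
lemma Clears.hasSum_formalP {Z τ w : ℂ} {L : ℕ} {r : ℝ}
    (h : Clears Z (Complex.exp (2 * Real.pi * Complex.I * τ)) L r)
    (h1 : ‖Complex.exp (2 * Real.pi * Complex.I * τ)‖ < ‖Complex.exp w‖)
    (h2 : ‖Complex.exp w‖ < 1) {k : ℕ} (hk : 1 ≤ k) :
    HasSum (fun x : ℤ × ℕ => PowerSeries.coeff x.2 (denom Z L * formalP k Z x.1) *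
        Complex.exp (w * x.1) * Complex.exp (2 * Real.pi * Complex.I * τ) ^ x.2)
      (denomVal Z L (Complex.exp (2 * Real.pi * Complex.I * τ)) * twistedP k w Z τ) := by
  obtain ⟨k, rfl⟩ := Nat.exists_eq_add_of_le' hk
  have hγ := summable_int_pow_mul_exp k h1
    ((mul_le_of_le_one_right (norm_nonneg _) (h1.trans h2).le).trans_lt h2)
  -- The constant terms contribute `∑ ℓ^k e^(wℓ)` over `ℓ > 0`; this is what needs `|e^w| < 1` and
  -- not merely `|e^w q| < 1`.
  have hκ : Summable fun l : ℤ => (l : ℂ) ^ k / (k.factorial : ℂ) * Complex.exp (w * l) *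
      (if l = 0 then zeroTerm Z else if 0 < l then 1 else 0) := by
    refine Summable.of_nat_of_neg ?_ ?_
    · have hs := (summable_pow_mul_geometric_of_norm_lt_one k h2).mul_left (k.factorial : ℂ)⁻¹
      rw [← summable_nat_add_iff 1] at hs ⊢
      refine hs.congr fun n => ?_
      rw [if_neg (by lia), if_pos (by lia), ← Complex.exp_nat_mul]
      push_cast
      ring_nf
    · refine summable_of_ne_finset_zero (s := {0}) fun n hn => ?_
      rw [Finset.mem_singleton] at hn
      rw [if_neg (by lia), if_neg (by lia), mul_zero]
  have hval : twistedP (k + 1) w Z τ = ∑' l : ℤ, (l : ℂ) ^ k / (k.factorial : ℂ) *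
      Complex.exp (w * l) * ((if l = 0 then zeroTerm Z else if 0 < l then 1 else 0) +
        lamVal Z (Complex.exp (2 * Real.pi * Complex.I * τ)) l) := by
    rw [twistedP, ← tsum_mul_left]
    refine tsum_congr fun l => ?_
    by_cases hl : l = 0
    · subst hl
      simp [lamVal]
      ring
    · rw [one_add_lamVal h hl, if_neg hl, add_tsub_cancel_right]
      ring
  rw [hval]
  refine (congrArg (fun f => HasSum f _) (funext fun x => ?_)).mpr (h.hasSum_kernel hγ hκ).1
  rw [formalP_eq, add_tsub_cancel_right, ← kernelP_eq, mul_left_comm, PowerSeries.coeff_C_mul]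
  ring

/-- The constant terms of the Lambert kernel whose sum is a twisted Eisenstein series. -/
def kernelEConst (Z : ℂ) (l : ℤ) : ℂ := if l = 0 then zeroTerm Z - 1 else 0

lemma eval_eisenstein_kernel (j : ℕ) (Z τ : ℂ)
    (hs : Summable fun l : ℤ => (l : ℂ) ^ j / (j.factorial : ℂ) *
      (kernelEConst Z l +
        lamVal Z (Complex.exp (2 * Real.pi * Complex.I * τ)) l)) :
    -bern (j + 1) + ∑' l : ℤ, (l : ℂ) ^ j / (j.factorial : ℂ) *
      (kernelEConst Z l +
        lamVal Z (Complex.exp (2 * Real.pi * Complex.I * τ)) l) = twistedE (j + 1) τ Z := by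
  -- Pairing `ℓ` with `-ℓ` counts `ℓ = 0` twice; removing the initial term leaves a single copy to
  -- account for.
  have h1 := hs.hasSum.nat_add_neg
  rw [← hasSum_nat_add_iff' 1] at h1
  rw [twistedE, eisensteinConst_succ, add_tsub_cancel_right, ← tsum_mul_left, add_assoc]
  refine congrArg₂ (· + ·) rfl (sub_eq_iff_eq_add'.mp ?_)
  refine Eq.trans ?_ (h1.tsum_eq.symm.trans (tsum_congr fun l => ?_))
  · simp [lamVal, kernelEConst]
  · have hl : ((l + 1 : ℕ) : ℤ) ≠ 0 := by lia
    have hl' : (0 : ℤ) < ((l + 1 : ℕ) : ℤ) := by lia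
    have hn : -((l + 1 : ℕ) : ℤ) ≠ 0 := by lia
    have hn' : ¬ (0 : ℤ) < -((l + 1 : ℕ) : ℤ) := by lia
    simp only [lamVal, kernelEConst, if_neg hl, if_pos hl', if_neg hn, if_neg hn', Int.natAbs_neg,
      Int.natAbs_natCast, exp_pow_eq]
    push_cast
    rw [neg_pow, mul_comm (Complex.exp _) (zeta Z), mul_comm (Complex.exp _) (zeta Z)⁻¹]
    ring

/-- The value of the twisted Eisenstein series, after clearing denominators. -/
lemma Clears.evalAt_formalE {Z τ : ℂ} {L : ℕ} {r : ℝ}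
    (h : Clears Z (Complex.exp (2 * Real.pi * Complex.I * τ)) L r) (hτ : 0 < τ.im) {k : ℕ}
    (hk : 1 ≤ k) :
    EvalAt (denom Z L * formalE k Z) (Complex.exp (2 * Real.pi * Complex.I * τ))
      (denomVal Z L (Complex.exp (2 * Real.pi * Complex.I * τ)) * twistedE k τ Z) := by
  obtain ⟨j, rfl⟩ := Nat.exists_eq_add_of_le' hk
  have hq := norm_exp_lt_one hτ
  have hγ : Summable fun l : ℤ => ‖(l : ℂ) ^ j / (j.factorial : ℂ)‖ *
      ‖Complex.exp (2 * Real.pi * Complex.I * τ)‖ ^ l.natAbs := by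
    have := summable_int_pow_mul_exp j (w := 0) (q := Complex.exp (2 * Real.pi * Complex.I * τ))
      (by simpa using hq) (by simpa using hq)
    simpa using this
  have hκ : Summable fun l : ℤ => (l : ℂ) ^ j / (j.factorial : ℂ) *
      kernelEConst Z l :=
    summable_of_ne_finset_zero (s := {0}) fun l hl => by
      rw [Finset.mem_singleton] at hl
      rw [kernelEConst, if_neg hl, mul_zero]
  obtain ⟨h1, h2⟩ := h.hasSum_kernel hγ hκ
  rw [← eval_eisenstein_kernel j Z τ h2, mul_add, mul_comm _ (-bern (j + 1))]
  generalize Complex.exp (2 * Real.pi * Complex.I * τ) = q at *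
  obtain ⟨y, hy⟩ : ∃ y, denomVal Z L q * ∑' l : ℤ, (l : ℂ) ^ j / (j.factorial : ℂ) *
      (kernelEConst Z l + lamVal Z q l) = y := ⟨_, rfl⟩
  rw [hy] at h1 ⊢
  -- Summing over `ℓ` first, at a fixed power of `q`, gives finite sums because `lam Z ℓ` is
  -- divisible by `q^|ℓ|`; these are the coefficients of `denom Z L * formalE (j + 1) Z` apart from
  -- the Bernoulli constant.
  rw [← (Equiv.prodComm ℕ ℤ).hasSum_iff] at h1
  have h3 := h1.prod_fiberwise fun N => (h1.summable.prod_factor N).hasSum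
  have h4 := ((evalAt_denom Z L q).mul_left (-bern (j + 1))).add h3
  refine (congrArg (fun f => HasSum f _) (funext fun N => ?_)).mpr h4
  set Q : ℤ → PowerSeries ℂ := fun l => PowerSeries.C ((l : ℂ) ^ j / (j.factorial : ℂ)) *
    (PowerSeries.C (kernelEConst Z l) + lam Z l) with hQ
  have hterm (l : ℤ) : (l : ℂ) ^ j / (j.factorial : ℂ) * (PowerSeries.coeff N (denom Z L *
      (PowerSeries.C (kernelEConst Z l) + lam Z l)) * q ^ N) =
      PowerSeries.coeff N (Q l * denom Z L) * q ^ N := by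
    rw [hQ, mul_assoc, PowerSeries.coeff_C_mul, mul_comm (denom Z L)]
    ring
  have hsupp (l : ℤ) (hl : PowerSeries.coeff N (Q l * denom Z L) ≠ 0) : l.natAbs ≤ N := by
    by_contra hlt
    refine hl (Formal.coeff_mul_eq_zero_of_dvd (l := l.natAbs) ?_ (by lia))
    have h0 : l ≠ 0 := by lia
    rw [hQ]
    simp only [kernelEConst, if_neg h0, map_zero, zero_add]
    refine Dvd.dvd.mul_left ?_ _
    rw [lam, if_neg h0]
    split_ifs
    · exact X_pow_dvd_lambert _ _
    · exact dvd_neg.mpr (X_pow_dvd_lambert _ _)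
  have hfin : (Function.support fun l => PowerSeries.coeff N (Q l * denom Z L)).Finite :=
    (Set.finite_Icc (-N : ℤ) N).subset fun l hl => by
      have := hsupp l hl
      exact ⟨by lia, by lia⟩
  simp only [Function.comp_apply, Equiv.prodComm_apply, Prod.swap_prod_mk, hterm]
  rw [tsum_mul_right, tsum_eq_finsum hfin,
    Formal.finsum_int_eq_sum_range hsupp (Nat.lt_succ_self N), mul_comm (denom Z L),
    coeff_mul_congr (Q := PowerSeries.C (-bern (j + 1)) +
      ∑ i ∈ Finset.range (N + 1), (Q (-(1 + i)) + Q i))]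
  · rw [add_mul, map_add, PowerSeries.coeff_C_mul, Finset.sum_mul, map_sum]
    simp only [add_mul, map_add]
    ring
  · intro i hi
    rw [coeff_formalE_succ j Z (Nat.lt_succ_of_le hi)]
    refine congrArg _ (congrArg₂ (· + ·) rfl (Finset.sum_congr rfl fun l _ =>
      congrArg₂ (· + ·) ?_ ?_))
    · rw [formalP_eq, kernelP_eq, hQ, add_tsub_cancel_right]
      have h5 : (-(1 + (l : ℤ))) ≠ 0 := by lia
      have h6 : ¬ 0 < (-(1 + (l : ℤ))) := by lia
      simp only [kernelEConst, if_neg h5, if_neg h6]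
    · rw [formalP_eq, kernelP_eq, hQ, add_tsub_cancel_right]
      by_cases h5 : (l : ℤ) = 0
      · simp only [kernelEConst, if_pos h5, map_sub, map_one, Int.cast_natCast]
        ring
      · have h6 : 0 < (l : ℤ) := by lia
        simp only [kernelEConst, if_neg h5, if_pos h6, map_zero, map_one, Int.cast_natCast]
        ring

/-! ### The recursions for the values -/

namespace Formal

variable {n : ℕ}

/-- No convergence is assumed: summability on the two sides is equivalent, and otherwise both sums
take the default value `0`. -/
lemma tsum_term_extend (F : Formal n) (a : ℂ) (w : Fin (n + 1) → ℂ) (τ : ℂ) :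
    ∑' r, F.extend.term a w τ r = ∑' r, F.term a (Fin.tail w) τ r := by
  by_cases hs : Summable (F.term a (Fin.tail w) τ)
  · exact (hasSum_term_extend.mpr hs.hasSum).tsum_eq
  · rw [tsum_eq_zero_of_not_summable hs, tsum_eq_zero_of_not_summable]
    rintro ⟨x, hx⟩
    exact hs ⟨x, hasSum_term_extend.mp hx⟩

/-- An identity of formal series that holds after clearing denominators holds for the values. -/
lemma value_eq_of_denom {F G S : Formal (n + 1)} {a : ℂ} {w : Fin (n + 1) → ℂ} {τ x y Z : ℂ}
    {L : ℕ} {r : ℝ} (h : Clears Z (Complex.exp (2 * Real.pi * Complex.I * τ)) L r)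
    (hL : IsInt Z → L = 0) {c : Prop} [Decidable c] (hc : c → IsInt Z) (hFS : F = (if c then G else 0) + S)
    (hF : HasSum (F.term a w τ) x)
    (hS : HasSum (Formal.term (fun e => denom Z L * S e) a w τ)
      (denomVal Z L (Complex.exp (2 * Real.pi * Complex.I * τ)) * y)) :
    x = (if c then ∑' r, G.term a w τ r else 0) + y := by
  by_cases hcc : c
  -- Here nothing is cleared, so `G = F - S` is a difference of convergent series; its convergence
  -- is deduced, not assumed.
  · have hD : denom Z L = 1 := by simp [denom, hL (hc hcc)]
    have hd : denomVal Z L (Complex.exp (2 * Real.pi * Complex.I * τ)) = 1 := by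
      simp [denomVal, hL (hc hcc)]
    simp only [hD, hd, one_mul] at hS
    rw [if_pos hcc] at hFS ⊢
    have hG := hasSum_term_sub hF hS
    have hGF : G = F - fun e => S e := by
      rw [hFS]
      exact (add_sub_cancel_right G S).symm
    rw [← hGF] at hG
    rw [hG.tsum_eq]
    ring
  · rw [if_neg hcc, zero_add] at hFS ⊢
    subst hFS
    -- The cleared series is summed in two ways, and the nonzero value of `denom` is cancelled.
    exact mul_left_cancel₀ h.denomVal_ne_zero
      ((hasSum_term_mul hF (evalAt_denom Z L _)).unique hS)

lemma hasSum_denom_mul_mulRatio {F : Formal n} {a : ℂ} {w : Fin n → ℂ} {τ x Z : ℂ} {L : ℕ} {r : ℝ}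
    (h : Clears Z (Complex.exp (2 * Real.pi * Complex.I * τ)) L r) {s t : Fin n}
    (h1 : ‖Complex.exp (2 * Real.pi * Complex.I * τ)‖ < ‖Complex.exp (w s - w t)‖)
    (h2 : ‖Complex.exp (w s - w t)‖ < 1) {k : ℕ} (hk : 1 ≤ k) (hvf : F.VanishesFar s t)
    (hF : HasSum (F.term a w τ) x) :
    HasSum (Formal.term (fun e => denom Z L * mulRatio (formalP k Z) s t F e) a w τ)
      (denomVal Z L (Complex.exp (2 * Real.pi * Complex.I * τ)) *
        (twistedP k (w s - w t) Z τ * x)) := by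
  rw [mul_mulRatio hvf (X_pow_dvd_formalP k Z), ← mul_assoc]
  exact hasSum_mulRatio hF (h.hasSum_formalP h1 h2 hk)
    (hvf.finite_support fun l hl => (X_pow_dvd_formalP k Z l hl).mul_left _)

end Formal

namespace VOAModule

variable {V M : Type*} [AddCommGroup V] [Module ℂ V] [AddCommGroup M] [Module ℂ M]
  {A : VOA V} {X : VOAModule A M} {n m : ℕ} {h : Fin m → V} (hH : ConditionH X h) (z : Fin m → ℂ)

/-- Inserting the vacuum changes nothing, so convergence of all `(n+1)`-point functions implies that
of the `n`-point functions on the right of (a). -/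
lemma nPoint_cons_vac (u : Fin n → V) :
    nPoint hH z (Fin.cons A.vac u : Fin (n + 1) → V) = (nPoint hH z u).extend := by
  funext e
  obtain ⟨a, e, rfl⟩ : ∃ a e', e = (Fin.cons a e' : Fin (n + 1) → ℤ) :=
    ⟨e 0, Fin.tail e, (Fin.cons_self_tail e).symm⟩
  rw [nPoint_apply, opProd_cons, coefOp_vac, Formal.extend, Fin.cons_zero, Fin.tail_cons]
  split_ifs
  · rw [one_mul, nPoint_apply]
  · rw [zero_mul, zero_mul, gradedTrace_zero]

variable {w : Fin (n + 1) → ℂ} {τ : ℂ}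

lemma ConvergesAt.hasSum {n : ℕ} {w : Fin n → ℂ} (hconv : ConvergesAt hH z w τ) (u : Fin n → V) :
    HasSum ((nPoint hH z u).term (X.wt - A.c / 24) w τ) (X.value (nPoint hH z u) w τ) :=
  (hconv u).hasSum

lemma ConvergesAt.hasSum_extend (hconv : ConvergesAt hH z w τ) (u : Fin n → V) :
    HasSum ((nPoint hH z u).extend.term (X.wt - A.c / 24) w τ)
      (X.value (nPoint hH z u) (Fin.tail w) τ) := by
  have := hconv.hasSum hH z (Fin.cons A.vac u)
  rwa [nPoint_cons_vac, value, Formal.tsum_term_extend] at this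

lemma value_zero {n : ℕ} (w : Fin n → ℂ) : X.value (0 : Formal n) w τ = 0 :=
  (Formal.hasSum_term_zero _ _ _).tsum_eq

variable {v : V} {μ : Fin m → ℂ}

/-- The recursion for an additional point, for the values. -/
theorem value_nPoint_cons (hv : ∀ j, A.mode (h j) 0 v = μ j • v) (hτ : 0 < τ.im)
    (hw : ∀ s : Fin n,
      ‖Complex.exp (2 * Real.pi * Complex.I * τ)‖ < ‖Complex.exp (w s.succ - w 0)‖ ∧
        ‖Complex.exp (w s.succ - w 0)‖ < 1)
    (hZ : ∀ a b : ℤ, ∑ j, z j * μ j = a + b * τ → b = 0) (hconv : ConvergesAt hH z w τ)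
    (u : Fin n → V) :
    X.value (nPoint hH z (Fin.cons v u : Fin (n + 1) → V)) w τ =
      (if IsInt (∑ j, z j * μ j) then
        X.value (zeroModePoint hH z v u) (Fin.tail w) τ else 0) +
      ∑ s : Fin n, ∑ᶠ k : ℕ, twistedP (k + 1) (w s.succ - w 0) (∑ j, z j * μ j) τ *
        X.value (nPoint hH z (Function.update u s (A.sq v k (u s)))) (Fin.tail w) τ := by
  obtain ⟨L, r, hcl, hL⟩ := exists_clears hτ hZ
  obtain ⟨K, hK⟩ := (Filter.eventually_all.mpr fun s : Fin n =>
    A.eventually_sq_eq_zero v (u s)).exists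
  rw [Finset.sum_congr rfl fun s _ => finsum_eq_sum_range (K := K) fun k hk => by
    rw [hK s k hk, nPoint_update_zero, value_zero, mul_zero]]
  have hformal := nPoint_cons_formal hH z hv u
  rw [Finset.sum_congr rfl fun s _ => finsum_eq_sum_range (K := K) fun k hk => by
    rw [hK s k hk, nPoint_update_zero, Formal.extend_zero, Formal.mulRatio_zero]] at hformal
  have hval := Formal.value_eq_of_denom hcl hL (fun hc => hc) hformal
    (hconv.hasSum hH z (Fin.cons v u)) (y := ∑ s : Fin n, ∑ k ∈ Finset.range K,
      twistedP (k + 1) (w s.succ - w 0) (∑ j, z j * μ j) τ *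
        X.value (nPoint hH z (Function.update u s (A.sq v k (u s)))) (Fin.tail w) τ) ?_
  · rw [hval, Formal.tsum_term_extend, value]
  · have hs := Formal.hasSum_term_sum (S := Finset.univ) fun (s : Fin n) _ =>
      Formal.hasSum_term_sum (S := Finset.range K) fun (k : ℕ) _ =>
        Formal.hasSum_denom_mul_mulRatio hcl (hw s).1 (hw s).2 (Nat.le_add_left 1 k)
          (Formal.vanishesFar_extend _ s)
          (hconv.hasSum_extend hH z (Function.update u s (A.sq v k (u s))))
    simp only [← Finset.mul_sum] at hs
    refine (congrArg (fun F => HasSum (Formal.term F _ w τ) _) (funext fun e => ?_)).mpr hs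
    simp only [Finset.sum_apply, Finset.mul_sum]

/-- The recursion for `v[-p]u₁`, for the values. -/
theorem value_nPoint_sq_neg (hv : ∀ j, A.mode (h j) 0 v = μ j • v) (hτ : 0 < τ.im)
    (hw : ∀ s : Fin n,
      ‖Complex.exp (2 * Real.pi * Complex.I * τ)‖ < ‖Complex.exp (w s.succ - w 0)‖ ∧
        ‖Complex.exp (w s.succ - w 0)‖ < 1)
    (hZ : ∀ a b : ℤ, ∑ j, z j * μ j = a + b * τ → b = 0) (hconv : ConvergesAt hH z w τ)
    (u : Fin (n + 1) → V) (p : ℕ) (hp : 1 ≤ p) :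
    X.value (nPoint hH z (Function.update u 0 (A.sq v (-p) (u 0)))) w τ =
      (if IsInt (∑ j, z j * μ j) ∧ p = 1 then
        X.value (zeroModePoint hH z v u) w τ else 0) +
      (-1) ^ (p + 1) * (∑ᶠ k : ℕ,
        ((k + p - 1).choose (p - 1) : ℂ) * twistedE (k + p) τ (∑ j, z j * μ j) *
          X.value (nPoint hH z (Function.update u 0 (A.sq v k (u 0)))) w τ) +
      (-1) ^ (p + 1) * ∑ s : Fin n, ∑ᶠ k : ℕ,
        ((k + p - 1).choose (p - 1) : ℂ) *
          twistedP (k + p) (w s.succ - w 0) (∑ j, z j * μ j) τ *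
          X.value (nPoint hH z (Function.update u s.succ (A.sq v k (u s.succ)))) w τ := by
  obtain ⟨L, r, hcl, hL⟩ := exists_clears hτ hZ
  obtain ⟨K, hK⟩ := (Filter.eventually_all.mpr fun s : Fin (n + 1) =>
    A.eventually_sq_eq_zero v (u s)).exists
  rw [Finset.sum_congr rfl fun s _ => finsum_eq_sum_range (K := K) fun k hk => by
    rw [hK s.succ k hk, nPoint_update_zero, value_zero, mul_zero]]
  rw [finsum_eq_sum_range (K := K) fun k hk => by
    rw [hK 0 k hk, nPoint_update_zero, value_zero, mul_zero]]
  have hformal := nPoint_sq_neg_formal hH z hv u p hp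
  rw [finsum_eq_sum_range (K := K) fun k hk => by
    rw [hK 0 k hk, nPoint_update_zero]; funext e; simp] at hformal
  rw [Finset.sum_congr rfl fun s _ => finsum_eq_sum_range (K := K) fun k hk => by
    rw [hK s.succ k hk, nPoint_update_zero, Formal.mulRatio_zero]; funext e; simp] at hformal
  rw [add_assoc, ← mul_add] at hformal ⊢
  refine Formal.value_eq_of_denom hcl hL And.left hformal (hconv.hasSum hH z _) ?_
  have hE (k : ℕ) := Formal.hasSum_term_C_mul ((k + p - 1).choose (p - 1) : ℂ)
    (Formal.hasSum_term_mul (hconv.hasSum hH z (Function.update u 0 (A.sq v k (u 0))))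
      (hcl.evalAt_formalE hτ (k := k + p) (by lia)))
  have hP (s : Fin n) (k : ℕ) := Formal.hasSum_term_C_mul ((k + p - 1).choose (p - 1) : ℂ)
    (Formal.hasSum_denom_mul_mulRatio hcl (hw s).1 (hw s).2 (k := k + p) (by lia)
      (vanishesFar_nPoint hH z _ s)
      (hconv.hasSum hH z (Function.update u s.succ (A.sq v k (u s.succ)))))
  have hs := Formal.hasSum_term_C_mul ((-1) ^ (p + 1))
    (Formal.hasSum_term_add (Formal.hasSum_term_sum (S := Finset.range K) fun k _ => hE k)
      (Formal.hasSum_term_sum (S := Finset.univ) fun s _ =>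
        Formal.hasSum_term_sum (S := Finset.range K) fun k _ => hP s k))
  generalize denomVal (∑ j, z j * μ j) L (Complex.exp (2 * Real.pi * Complex.I * τ)) = d at hs ⊢
  refine (congrArg₂ (fun F x => HasSum (Formal.term F _ w τ) x) (funext fun e => ?_) ?_).mpr hs
  · simp only [Pi.add_apply, Pi.mul_apply, Pi.pow_apply, Pi.neg_apply, Pi.one_apply,
      Finset.sum_apply, map_pow, map_neg, map_one, map_natCast]
    rw [mul_left_comm]
    refine congrArg₂ (· * ·) rfl ?_
    simp only [mul_add, Finset.mul_sum]
    refine congrArg₂ (· + ·) (Finset.sum_congr rfl fun k _ => ?_)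
      (Finset.sum_congr rfl fun s _ => Finset.sum_congr rfl fun k _ => ?_)
    · ring
    · ring
  · rw [mul_left_comm]
    refine congrArg₂ (· * ·) rfl ?_
    simp only [mul_add, Finset.mul_sum]
    refine congrArg₂ (· + ·) (Finset.sum_congr rfl fun k _ => ?_)
      (Finset.sum_congr rfl fun s _ => Finset.sum_congr rfl fun k _ => ?_)
    · ring
    · ring

end VOAModule

end JacobiTrace

end

open JacobiTrace Classical in
theorem mainTheorem4 {V M : Type*} [AddCommGroup V] [Module ℂ V] [AddCommGroup M] [Module ℂ M]
    (A : VOA V) (X : VOAModule A M) {m : ℕ} (h : Fin m → V) (hH : ConditionH X h)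
    (z : Fin m → ℂ) (v : V) (μ : Fin m → ℂ) (hv : ∀ j, A.mode (h j) 0 v = μ j • v) :
    -- the recursion for an additional point, as an identity of formal series
    (∀ (n : ℕ) (u : Fin n → V),
      X.nPoint hH z (Fin.cons v u : Fin (n + 1) → V) =
        (if IsInt (∑ j, z j * μ j) then (VOAModule.zeroModePoint hH z v u).extend else 0) +
        ∑ s : Fin n, ∑ᶠ k : ℕ,
          Formal.mulRatio (formalP (k + 1) (∑ j, z j * μ j)) s.succ 0
            (VOAModule.nPoint hH z (Function.update u s (A.sq v k (u s)))).extend) ∧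
    -- the recursion for `v[-p]u₁`, as an identity of formal series
    (∀ (n : ℕ) (u : Fin (n + 1) → V) (p : ℕ), 1 ≤ p →
      VOAModule.nPoint hH z (Function.update u 0 (A.sq v (-p) (u 0))) =
        (if IsInt (∑ j, z j * μ j) ∧ p = 1 then VOAModule.zeroModePoint hH z v u else 0) +
        (-1) ^ (p + 1) * (∑ᶠ k : ℕ, fun e =>
          ((k + p - 1).choose (p - 1) : PowerSeries ℂ) * formalE (k + p) (∑ j, z j * μ j) *
            VOAModule.nPoint hH z (Function.update u 0 (A.sq v k (u 0))) e) +
        (-1) ^ (p + 1) * ∑ s : Fin n, ∑ᶠ k : ℕ, fun e =>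
          ((k + p - 1).choose (p - 1) : PowerSeries ℂ) *
            Formal.mulRatio (formalP (k + p) (∑ j, z j * μ j)) s.succ 0
              (VOAModule.nPoint hH z (Function.update u s.succ (A.sq v k (u s.succ)))) e) ∧
    -- the same two recursions for the values of the functions, wherever they converge
    (∀ (n : ℕ) (w : Fin (n + 1) → ℂ) (τ : ℂ), 0 < τ.im →
      (∀ s : Fin n, ‖Complex.exp (2 * Real.pi * Complex.I * τ)‖ < ‖Complex.exp (w s.succ - w 0)‖ ∧
        ‖Complex.exp (w s.succ - w 0)‖ < 1) →
      (∀ a b : ℤ, ∑ j, z j * μ j = a + b * τ → b = 0) →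
      VOAModule.ConvergesAt hH z w τ →
      (∀ u : Fin n → V,
        X.value (VOAModule.nPoint hH z (Fin.cons v u : Fin (n + 1) → V)) w τ =
          (if IsInt (∑ j, z j * μ j) then
            X.value (VOAModule.zeroModePoint hH z v u) (Fin.tail w) τ else 0) +
          ∑ s : Fin n, ∑ᶠ k : ℕ, twistedP (k + 1) (w s.succ - w 0) (∑ j, z j * μ j) τ *
            X.value (VOAModule.nPoint hH z (Function.update u s (A.sq v k (u s))))
              (Fin.tail w) τ) ∧
      (∀ (u : Fin (n + 1) → V) (p : ℕ), 1 ≤ p →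
        X.value (VOAModule.nPoint hH z (Function.update u 0 (A.sq v (-p) (u 0)))) w τ =
          (if IsInt (∑ j, z j * μ j) ∧ p = 1 then
            X.value (VOAModule.zeroModePoint hH z v u) w τ else 0) +
          (-1) ^ (p + 1) * (∑ᶠ k : ℕ,
            ((k + p - 1).choose (p - 1) : ℂ) * twistedE (k + p) τ (∑ j, z j * μ j) *
              X.value (VOAModule.nPoint hH z (Function.update u 0 (A.sq v k (u 0)))) w τ) +
          (-1) ^ (p + 1) * ∑ s : Fin n, ∑ᶠ k : ℕ,
            ((k + p - 1).choose (p - 1) : ℂ) *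
              twistedP (k + p) (w s.succ - w 0) (∑ j, z j * μ j) τ *
              X.value (VOAModule.nPoint hH z
                (Function.update u s.succ (A.sq v k (u s.succ)))) w τ)) := by
  exact ⟨fun n u => VOAModule.nPoint_cons_formal hH z hv u,
    fun n u p hp => VOAModule.nPoint_sq_neg_formal hH z hv u p hp,
    fun n w τ hτ hw hZ hconv =>
      ⟨fun u => VOAModule.value_nPoint_cons hH z hv hτ hw hZ hconv u,
        fun u p hp => VOAModule.value_nPoint_sq_neg hH z hv hτ hw hZ hconv u p hp⟩⟩
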